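/- Let $k$ be an algebraically closed field. A $k$-category is a small category whose morphism sets are $k$-vector spaces and whose composition is $k$-bilinear; functors between $k$-categories are $k$-linear. A $k$-category $\mathcal C$ is connected if its objects cannot be split into two non-empty parts with no non-zero morphism between them in either direction. It is locally bounded if distinct objects are not isomorphic, each endomorphism algebra $\mathcal C(x,x)$ is local, and $\bigoplus_{y}\mathcal C(x,y)$ and $\bigoplus_y\mathcal C(y,x)$ are finite dimensional for every object $x$. A $\mathcal C$-module is a $k$-linear functor from $\mathcal C$ to $k$-vector spaces; it is finite dimensional if the direct sum of its values is. A basic finite dimensional $k$-algebra is regarded as a locally bounded $k$-category with finitely many objects (the elements of a complete set of primitive orthogonal idempotents). A module is basic if it is a finite direct sum of pairwise non-isomorphic finite dimensional indecomposable modules. A finite dimensional $\mathcal C$-module $T$ is tilting if it has finite projective dimension, $\mathrm{Ext}^i_{\mathcal C}(T,T)=0$ for all $i>0$, and there is an exact sequence $0\to\mathcal C\to T_1\to\cdots\to T_r\to 0$ where each $T_i$ is a finite direct sum of direct summands of $T$ and $\mathcal C$ denotes the regular module $x\mapsto\bigoplus_y\mathcal C(y,x)$. Let $G$ be a group. A Galois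 covering $F\colon\mathcal E\to\mathcal B$ with group $G$ is a $k$-linear functor with a group morphism from $G$ to the group of $k$-linear automorphisms $g$ of $\mathcal E$ with $F\circ g=F$, such that $G$ acts freely on the objects of $\mathcal E$ and the functor $\mathcal E/G\to\mathcal B$ induced by $F$ is an isomorphism, where $\mathcal E/G$ is the quotient in the category of $k$-categories. It is connected if $\mathcal E$ is connected and locally bounded. For a $\mathcal B$-module $M$, put $F.M=M\circ F$. For an $\mathcal E$-module $N$, the push-down $F_\lambda N$ is the $\mathcal B$-module with $(F_\lambda N)(b)=\bigoplus_{F(x)=b}N(x)$ such that, for every morphism $u\colon x\to y$ of $\mathcal E$, the restriction of $(F_\lambda N)(F(u))$ to the summand $N(x)$ is $N(u)\colon N(x)\to N(y)$. A $\mathcal B$-module $M$ is of the first kind with respect to $F$ if every indecomposable direct summand of $M$ is isomorphic to $F_\lambda N$ for some $\mathcal E$-module $N$. **Lemma.** Let $A$ be a basic connected finite dimensional $k$-algebra, let $G$ be a finite group, let $F\colon A'\to A$ be a connected Galois covering with group $G$, and let $T$ be a basic tilting $A$-module of the first kind with respect to $F$. Then $F.T$ is a tilting $A'$-module and is basic.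 -/

import Mathlib

open CategoryTheory CategoryTheory.Limits

universe u w

namespace GaloisTilting

/-! ## `k`-categories

A `k`-category is a small category `C` with instances `Preadditive C` and `Linear k C`.  A functor
between `k`-categories is `k`-linear if it is `Additive` and `Linear k`. -/

section Categories

variable (k : Type u) [Field k] (C : Type u) [Category.{u} C] [Preadditive C] [Linear k C]

/-- `C` is connected: whenever the objects are split into a set `S` and its complement with no
nonzero morphism between the two parts in either direction, one of the two parts is empty. -/
def IsConnectedCat (C : Type u) [Category.{u} C] [Preadditive C] : Prop :=
  ∀ S : Set C,
    (∀ x ∈ S, ∀ y ∉ S, (∀ f : x ⟶ y, f = 0) ∧ (∀ f : y ⟶ x, f = 0)) → S = ∅ ∨ S = Set.univ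

/-- Locally bounded `k`-categories. -/
structure IsLocallyBounded : Prop where
  /-- distinct objects are not isomorphic -/
  eq_of_iso : ∀ x y : C, Nonempty (x ≅ y) → x = y
  /-- the sum of all morphism spaces out of `x` is finite dimensional -/
  finite_out : ∀ x : C, Module.Finite k (DirectSum C fun y => (x ⟶ y))
  /-- the sum of all morphism spaces into `x` is finite dimensional -/
  finite_in : ∀ x : C, Module.Finite k (DirectSum C fun y => (y ⟶ x))
  /-- the endomorphism algebra of each object is local -/
  isLocalRing_end : ∀ x : C, IsLocalRing (End x)

end Categories

/-! ## Modules over `k`-categories -/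

section Modules

variable (k : Type u) [Field k] (C : Type u) [Category.{u} C] [Preadditive C] [Linear k C]

/-- The property of a functor `C ⥤ ModuleCat k` of being `k`-linear. -/
def isLinear : ObjectProperty (C ⥤ ModuleCat.{u} k) :=
  fun M => M.Additive ∧ M.Linear k

/-- The category `MOD(C)` of (left) `C`-modules: `k`-linear functors from `C` to `k`-vector spaces,
with natural transformations as morphisms. -/
abbrev LinMod := (isLinear k C).FullSubcategory

/-- A functor with a pointwise jointly injective family of natural maps to linear functors is
linear. -/
lemma isLinear_of_jointly_mono {M : C ⥤ ModuleCat.{u} k} {J : Type*}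
    (N : J → (C ⥤ ModuleCat.{u} k)) (hN : ∀ j, isLinear k C (N j)) (p : ∀ j, M ⟶ N j)
    (hp : ∀ (x : C) (a b : M.obj x), (∀ j, ((p j).app x).hom a = ((p j).app x).hom b) → a = b) :
    isLinear k C M := by
  have nat : ∀ (j : J) {x y : C} (f : x ⟶ y) (a : M.obj x),
      ((p j).app y).hom ((M.map f).hom a) = ((N j).map f).hom (((p j).app x).hom a) := by
    intro j x y f a
    have := congrArg (fun t => t.hom a) ((p j).naturality f)
    simpa using this
  constructor
  · constructor
    intro x y f g
    ext a
    refine hp _ _ _ fun j => ?_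
    have := (hN j).1
    have e : (N j).map (f + g) = (N j).map f + (N j).map g := Functor.map_add _
    simp only [ModuleCat.hom_add, LinearMap.add_apply, map_add, nat, e]
  · constructor
    intro x y f r
    ext a
    refine hp _ _ _ fun j => ?_
    have := (hN j).2
    have e : (N j).map (r • f) = r • (N j).map f := Functor.Linear.map_smul f r
    simp only [ModuleCat.hom_smul, LinearMap.smul_apply, map_smul, nat, e]

instance : (isLinear k C).IsClosedUnderSubobjects where
  prop_of_mono {M N} i _ hN := by
    refine isLinear_of_jointly_mono k C (J := Unit) (fun _ => N) (fun _ => hN) (fun _ => i) ?_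
    intro x a b h
    exact (ModuleCat.mono_iff_injective (i.app x)).1 inferInstance (h ())

instance : (isLinear k C).IsClosedUnderQuotients where
  prop_of_epi {M N} q _ hM := by
    have nat : ∀ {x y : C} (f : x ⟶ y) (a : M.obj x),
        (q.app y).hom ((M.map f).hom a) = (N.map f).hom ((q.app x).hom a) := by
      intro x y f a
      have := congrArg (fun t => t.hom a) (q.naturality f)
      simpa using this
    have surj : ∀ x, Function.Surjective (q.app x).hom := fun x =>
      (ModuleCat.epi_iff_surjective (q.app x)).1 inferInstance
    have := hM.1
    have := hM.2
    constructor
    · constructor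
      intro x y f g
      ext b
      obtain ⟨a, rfl⟩ := surj x b
      have e : M.map (f + g) = M.map f + M.map g := Functor.map_add _
      simp only [ModuleCat.hom_add, LinearMap.add_apply, map_add, ← nat, e]
    · constructor
      intro x y f r
      ext b
      obtain ⟨a, rfl⟩ := surj x b
      have e : M.map (r • f) = r • M.map f := Functor.Linear.map_smul f r
      simp only [ModuleCat.hom_smul, LinearMap.smul_apply, map_smul, ← nat, e]

instance : (isLinear k C).IsClosedUnderFiniteProducts where
  isClosedUnderLimitsOfShape J _ :=
    { limitsOfShape_le := by
        rintro M ⟨⟨⟨D, π, hl⟩, hD⟩⟩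
        refine isLinear_of_jointly_mono k C (J := Discrete J) (fun j => D.obj j) hD
          (fun j => π.app j) ?_
        intro x a b h
        have hx := isLimitOfPreserves ((evaluation C (ModuleCat.{u} k)).obj x) hl
        let fa : ModuleCat.of k k ⟶ M.obj x :=
          ModuleCat.ofHom (LinearMap.toSpanSingleton k _ a)
        let fb : ModuleCat.of k k ⟶ M.obj x :=
          ModuleCat.ofHom (LinearMap.toSpanSingleton k _ b)
        have hab : fa = fb := by
          refine hx.hom_ext fun j => ?_
          ext
          have hj := h j
          simpa [fa, fb] using hj
        have := congrArg (fun f => f.hom (1 : k)) hab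
        simpa [fa, fb] using this }

instance : (isLinear k C).ContainsZero where
  exists_zero := by
    obtain ⟨Z, hZ⟩ := HasZeroObject.zero (C := C ⥤ ModuleCat.{u} k)
    refine ⟨Z, hZ, ?_⟩
    refine isLinear_of_jointly_mono k C (J := Empty) (fun j => j.elim) (fun j => j.elim)
      (fun j => j.elim) fun x a b _ => ?_
    have hz : IsZero (Z.obj x) := hZ.obj x
    have := ModuleCat.subsingleton_of_isZero hz
    exact Subsingleton.elim a b

/-- `C`-modules form an abelian category. -/
noncomputable instance : Abelian (LinMod k C) := inferInstance

instance : HasFiniteBiproducts (LinMod k C) := Abelian.hasFiniteBiproducts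

variable {k C}

/-- A `C`-module `M` is finite dimensional if the direct sum of all the `M(x)` is. -/
def IsFinDim (M : LinMod k C) : Prop :=
  Module.Finite k (DirectSum C fun x => M.obj.obj x)

/-- `N` is (isomorphic to) a direct summand of `M`. -/
def IsSummand (N M : LinMod k C) : Prop :=
  ∃ N' : LinMod k C, Nonempty (M ≅ N ⊞ N')

/-- A `C`-module is basic if it is a finite direct sum of pairwise non-isomorphic finite dimensional
indecomposable modules. -/
def IsBasic (M : LinMod k C) : Prop :=
  ∃ (t : ℕ) (N : Fin t → LinMod k C),
    (∀ i, IsFinDim (N i) ∧ Indecomposable (N i)) ∧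
    Nonempty (M ≅ biproduct N) ∧
    ∀ i j, i ≠ j → ¬ Nonempty (N i ≅ N j)

/-- `add(T)`: the modules that are finite direct sums of direct summands of `T`. -/
def InAdd (T X : LinMod k C) : Prop :=
  ∃ (m : ℕ) (N : Fin m → LinMod k C), (∀ i, IsSummand (N i) T) ∧ Nonempty (X ≅ biproduct N)

/-- `X` admits an exact sequence `0 → X → T₁ → ⋯ → T_r → 0` with all `T_i` in `add(T)`; the long
exact sequence is spliced from short exact sequences `0 → X_{i-1} → T_i → X_i → 0`, where
`X_0 = X` and `X_{r-1} ≅ T_r`. -/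
inductive HasAddCoresolution (T : LinMod k C) : LinMod k C → Prop
  | of_inAdd (X : LinMod k C) (hX : InAdd T X) : HasAddCoresolution T X
  | splice {X Y Z : LinMod k C} (f : X ⟶ Y) (g : Y ⟶ Z) (w : f ≫ g = 0)
      (hS : (ShortComplex.mk f g w).ShortExact) (hY : InAdd T Y)
      (hZ : HasAddCoresolution T Z) : HasAddCoresolution T X

open Classical in
variable (k C) in
/-- The regular module of `C`: the direct sum over all objects `y` of the representable modules
`x ↦ (y ⟶ x)`, a morphism of `C` acting by composition. When `C` is the category attached to a
basic finite dimensional algebra `A`, this is `A` as a left module over itself. -/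
def regularModule : LinMod k C where
  obj :=
    { obj := fun x => ModuleCat.of k (DirectSum C fun y => (y ⟶ x))
      map := fun f => ModuleCat.ofHom
        (DirectSum.lmap fun y => Linear.rightComp k y f)
      map_id := fun x => by
        ext : 1
        refine DirectSum.linearMap_ext _ fun y => ?_
        ext g : 1
        simp
      map_comp := fun f g => by
        ext : 1
        refine DirectSum.linearMap_ext _ fun y => ?_
        ext h : 1
        simp }
  property := by
    constructor
    · constructor
      intro x y f g
      ext : 1
      refine DirectSum.linearMap_ext _ fun z => ?_
      ext h : 1
      simp
    · constructor
      intro x y f r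
      ext : 1
      refine DirectSum.linearMap_ext _ fun z => ?_
      ext h : 1
      simp

/-- Tilting modules (of arbitrary finite projective dimension). -/
structure IsTilting (T : LinMod k C) : Prop where
  isFinDim : IsFinDim T
  /-- `T` has finite projective dimension -/
  finite_pd : ∃ n : ℕ, HasProjectiveDimensionLE T n
  /-- `T` is selforthogonal: `Ext^i(T, T) = 0` for `i > 0` -/
  ext_eq_zero : ∀ i : ℕ, 0 < i →
    letI := HasExt.standard (LinMod k C)
    Subsingleton (Abelian.Ext.{u + 1} T T i)
  /-- the regular module has a finite coresolution in `add(T)` -/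
  coresolution : HasAddCoresolution T (regularModule k C)

end Modules

/-! ## Galois coverings -/

section Coverings

variable (k : Type u) [Field k]
variable {E : Type u} [Category.{u} E] [Preadditive E] [Linear k E]
variable {B : Type u} [Category.{u} B] [Preadditive B] [Linear k B]

/-- A group morphism from `G` to the group of `k`-linear automorphisms of the `k`-category `E`
(the laws force every `act g` to be an automorphism, with inverse `act g⁻¹`). -/
structure CatAction (G : Type w) [Group G] (E : Type u) [Category.{u} E] [Preadditive E]
    [Linear k E] where
  act : G → (E ⥤ E)
  act_one : act 1 = 𝟭 E
  act_mul : ∀ g h : G, act (g * h) = act h ⋙ act g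
  additive : ∀ g, (act g).Additive
  linear : ∀ g, (act g).Linear k

/-- A `k`-linear functor `F : E ⥤ B`, together with a group morphism `ρ` from `G` to the
automorphisms of `E`, is a Galois covering with group `G` if `ρ g ⋙ F = F` for all `g`, the action
on objects is free, and `F` is the quotient of `E` by `G` in the category of `k`-categories,
i.e. the functor `E/G ⥤ B` induced by `F` is an isomorphism. -/
structure IsGaloisCovering {G : Type w} [Group G] (ρ : CatAction k G E) (F : E ⥤ B) : Prop where
  additive : F.Additive
  linear : F.Linear k
  /-- `G` acts freely on the objects of `E` -/
  free : ∀ (g : G) (x : E), (ρ.act g).obj x = x → g = 1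
  /-- `G` acts by automorphisms of the functor `F` -/
  comp_eq : ∀ g : G, ρ.act g ⋙ F = F
  /-- every `G`-invariant `k`-linear functor on `E` factors uniquely through `F` -/
  existsUnique_fac : ∀ (D : Type u) [Category.{u} D] [Preadditive D] [Linear k D] (H : E ⥤ D),
    H.Additive → H.Linear k → (∀ g : G, ρ.act g ⋙ H = H) →
      ∃! H' : B ⥤ D, H'.Additive ∧ H'.Linear k ∧ F ⋙ H' = H

variable {k}

/-- The pull-up `F.M = M ∘ F` of a `B`-module along a `k`-linear functor `F : E ⥤ B`. -/
def pullUp (F : E ⥤ B) (hF : F.Additive) (hF' : F.Linear k) (M : LinMod k B) : LinMod k E where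
  obj := F ⋙ M.obj
  property := by
    have := M.property.1
    have := M.property.2
    exact ⟨inferInstance, inferInstance⟩

open Classical in
/-- `IsPushDown F L N` says that `N ≅ F_λ L`, where `F_λ L` is the push-down of the `E`-module `L`:
for every object `b` of `B` there is an isomorphism `⨁_{F x = b} L(x) ≅ N(b)`, given on the summand
at `x` by `j_x : L(x) → N(F x) = N(b)`, and for every morphism `u : x ⟶ y` of `E` the map `N(F u)`
restricts on the summand `L(x)` to `L(u) : L(x) → L(y)`; the latter is the naturality of `j`. -/
def IsPushDown (F : E ⥤ B) (L : LinMod k E) (N : LinMod k B) : Prop :=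
  ∃ j : L.obj ⟶ F ⋙ N.obj, ∀ b : B,
    Function.Bijective
      (DirectSum.toModule k {x : E // F.obj x = b} (N.obj.obj b)
        (M := fun x : {x : E // F.obj x = b} => L.obj.obj x.1)
        fun x : {x : E // F.obj x = b} => (N.obj.map (eqToHom x.2)).hom ∘ₗ (j.app x.1).hom)

/-- A `B`-module `M` is of the first kind with respect to `F : E ⥤ B` if every indecomposable direct
summand of `M` is isomorphic to the push-down of some `E`-module. -/
def IsFirstKind (F : E ⥤ B) (M : LinMod k B) : Prop :=
  ∀ N : LinMod k B, Indecomposable N → IsSummand N M → ∃ L : LinMod k E, IsPushDown F L N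

end Coverings

end GaloisTilting

/-! Tilting. The pull-up along `F` is exact and sends the regular module of `A` to that of `A'`
(`nonempty_reg_iso`). Hence it preserves projectivity of finitely generated modules, bounds on
projective dimension, and coresolutions in `add T`. Morphisms `F.X ⟶ L` come from morphisms `X ⟶ F_λ
L` (`PushDownData.exists_lift`), so by dimension shifting the vanishing of all positive `Ext(X, F_λ
L)` gives that of `Ext(F.X, L)` (`ext_pull_eq_zero`). Write `T` as the sum of indecomposables `N_i =
F_λ L_i`. The pull-up of `N_i` is the sum over `g` of the twists of `L_i` by `g`, and each twist
again has push-down `N_i`; self-orthogonality of `F.T` follows.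

Basic. The twists are indecomposable because push-down is faithful. If the twist of `L_i` by `g` is
isomorphic to the twist of `L_{i'}` by `g'`, then pushing down gives `N_i ≅ N_{i'}`, so `i = i'`,
and `L_i` is invariant under `g g'⁻¹`. It remains to see that stabilizers are trivial
(`eq_one_of_twist_iso`), which is an integer count in the style of Grothendieck groups. For a module
with a finite coresolution in `add (F.T)`, the alternating sum of the multiplicities of `L = L_i` in
its terms is well defined and additive (`CoresClass.eq`, `CoresClass.of_shortExact`). Let `φ z` be
this number for the module represented by `z`, and let `v z` be the alternating multiplicity of that
representable in a finite projective resolution of `L`. The class of `L` itself is `1`, so `1 = ∑ z,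
v z * φ z`. If `g` fixes `L`, then both `v` and `φ` are invariant under `g`; as `g` acts freely on
objects, its order divides the sum, that is, divides `1`.

A Galois covering is given only by a universal property. Concrete information about the morphisms of
`A` (`exists_matrix`, `column_eq_zero`) is extracted by applying that property to an explicit
category of orbits. -/

namespace GaloisTilting

/-! ### Retracts of finite sums of copies of an object -/

section AdditiveClosure

variable {C : Type*} [Category* C] [Preadditive C]

/-- The additive subgroup of the morphisms that are sums of morphisms factoring through `P`. -/
def factoringThrough (P X Y : C) : AddSubgroup (X ⟶ Y) :=
  AddSubgroup.closure {f | ∃ (a : X ⟶ P) (b : P ⟶ Y), a ≫ b = f}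

lemma comp_mem_factoringThrough {P X Y : C} (a : X ⟶ P) (b : P ⟶ Y) :
    a ≫ b ∈ factoringThrough P X Y :=
  AddSubgroup.subset_closure ⟨a, b, rfl⟩

/-- The induction principle for `IsInAdd`: to prove a property of `X` in `add P`, exhibit it as a
subgroup of endomorphisms, check it on composites through `P`, and evaluate at the identity. -/
lemma factoringThrough_le {P X Y : C} {H : AddSubgroup (X ⟶ Y)}
    (h : ∀ (a : X ⟶ P) (b : P ⟶ Y), a ≫ b ∈ H) : factoringThrough P X Y ≤ H := by
  refine (AddSubgroup.closure_le _).2 ?_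
  rintro _ ⟨a, b, rfl⟩
  exact h a b

lemma factoringThrough_comp {P X Y Z W : C} (g : Z ⟶ X) (h : Y ⟶ W) {f : X ⟶ Y}
    (hf : f ∈ factoringThrough P X Y) : g ≫ f ≫ h ∈ factoringThrough P Z W := by
  have : factoringThrough P X Y ≤ (factoringThrough P Z W).comap
      ((Preadditive.leftComp W g).comp (Preadditive.rightComp X h)) := by
    refine factoringThrough_le fun a b => ?_
    have := comp_mem_factoringThrough (P := P) (g ≫ a) (b ≫ h)
    rw [Category.assoc] at this
    change g ≫ (a ≫ b) ≫ h ∈ factoringThrough P Z W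
    rwa [Category.assoc]
  exact this hf

/-- `X` is a retract of a finite direct sum of copies of `P`, expressed by the condition that the
identity of `X` is a sum of morphisms factoring through `P`. -/
def IsInAdd (P X : C) : Prop := 𝟙 X ∈ factoringThrough P X X

namespace IsInAdd

variable {P Q X Y : C}

lemma self (P : C) : IsInAdd P P := by
  have := comp_mem_factoringThrough (𝟙 P) (𝟙 P)
  rwa [Category.id_comp] at this

lemma of_retract (h : Retract X Y) (hY : IsInAdd P Y) : IsInAdd P X := by
  have := factoringThrough_comp h.i h.r hY
  simpa [IsInAdd] using this

lemma of_iso (e : X ≅ Y) (hY : IsInAdd P Y) : IsInAdd P X := of_retract e.retract hY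

lemma of_isZero (h : IsZero X) : IsInAdd P X := by
  have : 𝟙 X = 0 := h.eq_of_src _ _
  rw [IsInAdd, this]
  exact zero_mem _

lemma of_sum {J : Type*} [Fintype J] (f : J → C) (a : ∀ j, X ⟶ f j) (b : ∀ j, f j ⟶ X)
    (hab : ∑ j, a j ≫ b j = 𝟙 X) (h : ∀ j, IsInAdd P (f j)) : IsInAdd P X := by
  rw [IsInAdd, ← hab]
  refine sum_mem fun j _ => ?_
  simpa using factoringThrough_comp (a j) (b j) (h j)

lemma biprod [HasBinaryBiproducts C] (hX : IsInAdd P X) (hY : IsInAdd P Y) :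
    IsInAdd P (X ⊞ Y) := by
  rw [IsInAdd, ← biprod.total]
  refine add_mem ?_ ?_
  · simpa using factoringThrough_comp (biprod.fst (X := X) (Y := Y)) biprod.inl hX
  · simpa using factoringThrough_comp (biprod.snd (X := X) (Y := Y)) biprod.inr hY

lemma biproduct [HasFiniteBiproducts C] {J : Type*} [Finite J] (f : J → C)
    (h : ∀ j, IsInAdd P (f j)) : IsInAdd P (⨁ f) := by
  have := Fintype.ofFinite J
  refine of_sum f (biproduct.π f) (biproduct.ι f) (biproduct.hom_ext' _ _ fun j => ?_) h
  rw [Preadditive.comp_sum, Finset.sum_eq_single j, biproduct.ι_π_self_assoc, Category.comp_id]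
  · intro i _ hi
    rw [biproduct.ι_π_ne_assoc _ (Ne.symm hi), zero_comp]
  · simp

lemma map {D : Type*} [Category* D] [Preadditive D] (F : C ⥤ D) [F.Additive] (h : IsInAdd P X) :
    IsInAdd (F.obj P) (F.obj X) := by
  have : factoringThrough P X X ≤ (factoringThrough (F.obj P) (F.obj X) (F.obj X)).comap
      (F.mapAddHom (X := X) (Y := X)) := by
    refine factoringThrough_le fun a b => ?_
    simpa using comp_mem_factoringThrough (F.map a) (F.map b)
  simpa [IsInAdd] using this h

lemma trans (hQ : IsInAdd P Q) (hX : IsInAdd Q X) : IsInAdd P X := by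
  refine (factoringThrough_le (H := factoringThrough P X X) fun a b => ?_) hX
  simpa using factoringThrough_comp a b hQ

/-- The endomorphisms of `X` whose composite with `f` lifts through `e` form a subgroup, and
projectivity of `P` puts every composite through `P` in it. -/
lemma projective [Projective P] (hX : IsInAdd P X) : Projective X := by
  refine ⟨fun {E Z} f e _ => ?_⟩
  let H : AddSubgroup (X ⟶ X) :=
    ((Preadditive.rightComp X e).range).comap (Preadditive.rightComp X f)
  have : factoringThrough P X X ≤ H := by
    refine factoringThrough_le fun a b => ?_
    refine ⟨a ≫ Projective.factorThru (b ≫ f) e, ?_⟩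
    change (a ≫ Projective.factorThru (b ≫ f) e) ≫ e = (a ≫ b) ≫ f
    simp
  obtain ⟨g, hg⟩ := this hX
  exact ⟨g, hg.trans (Category.id_comp f)⟩

end IsInAdd

end AdditiveClosure

/-! ### Vanishing of Ext and dimension shifting -/

section ExtVanishing

variable {C : Type*} [Category* C] [Abelian C] [HasExt.{w} C]

open Abelian

/-- Endomorphisms of `X` act additively on `Ext`, those through `P` act as zero, and the identity is
a sum of these. -/
lemma IsInAdd.ext_eq_zero_left {P X Y : C} {i : ℕ} (hX : IsInAdd P X)
    (h : Subsingleton (Ext.{w} P Y i)) : Subsingleton (Ext.{w} X Y i) := by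
  suffices H : ∀ e : Ext.{w} X Y i, e = 0 from ⟨fun a b => by rw [H a, H b]⟩
  intro e
  let φ : (X ⟶ X) →+ Ext.{w} X Y i :=
    AddMonoidHom.mk' (fun f => (Ext.mk₀ f).comp e (zero_add i)) fun f g => by
      rw [Ext.mk₀_add, Ext.add_comp]
  have : factoringThrough P X X ≤ φ.ker := by
    refine factoringThrough_le fun a b => ?_
    rw [AddMonoidHom.mem_ker]
    change (Ext.mk₀ (a ≫ b)).comp e (zero_add i) = 0
    rw [← Ext.mk₀_comp_mk₀, Ext.comp_assoc_of_second_deg_zero,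
      Subsingleton.elim ((Ext.mk₀ b).comp e (zero_add i)) 0, Ext.comp_zero]
  have h1 := this hX
  rw [AddMonoidHom.mem_ker] at h1
  change (Ext.mk₀ (𝟙 X)).comp e (zero_add i) = 0 at h1
  rwa [Ext.mk₀_id_comp] at h1

lemma IsInAdd.ext_eq_zero_right {P X Y : C} {i : ℕ} (hY : IsInAdd P Y)
    (h : Subsingleton (Ext.{w} X P i)) : Subsingleton (Ext.{w} X Y i) := by
  suffices H : ∀ e : Ext.{w} X Y i, e = 0 from ⟨fun a b => by rw [H a, H b]⟩
  intro e
  let φ : (Y ⟶ Y) →+ Ext.{w} X Y i :=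
    AddMonoidHom.mk' (fun f => e.comp (Ext.mk₀ f) (add_zero i)) fun f g => by
      rw [Ext.mk₀_add, Ext.comp_add]
  have : factoringThrough P Y Y ≤ φ.ker := by
    refine factoringThrough_le fun a b => ?_
    rw [AddMonoidHom.mem_ker]
    change e.comp (Ext.mk₀ (a ≫ b)) (add_zero i) = 0
    rw [← Ext.mk₀_comp_mk₀, ← Ext.comp_assoc_of_third_deg_zero,
      Subsingleton.elim (e.comp (Ext.mk₀ a) (add_zero i)) 0, Ext.zero_comp]
  have h1 := this hY
  rw [AddMonoidHom.mem_ker] at h1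
  change e.comp (Ext.mk₀ (𝟙 Y)) (add_zero i) = 0 at h1
  rwa [Ext.comp_mk₀_id] at h1

/-- The obstruction to extending `f` is its image under the connecting map to `Ext¹(X₃, Y)`. -/
lemma exists_extension {S : ShortComplex C} (hS : S.ShortExact) {Y : C}
    (h : Subsingleton (Ext.{w} S.X₃ Y 1)) (f : S.X₁ ⟶ Y) : ∃ g : S.X₂ ⟶ Y, S.f ≫ g = f := by
  obtain ⟨x, hx⟩ := Ext.contravariant_sequence_exact₁ hS Y (Ext.mk₀ f) (add_zero 1)
    (Subsingleton.elim _ _)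
  obtain ⟨g, rfl⟩ := Ext.homEquiv₀.symm.surjective x
  refine ⟨g, Ext.homEquiv₀.symm.injective ?_⟩
  simpa using hx

/-- Dimension shifting in the first variable. -/
lemma ext_eq_zero_X₁ {S : ShortComplex C} (hS : S.ShortExact) {Y : C} {i j : ℕ} (hij : 1 + i = j)
    (h₂ : Subsingleton (Ext.{w} S.X₂ Y i)) (h₃ : Subsingleton (Ext.{w} S.X₃ Y j)) :
    Subsingleton (Ext.{w} S.X₁ Y i) := by
  suffices H : ∀ e : Ext.{w} S.X₁ Y i, e = 0 from ⟨fun a b => by rw [H a, H b]⟩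
  intro e
  obtain ⟨x, rfl⟩ := Ext.contravariant_sequence_exact₁ hS Y e hij (Subsingleton.elim _ _)
  rw [Subsingleton.elim x 0, Ext.comp_zero]

lemma ext_eq_zero_X₃ {S : ShortComplex C} (hS : S.ShortExact) {Y : C} {i j : ℕ} (hij : 1 + i = j)
    (h₁ : Subsingleton (Ext.{w} S.X₁ Y i)) (h₂ : Subsingleton (Ext.{w} S.X₂ Y j)) :
    Subsingleton (Ext.{w} S.X₃ Y j) := by
  suffices H : ∀ e : Ext.{w} S.X₃ Y j, e = 0 from ⟨fun a b => by rw [H a, H b]⟩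
  intro e
  obtain ⟨x, rfl⟩ := Ext.contravariant_sequence_exact₃ hS Y e (Subsingleton.elim _ _) hij
  rw [Subsingleton.elim x 0, Ext.comp_zero]

/-- `Ext¹` vanishes as soon as morphisms extend along one short exact sequence with projective
middle term. -/
lemma ext_one_eq_zero_of_extension {S : ShortComplex C} (hS : S.ShortExact) [Projective S.X₂] {Y : C}
    (h : ∀ f : S.X₁ ⟶ Y, ∃ g : S.X₂ ⟶ Y, S.f ≫ g = f) : Subsingleton (Ext.{w} S.X₃ Y 1) := by
  suffices H : ∀ e : Ext.{w} S.X₃ Y 1, e = 0 from ⟨fun a b => by rw [H a, H b]⟩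
  intro e
  -- As `X₂` is projective, every class is the extension class composed with some `f : X₁ ⟶ Y`. If
  -- `f` extends over `S.f`, the product vanishes, since the extension class composed with `S.f` is
  -- zero.
  obtain ⟨x, rfl⟩ := Ext.contravariant_sequence_exact₃ hS Y e (Ext.eq_zero_of_projective _)
    (add_zero 1)
  obtain ⟨f, rfl⟩ := Ext.homEquiv₀.symm.surjective x
  obtain ⟨g, rfl⟩ := h f
  simp only [Ext.homEquiv₀_symm_apply]
  rw [← Ext.mk₀_comp_mk₀]
  exact hS.extClass_comp_assoc _

end ExtVanishing

/-! ### Schanuel's lemma and its dual -/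

section Schanuel

variable {C : Type*} [Category* C] [Abelian C]

/-- Adding an identity to the right part of a short exact sequence. -/
lemma shortExact_biprod_right {M X Z : C} {f : M ⟶ X} {g : X ⟶ Z} {w : f ≫ g = 0}
    (hS : (ShortComplex.mk f g w).ShortExact) (Y : C) :
    (ShortComplex.mk (f ≫ biprod.inl : M ⟶ X ⊞ Y) (biprod.map g (𝟙 Y)) (by
      simp [reassoc_of% w])).ShortExact := by
  have := hS.mono_f
  have := hS.epi_g
  dsimp at *
  refine ShortComplex.ShortExact.mk' ?_ (mono_comp _ _) inferInstance
  refine ShortComplex.exact_of_g_is_cokernel _ ?_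
  refine CokernelCofork.IsColimit.ofπ' _ _ fun {A} t ht => ?_
  let d := hS.gIsCokernel.desc (CokernelCofork.ofπ (biprod.inl ≫ t) (by simpa using ht))
  have hd : g ≫ d = biprod.inl ≫ t :=
    hS.gIsCokernel.fac (CokernelCofork.ofπ (biprod.inl ≫ t) (by simpa using ht))
      WalkingParallelPair.one
  refine ⟨biprod.desc d (biprod.inr ≫ t), ?_⟩
  ext <;> simp [hd]

lemma nonempty_iso_X₃ {S S' : ShortComplex C} (hS : S.ShortExact) (hS' : S'.ShortExact)
    (e₁ : S.X₁ ≅ S'.X₁) (e₂ : S.X₂ ≅ S'.X₂) (h : S.f ≫ e₂.hom = e₁.hom ≫ S'.f) :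
    Nonempty (S.X₃ ≅ S'.X₃) := by
  have h1 := hS.gIsCokernel
  have h2 := hS'.gIsCokernel
  have w : S.f ≫ e₂.hom ≫ S'.g = 0 := by rw [reassoc_of% h, S'.zero, comp_zero]
  have h' : S'.f ≫ e₂.inv = e₁.inv ≫ S.f := by
    rw [Iso.comp_inv_eq, Category.assoc, h, Iso.inv_hom_id_assoc]
  have w' : S'.f ≫ e₂.inv ≫ S.g = 0 := by rw [reassoc_of% h', S.zero, comp_zero]
  have := hS.epi_g
  have := hS'.epi_g
  let a := h1.desc (CokernelCofork.ofπ (e₂.hom ≫ S'.g) w)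
  have ha : S.g ≫ a = e₂.hom ≫ S'.g := h1.fac _ WalkingParallelPair.one
  let b := h2.desc (CokernelCofork.ofπ (e₂.inv ≫ S.g) w')
  have hb : S'.g ≫ b = e₂.inv ≫ S.g := h2.fac _ WalkingParallelPair.one
  refine ⟨⟨a, b, ?_, ?_⟩⟩
  · rw [← cancel_epi S.g, reassoc_of% ha, hb]; simp
  · rw [← cancel_epi S'.g, reassoc_of% hb, ha]; simp

lemma nonempty_iso_X₁ {S S' : ShortComplex C} (hS : S.ShortExact) (hS' : S'.ShortExact)
    (e₂ : S.X₂ ≅ S'.X₂) (e₃ : S.X₃ ≅ S'.X₃) (h : S.g ≫ e₃.hom = e₂.hom ≫ S'.g) :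
    Nonempty (S.X₁ ≅ S'.X₁) := by
  obtain ⟨e⟩ := nonempty_iso_X₃ hS'.op hS.op e₃.op e₂.op
    (congrArg Quiver.Hom.op h.symm)
  exact ⟨e.unop⟩

/-- The dual of Schanuel's lemma. -/
lemma dual_schanuel {M X Z X' Z' : C} {f : M ⟶ X} {g : X ⟶ Z} {w : f ≫ g = 0}
    (hS : (ShortComplex.mk f g w).ShortExact) {f' : M ⟶ X'} {g' : X' ⟶ Z'} {w' : f' ≫ g' = 0}
    (hS' : (ShortComplex.mk f' g' w').ShortExact)
    (h : ∃ a : X ⟶ X', f ≫ a = f') (h' : ∃ b : X' ⟶ X, f' ≫ b = f) :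
    Nonempty (Z ⊞ X' ≅ Z' ⊞ X) := by
  obtain ⟨a, ha⟩ := h
  obtain ⟨b, hb⟩ := h'
  -- Two shears: `s` carries `(f, 0)` to `(f, f')`, and `t` carries that to `(f', 0)`. The two
  -- padded monomorphisms therefore agree up to isomorphism, hence so do their cokernels.
  let s : X ⊞ X' ≅ X ⊞ X' :=
    { hom := biprod.lift biprod.fst (biprod.fst ≫ a + biprod.snd)
      inv := biprod.lift biprod.fst (- biprod.fst ≫ a + biprod.snd) }
  let t : X ⊞ X' ≅ X' ⊞ X :=
    { hom := biprod.lift biprod.snd (biprod.fst - biprod.snd ≫ b)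
      inv := biprod.lift (biprod.snd + biprod.fst ≫ b) biprod.fst }
  refine nonempty_iso_X₃ (shortExact_biprod_right hS X') (shortExact_biprod_right hS' X)
    (Iso.refl M) (s ≪≫ t) ?_
  dsimp [s, t]
  ext <;> simp [ha, hb, reassoc_of% ha]

/-- Adding an identity to the left part of a short exact sequence. -/
lemma shortExact_biprod_left {K Q M : C} {f : K ⟶ Q} {g : Q ⟶ M} {w : f ≫ g = 0}
    (hS : (ShortComplex.mk f g w).ShortExact) (Y : C) :
    (ShortComplex.mk (biprod.map f (𝟙 Y)) (biprod.fst ≫ g : Q ⊞ Y ⟶ M) (by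
      simp [w])).ShortExact := by
  have := hS.mono_f
  have := hS.epi_g
  dsimp at *
  refine ShortComplex.ShortExact.mk' ?_ inferInstance (epi_comp _ _)
  refine ShortComplex.exact_of_f_is_kernel _ ?_
  refine KernelFork.IsLimit.ofι' _ _ fun {A} t ht => ?_
  let d := hS.fIsKernel.lift (KernelFork.ofι (t ≫ biprod.fst) (by simpa using ht))
  have hd : d ≫ f = t ≫ biprod.fst :=
    hS.fIsKernel.fac (KernelFork.ofι (t ≫ biprod.fst) (by simpa using ht))
      WalkingParallelPair.zero
  refine ⟨biprod.lift d (t ≫ biprod.snd), ?_⟩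
  ext <;> simp [hd]

/-- Schanuel's lemma. -/
lemma schanuel {K Q M K' Q' : C} {f : K ⟶ Q} {g : Q ⟶ M} {w : f ≫ g = 0}
    (hS : (ShortComplex.mk f g w).ShortExact) {f' : K' ⟶ Q'} {g' : Q' ⟶ M} {w' : f' ≫ g' = 0}
    (hS' : (ShortComplex.mk f' g' w').ShortExact) [Projective Q] [Projective Q'] :
    Nonempty (K ⊞ Q' ≅ K' ⊞ Q) := by
  have := hS.epi_g
  have := hS'.epi_g
  dsimp at *
  obtain ⟨a, ha⟩ : ∃ a : Q ⟶ Q', a ≫ g' = g := ⟨_, Projective.factorThru_comp g g'⟩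
  obtain ⟨b, hb⟩ : ∃ b : Q' ⟶ Q, b ≫ g = g' := ⟨_, Projective.factorThru_comp g' g⟩
  -- Two shears whose composite turns `biprod.fst ≫ g` into `biprod.fst ≫ g'`, so that the kernels
  -- agree.
  let s : Q ⊞ Q' ≅ Q ⊞ Q' :=
    { hom := biprod.lift (biprod.fst - biprod.snd ≫ b) biprod.snd
      inv := biprod.lift (biprod.fst + biprod.snd ≫ b) biprod.snd }
  let t : Q ⊞ Q' ≅ Q' ⊞ Q :=
    { hom := biprod.lift (biprod.snd + biprod.fst ≫ a) biprod.fst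
      inv := biprod.lift biprod.snd (biprod.fst - biprod.snd ≫ a) }
  refine nonempty_iso_X₁ (shortExact_biprod_left hS Q') (shortExact_biprod_left hS' Q)
    (s ≪≫ t) (Iso.refl M) ?_
  dsimp [s, t]
  simp [ha, hb]

end Schanuel

/-! ### Short exact sequences of cokernels -/

section CokernelSequence

open ZeroObject

variable {C : Type*} [Category* C] [Abelian C]

/-- The cokernels of a morphism of short exact sequences whose outer components are monomorphisms
form a short exact sequence. -/
lemma exists_cokernel_shortExact {S₁ S₂ : ShortComplex C} (h₁ : S₁.ShortExact)
    (h₂ : S₂.ShortExact) (φ : S₁ ⟶ S₂) (m₁ : Mono φ.τ₁) (m₃ : Mono φ.τ₃) :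
    ∃ (S₃ : ShortComplex C) (π : S₂ ⟶ S₃) (w₁ : φ.τ₁ ≫ π.τ₁ = 0) (w₂ : φ.τ₂ ≫ π.τ₂ = 0)
      (w₃ : φ.τ₃ ≫ π.τ₃ = 0), S₃.ShortExact ∧ (ShortComplex.mk _ _ w₁).ShortExact ∧
      (ShortComplex.mk _ _ w₂).ShortExact ∧ (ShortComplex.mk _ _ w₃).ShortExact := by
  have := h₁.epi_g
  have := h₂.epi_g
  have := h₁.mono_f
  have := h₂.mono_f
  let D : ShortComplex.SnakeInput C :=
    { L₀ := kernel φ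
      L₁ := S₁
      L₂ := S₂
      L₃ := cokernel φ
      v₀₁ := kernel.ι φ
      v₁₂ := φ
      v₂₃ := cokernel.π φ
      h₀ := kernelIsKernel φ
      h₃ := cokernelIsCokernel φ
      L₁_exact := h₁.exact
      L₂_exact := h₂.exact
      epi_L₁_g := inferInstance
      mono_L₂_f := inferInstance }
  -- The source of the connecting morphism is the kernel of the monomorphism `φ.τ₃`, so the sequence
  -- of cokernels is also exact on the left.
  have hz : IsZero D.L₀.X₃ := by
    have hk : D.v₀₁.τ₃ = 0 := by
      rw [← cancel_mono φ.τ₃, zero_comp]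
      exact D.w₀₂_τ₃
    have : Mono D.v₀₁.τ₃ := mono_of_isLimit_fork D.h₀τ₃
    rw [IsZero.iff_id_eq_zero, ← cancel_mono D.v₀₁.τ₃, hk, comp_zero, comp_zero]
  have hmono : Mono D.L₃.f := D.L₂'_exact.mono_g (hz.eq_of_src _ _)
  have hepi : Epi D.L₃.g := by
    have : Epi D.v₂₃.τ₃ := epi_of_isColimit_cofork D.h₃τ₃
    have h : Epi (D.v₂₃.τ₂ ≫ D.L₃.g) := by
      rw [D.v₂₃.comm₂₃]
      change Epi (S₂.g ≫ D.v₂₃.τ₃)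
      infer_instance
    exact epi_of_epi D.v₂₃.τ₂ _
  have m₂ : Mono φ.τ₂ := ShortComplex.mono_τ₂_of_exact_of_mono φ h₁.exact
  have : Epi D.v₂₃.τ₁ := epi_of_isColimit_cofork D.h₃τ₁
  have : Epi D.v₂₃.τ₂ := epi_of_isColimit_cofork D.h₃τ₂
  have : Epi D.v₂₃.τ₃ := epi_of_isColimit_cofork D.h₃τ₃
  exact ⟨D.L₃, D.v₂₃, D.w₁₃_τ₁, D.w₁₃_τ₂, D.w₁₃_τ₃, ⟨D.L₃_exact⟩,
    ⟨D.exact_C₁_down⟩, ⟨D.exact_C₂_down⟩, ⟨D.exact_C₃_down⟩⟩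

lemma shortExact_of_iso_X₁ {M M' X Z : C} {f : M ⟶ X} {g : X ⟶ Z} {w : f ≫ g = 0}
    (hS : (ShortComplex.mk f g w).ShortExact) (e : M' ≅ M) :
    (ShortComplex.mk (e.hom ≫ f) g (by simp [w])).ShortExact :=
  ShortComplex.shortExact_of_iso
    (ShortComplex.isoMk (S₁ := ShortComplex.mk f g w)
      (S₂ := ShortComplex.mk (e.hom ≫ f) g (by simp [w]))
      e.symm (Iso.refl _) (Iso.refl _) (by simp) (by simp)) hS

lemma shortExact_id_zero (X : C) :
    (ShortComplex.mk (𝟙 X) (0 : X ⟶ 0) comp_zero).ShortExact :=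
  ShortComplex.ShortExact.mk' (ShortComplex.exact_of_g_is_cokernel _
    (CokernelCofork.IsColimit.ofπ' _ _ fun t ht => ⟨0, by
      have ht : t = 0 := by simpa using ht
      simp [ht]⟩)) (by dsimp; infer_instance)
    ⟨fun _ _ _ => (isZero_zero C).eq_of_src _ _⟩

lemma shortExact_zero_id (X : C) :
    (ShortComplex.mk (0 : 0 ⟶ X) (𝟙 X) zero_comp).ShortExact :=
  ShortComplex.ShortExact.mk' (ShortComplex.exact_of_f_is_kernel _
    (KernelFork.IsLimit.ofι' _ _ fun t ht => ⟨0, by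
      have ht : t = 0 := by simpa using ht
      simp [ht]⟩)) ⟨fun _ _ _ => (isZero_zero C).eq_of_tgt _ _⟩
    (by dsimp; infer_instance)

lemma shortExact_biprod_map {M X Z M' X' Z' : C} {f : M ⟶ X} {g : X ⟶ Z} {w : f ≫ g = 0}
    (hS : (ShortComplex.mk f g w).ShortExact) {f' : M' ⟶ X'} {g' : X' ⟶ Z'} {w' : f' ≫ g' = 0}
    (hS' : (ShortComplex.mk f' g' w').ShortExact) :
    (ShortComplex.mk (biprod.map f f') (biprod.map g g') (by
      ext <;> simp [w, w'])).ShortExact := by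
  have := hS.mono_f
  have := hS.epi_g
  have := hS'.mono_f
  have := hS'.epi_g
  dsimp at *
  refine ShortComplex.ShortExact.mk' ?_ inferInstance inferInstance
  refine ShortComplex.exact_of_g_is_cokernel _ ?_
  refine CokernelCofork.IsColimit.ofπ' _ _ fun {A} t ht => ?_
  have h₁ : f ≫ biprod.inl ≫ t = 0 := by
    simpa only [biprod.inl_map_assoc, comp_zero] using biprod.inl ≫= ht
  have h₂ : f' ≫ biprod.inr ≫ t = 0 := by
    simpa only [biprod.inr_map_assoc, comp_zero] using biprod.inr ≫= ht
  let d := hS.gIsCokernel.desc (CokernelCofork.ofπ (biprod.inl ≫ t) h₁)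
  have hd : g ≫ d = biprod.inl ≫ t := hS.gIsCokernel.fac _ WalkingParallelPair.one
  let d' := hS'.gIsCokernel.desc (CokernelCofork.ofπ (biprod.inr ≫ t) h₂)
  have hd' : g' ≫ d' = biprod.inr ≫ t := hS'.gIsCokernel.fac _ WalkingParallelPair.one
  refine ⟨biprod.desc d d', ?_⟩
  ext <;> simp [hd, hd']

lemma shortExact_biprod (X Y : C) :
    (ShortComplex.mk (biprod.inl : X ⟶ X ⊞ Y) biprod.snd (by simp)).ShortExact :=
  (ShortComplex.Splitting.ofHasBinaryBiproduct X Y).shortExact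

end CokernelSequence

/-! ### Alternating multiplicities along coresolutions in `add T` -/

section CoresolutionClass

open ZeroObject

variable {C : Type*} [Category* C] [Abelian C] {V : Type*} [AddCommGroup V]

/-- A function on objects that is additive on the objects of `add P`. -/
structure IsAdditiveOn (P : C) (m : C → V) : Prop where
  iso : ∀ {X Y : C}, IsInAdd P X → (X ≅ Y) → m X = m Y
  biprod : ∀ {X Y : C}, IsInAdd P X → IsInAdd P Y → m (X ⊞ Y) = m X + m Y

lemma IsAdditiveOn.zero {P : C} {m : C → V} (hm : IsAdditiveOn P m) {X : C} (hX : IsZero X) :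
    m X = 0 := by
  have h := IsInAdd.of_isZero (P := P) hX
  have := hm.biprod h h
  rw [hm.iso (h.biprod h) (Y := X) (IsZero.iso (by simp [biprod_isZero_iff, hX]) hX)] at this
  simpa using this

/-- `CoresClass T m n M c` says that `M` has a coresolution of length `n` by objects of `add T`, and
that `c` is the alternating sum of the values of `m` on its terms. -/
def CoresClass (T : C) (m : C → V) : ℕ → C → V → Prop
  | 0, M, c => IsInAdd T M ∧ c = m M
  | n + 1, M, c => ∃ (X Z : C) (f : M ⟶ X) (g : X ⟶ Z) (w : f ≫ g = 0),
      (ShortComplex.mk f g w).ShortExact ∧ IsInAdd T X ∧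
        ∃ c', CoresClass T m n Z c' ∧ c = m X - c'

namespace CoresClass

variable {T : C} {m : C → V}

lemma of_iso (hm : IsAdditiveOn T m) {n : ℕ} {M M' : C} {c : V} (e : M' ≅ M)
    (h : CoresClass T m n M c) : CoresClass T m n M' c := by
  cases n with
  | zero => exact ⟨h.1.of_iso e, by rw [h.2, hm.iso (h.1.of_iso e) e]⟩
  | succ n =>
    obtain ⟨X, Z, f, g, w, hS, hX, h⟩ := h
    exact ⟨X, Z, e.hom ≫ f, g, by simp [w], shortExact_of_iso_X₁ hS e, hX, h⟩

/-- The tail is padded with `M → M → 0`, which changes no class because `m` vanishes on zero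
objects. This brings two coresolutions to a common length. -/
lemma succ (hm : IsAdditiveOn T m) {n : ℕ} {M : C} {c : V} (h : CoresClass T m n M c) :
    CoresClass T m (n + 1) M c := by
  induction n generalizing M c with
  | zero =>
    refine ⟨M, 0, 𝟙 M, 0, comp_zero, shortExact_id_zero M, h.1, 0,
      ⟨IsInAdd.of_isZero (isZero_zero C), ?_⟩, by rw [h.2, sub_zero]⟩
    rw [hm.zero (isZero_zero C)]
  | succ n ih =>
    obtain ⟨X, Z, f, g, w, hS, hX, c', h, rfl⟩ := h
    exact ⟨X, Z, f, g, w, hS, hX, c', ih h, rfl⟩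

lemma mono (hm : IsAdditiveOn T m) {n n' : ℕ} (hn : n ≤ n') {M : C} {c : V}
    (h : CoresClass T m n M c) : CoresClass T m n' M c := by
  induction hn with
  | refl => exact h
  | step _ ih => exact ih.succ hm

/-- Only the first term changes. This lets the stable isomorphisms produced by Schanuel's lemma be
fed back into an induction on the length. -/
lemma biprod_right (hm : IsAdditiveOn T m) {n : ℕ} {M X : C} {c : V}
    (h : CoresClass T m n M c) (hX : IsInAdd T X) : CoresClass T m n (M ⊞ X) (c + m X) := by
  cases n with
  | zero => exact ⟨h.1.biprod hX, by rw [h.2, hm.biprod h.1 hX]⟩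
  | succ n =>
    obtain ⟨Y, Z, f, g, w, hS, hY, c', h, rfl⟩ := h
    have := hS.mono_f
    have := hS.epi_g
    refine ⟨Y ⊞ X, Z, biprod.map f (𝟙 X), biprod.fst ≫ g, by simp [w],
      shortExact_biprod_left hS X, hY.biprod hX, c', h, ?_⟩
    rw [hm.biprod hY hX]
    abel

section

variable [HasExt.{w} C] (hm : IsAdditiveOn T m)
  (hT : ∀ i, 0 < i → Subsingleton (Abelian.Ext.{w} T T i))
include hT

/-- Dimension shifting: `Ext^i(M, X)` sits between `Ext^i(Y, X)`, which is zero, and `Ext^{i+1}(Z,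
X)`, which vanishes by induction. Consequently maps into `add T` extend along the coresolutions. -/
lemma ext_eq_zero {n : ℕ} {M : C} {c : V} (h : CoresClass T m n M c) {X : C} (hX : IsInAdd T X)
    (i : ℕ) (hi : 0 < i) : Subsingleton (Abelian.Ext.{w} M X i) := by
  induction n generalizing M c i with
  | zero => exact h.1.ext_eq_zero_left (hX.ext_eq_zero_right (hT i hi))
  | succ n ih =>
    obtain ⟨Y, Z, f, g, w, hS, hY, c', h, rfl⟩ := h
    exact ext_eq_zero_X₁ hS rfl (hY.ext_eq_zero_left (hX.ext_eq_zero_right (hT i hi)))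
      (ih h (1 + i) (by lia))

include hm

/-- The stable form is what the induction needs: dual Schanuel compares the cokernels `Z` and `Z'`
only after adding `Y'` and `Y`. -/
lemma add_eq_add {n : ℕ} {M M' X X' : C} {c c' : V} (h : CoresClass T m n M c)
    (h' : CoresClass T m n M' c') (hX : IsInAdd T X) (hX' : IsInAdd T X')
    (e : M ⊞ X ≅ M' ⊞ X') : c + m X = c' + m X' := by
  induction n generalizing M M' X X' c c' with
  | zero =>
    rw [h.2, h'.2, ← hm.biprod h.1 hX, ← hm.biprod h'.1 hX', hm.iso (h.1.biprod hX) e]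
  | succ n ih =>
    obtain ⟨Y, Z, f, g, w, hS, hY, d, h, hd⟩ := h.biprod_right hm hX
    obtain ⟨Y', Z', f', g', w', hS', hY', d', h', hd'⟩ :=
      (h'.biprod_right hm hX').of_iso hm e
    obtain ⟨e'⟩ := dual_schanuel hS hS'
      (exists_extension hS (h.ext_eq_zero hT hY' 1 one_pos) f')
      (exists_extension hS' (h'.ext_eq_zero hT hY 1 one_pos) f)
    rw [hd, hd', sub_eq_sub_iff_add_eq_add, add_comm, ← ih h h' hY' hY e', add_comm]

lemma eq {n n' : ℕ} {M : C} {c c' : V} (h : CoresClass T m n M c)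
    (h' : CoresClass T m n' M c') : c = c' := by
  have hz := IsInAdd.of_isZero (P := T) (isZero_zero C)
  have := add_eq_add hm hT (h.mono hm (le_max_left n n')) (h'.mono hm (le_max_right n n')) hz hz
    (Iso.refl _)
  exact add_right_cancel this

/-- The horseshoe lemma. The map `f'` extends to `M` by `Ext` vanishing, which embeds the sequence
into the split one on `X'` and `X''`; the cokernels form a short exact sequence to which induction
applies. In length zero the sequence itself splits. -/
lemma of_shortExact {n : ℕ} {M' M M'' : C} {f : M' ⟶ M} {g : M ⟶ M''} {w : f ≫ g = 0}
    (hS : (ShortComplex.mk f g w).ShortExact) {a b : V} (h' : CoresClass T m n M' a)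
    (h'' : CoresClass T m n M'' b) : CoresClass T m n M (a + b) := by
  induction n generalizing M' M M'' a b with
  | zero =>
    have := hS.mono_f
    obtain ⟨r, hr⟩ := exists_extension hS (h''.ext_eq_zero hT h'.1 1 one_pos) (𝟙 M')
    let s := ShortComplex.Splitting.ofExactOfRetraction _ hS.exact r hr hS.epi_g
    have e : M ≅ M' ⊞ M'' := s.isoBinaryBiproduct
    exact ⟨(h'.1.biprod h''.1).of_iso e, by
      rw [h'.2, h''.2, ← hm.biprod h'.1 h''.1, hm.iso ((h'.1.biprod h''.1).of_iso e) e]⟩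
  | succ n ih =>
    have h3 := h''
    obtain ⟨X', Z', f', g', w', hS', hX', c', h', rfl⟩ := h'
    obtain ⟨X'', Z'', f'', g'', w'', hS'', hX'', c'', h'', rfl⟩ := h''
    obtain ⟨r, hr⟩ := exists_extension hS (h3.ext_eq_zero hT hX' 1 one_pos) f'
    have := hS'.mono_f
    have := hS''.mono_f
    dsimp at *
    obtain ⟨S₃, π, w₁, w₂, w₃, hS₃, e₁, e₂, e₃⟩ := exists_cokernel_shortExact hS
      (shortExact_biprod X' X'')
      { τ₁ := f', τ₂ := biprod.lift r (g ≫ f''), τ₃ := f''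
        comm₁₂ := by dsimp; ext <;> simp [hr, reassoc_of% w] } ‹_› ‹_›
    obtain ⟨i₁⟩ := nonempty_iso_X₃ e₁ hS' (Iso.refl _) (Iso.refl _) (by simp)
    obtain ⟨i₃⟩ := nonempty_iso_X₃ e₃ hS'' (Iso.refl _) (Iso.refl _) (by simp)
    refine ⟨X' ⊞ X'', S₃.X₂, _, _, w₂, e₂, hX'.biprod hX'', c' + c'',
      ih hS₃ (h'.of_iso hm i₁) (h''.of_iso hm i₃), ?_⟩
    rw [hm.biprod hX' hX'']
    abel

/-- Modules with a coresolution are closed under kernels of epimorphisms. -/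
lemma kernel {n n' : ℕ} {K Q M : C} {f : K ⟶ Q} {g : Q ⟶ M} {w : f ≫ g = 0}
    (hS : (ShortComplex.mk f g w).ShortExact) {a b : V} (hQ : CoresClass T m n Q a)
    (hM : CoresClass T m n' M b) : ∃ n'', CoresClass T m n'' K (a - b) := by
  -- Lengthening by one guarantees an embedding of `Q` into an object `X` of `add T`, even when `n =
  -- 0`.
  obtain ⟨X, Z, i, p, w', hS', hX, c, hZ, rfl⟩ := hQ.succ hm
  have := hS.mono_f
  have hK : (ShortComplex.mk (𝟙 K) (0 : K ⟶ 0) comp_zero).ShortExact := shortExact_id_zero K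
  -- The cokernel of `K ⟶ Q ⟶ X` is an extension of `Z` by `M`. It appears by mapping `K → K → 0`
  -- into `Q → X → Z` and taking cokernels.
  obtain ⟨S₃, π, w₁, w₂, w₃, hS₃, e₁, e₂, e₃⟩ := exists_cokernel_shortExact hK hS'
      { τ₁ := f, τ₂ := f ≫ i, τ₃ := 0, comm₂₃ := by simp [w'] } ‹_›
      ⟨fun _ _ _ => (isZero_zero C).eq_of_tgt _ _⟩
  obtain ⟨i₁⟩ := nonempty_iso_X₃ e₁ hS (Iso.refl _) (Iso.refl _) (by simp)
  obtain ⟨i₃⟩ := nonempty_iso_X₃ e₃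
    (S' := ShortComplex.mk (0 : 0 ⟶ Z) (𝟙 Z) zero_comp) (shortExact_zero_id Z)
    (Iso.refl _) (Iso.refl _) (by simp)
  refine ⟨max n n' + 1, X, S₃.X₂, _, _, w₂, e₂, hX, b + c, of_shortExact hm hT hS₃
    ((hM.mono hm (le_max_right n n')).of_iso hm i₁)
    ((hZ.mono hm (le_max_left n n')).of_iso hm i₃), ?_⟩
  abel

/-- Modules with a coresolution are closed under direct summands. -/
lemma summand {n : ℕ} {W M N : C} {c : V} (h : CoresClass T m n W c) (e : W ≅ M ⊞ N) :
    ∃ c', CoresClass T m n M c' := by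
  induction n generalizing W M N c with
  | zero =>
    exact ⟨_, IsInAdd.of_retract ⟨biprod.inl, biprod.fst, by simp⟩ (h.1.of_iso e.symm), rfl⟩
  | succ n ih =>
    obtain ⟨X, Z, f, g, w, hS, hX, c', h, -⟩ := h.of_iso hm e.symm
    have := hS.mono_f
    dsimp at *
    let f₁ : M ⟶ X := biprod.inl ≫ f
    let f₂ : N ⟶ X := biprod.inr ≫ f
    have m₁ : Mono f₁ := mono_comp _ _
    have m₂ : Mono f₂ := mono_comp _ _
    have h₁ : (ShortComplex.mk f₁ (cokernel.π f₁) (cokernel.condition _)).ShortExact :=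
      ShortComplex.ShortExact.mk' (ShortComplex.exact_cokernel f₁) m₁ (by dsimp; infer_instance)
    have h₂ : (ShortComplex.mk f₂ (cokernel.π f₂) (cokernel.condition _)).ShortExact :=
      ShortComplex.ShortExact.mk' (ShortComplex.exact_cokernel f₂) m₂ (by dsimp; infer_instance)
    -- The embedding of `M ⊞ N` into `X` is compared with the diagonal embedding into `X ⊞ X`.
    -- Nothing is known yet about the cokernels of `f₁` and `f₂`, but the map back is simply the
    -- codiagonal. The resulting isomorphism makes `cokernel f₁` a summand of `Z ⊞ (X ⊞ X)`, which
    -- has a coresolution of length `n`.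
    obtain ⟨e'⟩ := dual_schanuel hS (shortExact_biprod_map h₁ h₂)
      (exists_extension hS (h.ext_eq_zero hT (hX.biprod hX) 1 one_pos) _)
      ⟨biprod.desc (𝟙 X) (𝟙 X), by ext <;> simp [f₁, f₂]⟩
    obtain ⟨d, hd⟩ := ih (h.biprod_right hm (hX.biprod hX))
      (e' ≪≫ biprod.associator (cokernel f₁) (cokernel f₂) X)
    exact ⟨_, X, cokernel f₁, f₁, cokernel.π f₁, cokernel.condition _, h₁, hX, d, hd, rfl⟩

end

/-- Coresolution classes are preserved by exact functors preserving `add T` and `m`. -/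
lemma map {n : ℕ} {M : C} {c : V} (h : CoresClass T m n M c) (F : C ⥤ C) [F.Additive]
    [PreservesFiniteLimits F] [PreservesFiniteColimits F] (hF : IsInAdd T (F.obj T))
    (hm : ∀ X, IsInAdd T X → m (F.obj X) = m X) : CoresClass T m n (F.obj M) c := by
  induction n generalizing M c with
  | zero => exact ⟨hF.trans (h.1.map F), by rw [h.2, hm _ h.1]⟩
  | succ n ih =>
    obtain ⟨X, Z, f, g, w, hS, hX, c', h, rfl⟩ := h
    exact ⟨F.obj X, F.obj Z, F.map f, F.map g, by rw [← F.map_comp, w, F.map_zero],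
      hS.map_of_exact F, hF.trans (hX.map F), c', ih h, by rw [hm _ hX]⟩

end CoresClass

end CoresolutionClass

/-! ### Alternating multiplicities along projective resolutions -/

section ResolutionClass

open ZeroObject

variable {C : Type*} [Category* C] [Abelian C] {V : Type*} [AddCommGroup V]

/-- `ResClass P m n M v` says that `M` has a resolution of length `n` by objects of `add P`, and
that `v` is the alternating sum of the values of `m` on its terms. -/
def ResClass (P : C) (m : C → V) : ℕ → C → V → Prop
  | 0, M, v => IsInAdd P M ∧ v = m M
  | n + 1, M, v => ∃ (K Q : C) (f : K ⟶ Q) (g : Q ⟶ M) (w : f ≫ g = 0),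
      (ShortComplex.mk f g w).ShortExact ∧ IsInAdd P Q ∧
        ∃ v', ResClass P m n K v' ∧ v = m Q - v'

namespace ResClass

variable {P : C} {m : C → V}

lemma of_iso (hm : IsAdditiveOn P m) {n : ℕ} {M M' : C} {v : V} (e : M ≅ M')
    (h : ResClass P m n M v) : ResClass P m n M' v := by
  cases n with
  | zero => exact ⟨h.1.of_iso e.symm, by rw [h.2, hm.iso h.1 e]⟩
  | succ n =>
    obtain ⟨K, Q, f, g, w, hS, hQ, h⟩ := h
    exact ⟨K, Q, f, g ≫ e.hom, by simp [reassoc_of% w], ShortComplex.shortExact_of_iso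
      (ShortComplex.isoMk (S₁ := ShortComplex.mk f g w)
        (S₂ := ShortComplex.mk f (g ≫ e.hom) (by simp [reassoc_of% w]))
        (Iso.refl _) (Iso.refl _) e (by simp) (by simp)) hS, hQ, h⟩

lemma biprod_right (hm : IsAdditiveOn P m) {n : ℕ} {M X : C} {v : V}
    (h : ResClass P m n M v) (hX : IsInAdd P X) : ResClass P m n (M ⊞ X) (v + m X) := by
  cases n with
  | zero => exact ⟨h.1.biprod hX, by rw [h.2, hm.biprod h.1 hX]⟩
  | succ n =>
    obtain ⟨K, Q, f, g, w, hS, hQ, v', h, rfl⟩ := h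
    refine ⟨K, Q ⊞ X, f ≫ biprod.inl, biprod.map g (𝟙 X), by simp [reassoc_of% w],
      shortExact_biprod_right hS X, hQ.biprod hX, v', h, ?_⟩
    rw [hm.biprod hQ hX]
    abel

/-- The analogue for resolutions: Schanuel's lemma needs only projectivity, and again determines the
kernels only up to summands in `add P`. -/
lemma add_eq_add [Projective P] (hm : IsAdditiveOn P m) {n : ℕ} {M M' X X' : C} {v v' : V}
    (h : ResClass P m n M v) (h' : ResClass P m n M' v') (hX : IsInAdd P X)
    (hX' : IsInAdd P X') (e : M ⊞ X ≅ M' ⊞ X') : v + m X = v' + m X' := by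
  induction n generalizing M M' X X' v v' with
  | zero =>
    rw [h.2, h'.2, ← hm.biprod h.1 hX, ← hm.biprod h'.1 hX', hm.iso (h.1.biprod hX) e]
  | succ n ih =>
    obtain ⟨K, Q, f, g, w, hS, hQ, d, h, hd⟩ := (h.biprod_right hm hX).of_iso hm e
    obtain ⟨K', Q', f', g', w', hS', hQ', d', h', hd'⟩ := h'.biprod_right hm hX'
    have := hQ.projective
    have := hQ'.projective
    obtain ⟨e'⟩ := schanuel hS hS'
    rw [hd, hd', sub_eq_sub_iff_add_eq_add, add_comm, ← ih h h' hQ' hQ e', add_comm]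

lemma eq [Projective P] (hm : IsAdditiveOn P m) {n : ℕ} {M : C} {v v' : V}
    (h : ResClass P m n M v) (h' : ResClass P m n M v') : v = v' := by
  have hz := IsInAdd.of_isZero (P := P) (isZero_zero C)
  exact add_right_cancel (add_eq_add hm h h' hz hz (Iso.refl _))

/-- The behaviour of resolution classes under an exact functor preserving `add P`. -/
lemma map {n : ℕ} {M : C} {v : V} (h : ResClass P m n M v) (F : C ⥤ C) [F.Additive]
    [PreservesFiniteLimits F] [PreservesFiniteColimits F] (hF : IsInAdd P (F.obj P))
    (s : V →+ V) (hm : ∀ X, IsInAdd P X → m (F.obj X) = s (m X)) :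
    ResClass P m n (F.obj M) (s v) := by
  induction n generalizing M v with
  | zero => exact ⟨hF.trans (h.1.map F), by rw [h.2, hm _ h.1]⟩
  | succ n ih =>
    obtain ⟨K, Q, f, g, w, hS, hQ, v', h, rfl⟩ := h
    exact ⟨F.obj K, F.obj Q, F.map f, F.map g, by rw [← F.map_comp, w, F.map_zero],
      hS.map_of_exact F, hF.trans (hQ.map F), s v', ih h, by rw [hm _ hQ, map_sub]⟩

/-- If the objects of `add P` have coresolutions by objects of `add T`, with classes determined by
`φ`, then the coresolution class of an object is determined by its resolution class. -/
lemma coresClass [HasExt.{w} C] {T : C} {W : Type*} [AddCommGroup W] {μ : C → W}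
    (hμ : IsAdditiveOn T μ) (hT : ∀ i, 0 < i → Subsingleton (Abelian.Ext.{w} T T i))
    (φ : V →+ W) (hφ : ∀ Q, IsInAdd P Q → ∃ n, CoresClass T μ n Q (φ (m Q)))
    {n n' : ℕ} {M : C} {v : V} {c : W} (h : ResClass P m n M v) (hc : CoresClass T μ n' M c) :
    c = φ v := by
  induction n generalizing M v n' c with
  | zero =>
    obtain ⟨_, hQ⟩ := hφ M h.1
    rw [h.2]
    exact CoresClass.eq hμ hT hc hQ
  | succ n ih =>
    obtain ⟨K, Q, f, g, w, hS, hQ, v', h, rfl⟩ := h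
    obtain ⟨_, hQ'⟩ := hφ Q hQ
    obtain ⟨_, hK⟩ := CoresClass.kernel hμ hT hS hQ' hc
    -- The kernel `K` has coresolution class `φ (m Q) - c`, and by induction this is `φ v'`.
    rw [map_sub, ← ih h hK, sub_sub_cancel]

end ResClass

end ResolutionClass

/-! ### Local finite dimensional algebras -/

section Residue

variable (k : Type*) [Field k] {R : Type*} [Ring R] [Algebra k R]

open Polynomial in
/-- Fitting's lemma. -/
lemma isUnit_or_isNilpotent [Module.Finite k R]
    (h : ∀ e : R, IsIdempotentElem e → e = 0 ∨ e = 1) (r : R) : IsUnit r ∨ IsNilpotent r := by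
  have hint : IsIntegral k r := Algebra.IsIntegral.isIntegral r
  -- The minimal polynomial is written as `X ^ a * q` with `X` not dividing `q`. A Bézout relation
  -- then yields complementary idempotents in `k[r]`, one of which must vanish.
  obtain ⟨q, hq, hq'⟩ := exists_eq_pow_rootMultiplicity_mul_and_not_dvd (minpoly k r)
    (minpoly.ne_zero hint) 0
  set a := rootMultiplicity 0 (minpoly k r)
  rw [C_0, sub_zero] at hq hq'
  have hcop : IsCoprime (X ^ a) q :=
    IsCoprime.pow_left ((irreducible_X.coprime_iff_not_dvd).2 hq')
  obtain ⟨s, t, hst⟩ := hcop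
  have h0 : aeval r (X ^ a * q) = 0 := by rw [← hq, minpoly.aeval]
  have hsum : aeval r (s * X ^ a) + aeval r (t * q) = 1 := by
    rw [← map_add, hst, map_one]
  have hprod : aeval r (s * X ^ a) * aeval r (t * q) = 0 := by
    rw [← map_mul, show s * X ^ a * (t * q) = s * t * (X ^ a * q) by ring, map_mul, h0, mul_zero]
  have hidem : IsIdempotentElem (aeval r (s * X ^ a)) := by
    have := congrArg (aeval r (s * X ^ a) * ·) hsum
    simp only [mul_add, hprod, add_zero, mul_one] at this
    exact this
  rcases h _ hidem with h1 | h1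
  · right
    rw [h1, zero_add] at hsum
    refine ⟨a, ?_⟩
    have : aeval r (X ^ a * (t * q)) = 0 := by
      rw [show X ^ a * (t * q) = t * (X ^ a * q) by ring, map_mul, h0, mul_zero]
    rw [map_mul, hsum, mul_one] at this
    simpa using this
  · left
    -- For `a = 0` the idempotent carries no information about `r`, but then `q` annihilates `r` and
    -- a Bézout relation between `X` and `q` inverts it.
    rcases Nat.eq_zero_or_pos a with ha | ha
    · have hne : q.coeff 0 ≠ 0 := fun hc => hq' (X_dvd_iff.2 hc)
      have hcop' : IsCoprime X q := (irreducible_X.coprime_iff_not_dvd).2 hq'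
      obtain ⟨s', t', hst'⟩ := hcop'
      have hq0 : aeval r q = 0 := by simpa [ha] using h0
      have h2 : aeval r (s' * X) = 1 := by
        have := congrArg (aeval r) hst'
        simpa [hq0] using this
      have h3 : aeval r (X * s') = 1 := by rw [mul_comm, h2]
      rw [map_mul, aeval_X] at h2 h3
      exact ⟨⟨r, aeval r s', h3, h2⟩, rfl⟩
    · obtain ⟨b, hb⟩ : ∃ b, a = b + 1 := ⟨a - 1, by lia⟩
      rw [hb] at h1
      have h2 : aeval r (s * X ^ b * X) = 1 := by rw [mul_assoc, ← pow_succ, h1]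
      have h3 : aeval r (X * (s * X ^ b)) = 1 := by rw [mul_comm, h2]
      rw [map_mul, aeval_X] at h2 h3
      exact ⟨⟨r, _, h3, h2⟩, rfl⟩

/-- A finite dimensional algebra over an algebraically closed field without nontrivial idempotents
is local with residue field `k`. -/
lemma exists_residue [IsAlgClosed k] [Module.Finite k R] [Nontrivial R]
    (h : ∀ e : R, IsIdempotentElem e → e = 0 ∨ e = 1) :
    ∃ χ : R →ₐ[k] k, ∀ r, χ r ≠ 0 → IsUnit r := by
  have key := isUnit_or_isNilpotent k h
  have : IsLocalRing R := IsLocalRing.of_isUnit_or_isUnit_one_sub_self fun r =>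
    (key r).imp_right fun hr => hr.isUnit_one_sub
  have hadd : ∀ {a b : R}, a ∈ nonunits R → b ∈ nonunits R → a + b ∈ nonunits R :=
    fun ha hb => IsLocalRing.nonunits_add ha hb
  -- In finite dimension one-sided inverses are two-sided, because left multiplication by `a` is
  -- injective once it is surjective. Hence the nonunits absorb multiplication on both sides.
  have hfin : ∀ a c : R, a * c = 1 → c * a = 1 := by
    intro a c hac
    have hs : Function.Surjective (LinearMap.mulLeft k a) := fun y => ⟨c * y, by
      rw [LinearMap.mulLeft_apply, ← mul_assoc, hac, one_mul]⟩
    refine LinearMap.injective_iff_surjective.2 hs ?_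
    simp [← mul_assoc, hac]
  have hmul : ∀ {a : R} (b : R), a ∈ nonunits R → a * b ∈ nonunits R := by
    intro a b ha hab
    apply ha
    obtain ⟨c, hc⟩ := hab.exists_right_inv
    rw [mul_assoc] at hc
    exact ⟨⟨a, _, hc, hfin _ _ hc⟩, rfl⟩
  have hmul' : ∀ {a : R} (b : R), a ∈ nonunits R → b * a ∈ nonunits R := by
    intro a b ha hab
    apply ha
    obtain ⟨c, hc⟩ := hab.exists_left_inv
    rw [← mul_assoc] at hc
    exact ⟨⟨a, _, hfin _ _ hc, hc⟩, rfl⟩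
  have hneg : ∀ {a : R}, a ∈ nonunits R → -a ∈ nonunits R := fun ha h => ha (by simpa using h)
  have hex : ∀ r : R, ∃ c : k, r - algebraMap k R c ∈ nonunits R := by
    intro r
    obtain ⟨c, hc⟩ := spectrum.nonempty_of_isAlgClosed_of_finiteDimensional k r
    refine ⟨c, fun hu => hc ?_⟩
    rw [spectrum.mem_resolventSet_iff]
    have := hu.neg
    rwa [neg_sub] at this
  choose χ hχ using hex
  -- Two admissible scalars would make their nonzero difference a sum of nonunits. Uniqueness makes
  -- the chosen `χ` an algebra morphism.
  have huniq : ∀ r c, r - algebraMap k R c ∈ nonunits R → χ r = c := by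
    intro r c hc
    by_contra hne
    refine hadd hc (hneg (hχ r)) ?_
    rw [show r - algebraMap k R c + -(r - algebraMap k R (χ r)) = algebraMap k R (χ r - c) by
      rw [map_sub]; abel]
    exact (IsUnit.mk0 _ (sub_ne_zero.2 hne)).map _
  have h0 : (0 : R) ∈ nonunits R := not_isUnit_zero
  refine ⟨AlgHom.ofLinearMap
    { toFun := χ
      map_add' := fun a b => huniq _ _ ?_
      map_smul' := fun c a => huniq _ _ ?_ } (huniq _ _ (by simp))
      fun a b => huniq _ _ ?_, fun r hr => ?_⟩
  · rw [show a + b - algebraMap k R (χ a + χ b) =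
      (a - algebraMap k R (χ a)) + (b - algebraMap k R (χ b)) by rw [map_add]; abel]
    exact hadd (hχ a) (hχ b)
  · rw [show c • a - algebraMap k R (RingHom.id k c • χ a) =
      algebraMap k R c * (a - algebraMap k R (χ a)) by
        rw [mul_sub, ← Algebra.smul_def, ← map_mul]; rfl]
    exact hmul' _ (hχ a)
  · change a * b - algebraMap k R (χ a * χ b) ∈ nonunits R
    rw [show a * b - algebraMap k R (χ a * χ b) =
      (a - algebraMap k R (χ a)) * b + algebraMap k R (χ a) * (b - algebraMap k R (χ b)) by
        rw [map_mul]; noncomm_ring]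
    exact hadd (hmul _ (hχ a)) (hmul' _ (hχ b))
  · by_contra hu
    exact hr (huniq r 0 (by simpa using hu))

end Residue

/-! ### Indecomposability and idempotents -/

section Idempotents

variable {C : Type*} [Category* C]

/-- All idempotent endomorphisms of `X` are trivial. -/
def HasTrivialIdempotents [Preadditive C] (X : C) : Prop :=
  ∀ e : X ⟶ X, e ≫ e = e → e = 0 ∨ e = 𝟙 X

/-- A right inverse of `h` defines an idempotent of `Y`. It is not zero, as otherwise the identity
of `X` would vanish, so it is the identity. -/
lemma HasTrivialIdempotents.isIso [Preadditive C] {X Y : C} (hX : ¬ IsZero X)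
    (hY : HasTrivialIdempotents Y) {h : X ⟶ Y} {f : Y ⟶ X} (hf : IsIso (h ≫ f)) : IsIso h := by
  have h1 : h ≫ f ≫ inv (h ≫ f) = 𝟙 X := by rw [← Category.assoc, IsIso.hom_inv_id]
  rcases hY ((f ≫ inv (h ≫ f)) ≫ h) (by
    simp only [Category.assoc, reassoc_of% h1]) with h2 | h2
  · refine absurd ((IsZero.iff_id_eq_zero X).2 ?_) hX
    have : h ≫ ((f ≫ inv (h ≫ f)) ≫ h) ≫ f ≫ inv (h ≫ f) = 0 := by
      rw [h2, zero_comp, comp_zero]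
    rwa [Category.assoc, h1, Category.comp_id, h1] at this
  · exact ⟨_, h1, h2⟩

/-- Splitting `e` and `𝟙 X - e` decomposes `X` as a biproduct of the two images. -/
lemma hasTrivialIdempotents_of_indecomposable [Abelian C] {X : C} (hX : Indecomposable X) :
    HasTrivialIdempotents X := by
  intro e he
  have he' : (𝟙 X - e) ≫ (𝟙 X - e) = 𝟙 X - e := by simp [he]
  obtain ⟨Y, i, p, h1, h2⟩ := IsIdempotentComplete.idempotents_split X e he
  obtain ⟨Y', i', p', h1', h2'⟩ := IsIdempotentComplete.idempotents_split X _ he'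
  have hp : i ≫ p' = 0 := by
    have : i ≫ (p' ≫ i') ≫ p' = 0 := by
      rw [h2', Preadditive.sub_comp, Preadditive.comp_sub, Category.id_comp, ← h2]
      simp [reassoc_of% h1]
    simpa [h1'] using this
  have hp' : i' ≫ p = 0 := by
    have : i' ≫ (p' ≫ i') ≫ p = 0 := by
      rw [h2', Preadditive.sub_comp, Preadditive.comp_sub, Category.id_comp, ← h2]
      simp [h1]
    rwa [Category.assoc, reassoc_of% h1'] at this
  let φ : X ≅ Y ⊞ Y' :=
    { hom := biprod.lift p p'
      inv := biprod.desc i i'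
      hom_inv_id := by simp [h2, h2']
      inv_hom_id := by ext <;> simp [h1, h1', hp, hp'] }
  rcases hX.2 Y Y' φ with h | h
  · left
    rw [← h2, h.eq_of_tgt p 0, zero_comp]
  · right
    rw [h.eq_of_tgt p' 0, zero_comp] at h2'
    exact (sub_eq_zero.1 h2'.symm).symm

lemma indecomposable_of_hasTrivialIdempotents [Abelian C] {X : C} (hX : ¬ IsZero X)
    (h : HasTrivialIdempotents X) : Indecomposable X := by
  refine ⟨hX, fun Y Z e => ?_⟩
  rcases h (e.hom ≫ biprod.fst ≫ biprod.inl ≫ e.inv) (by simp) with h1 | h1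
  · left
    rw [IsZero.iff_id_eq_zero]
    have := congrArg (fun t => biprod.inl ≫ e.inv ≫ t ≫ e.hom ≫ biprod.fst) h1
    simpa using this
  · right
    rw [IsZero.iff_id_eq_zero]
    have := congrArg (fun t => biprod.inr ≫ e.inv ≫ t ≫ e.hom ≫ biprod.snd) h1
    simpa using this.symm

end Idempotents

/-! ### Multiplicity of an indecomposable summand -/

section Multiplicity

variable (k : Type*) [Field k] {C : Type*} [Category* C] [Preadditive C] [Linear k C]

/-- `χ` exhibits `k` as the residue field of the local algebra of endomorphisms of `L`. -/
structure IsResidue {L : C} (χ : (L ⟶ L) →ₗ[k] k) : Prop where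
  one : χ (𝟙 L) = 1
  comp : ∀ f g, χ (f ≫ g) = χ f * χ g
  isIso : ∀ f, χ f ≠ 0 → IsIso f

lemma exists_isResidue [IsAlgClosed k] {L : C} [Module.Finite k (L ⟶ L)] (hL : ¬ IsZero L)
    (h : HasTrivialIdempotents L) : ∃ χ : (L ⟶ L) →ₗ[k] k, IsResidue k χ := by
  have : Module.Finite k (End L) := ‹Module.Finite k (L ⟶ L)›
  have : Nontrivial (End L) := ⟨⟨𝟙 L, 0, fun h => hL ((IsZero.iff_id_eq_zero L).2 h)⟩⟩
  obtain ⟨χ, hχ⟩ := exists_residue k (R := End L) fun e he => h e he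
  refine ⟨χ.toLinearMap, χ.map_one, fun f g => ?_, fun f hf => ?_⟩
  -- Multiplication in `End L` is composition in the reverse order; this is harmless because `k` is
  -- commutative.
  · rw [mul_comm]
    exact χ.map_mul g f
  · exact (isUnit_iff_isIso f).1 (hχ f hf)

/-- The radical morphisms from `X` to an object `L` with local endomorphism algebra. -/
def radicalHom (L X : C) : Submodule k (X ⟶ L) :=
  Submodule.span k {f | ∀ h : L ⟶ X, ¬ IsIso (h ≫ f)}

/-- The multiplicity of an indecomposable object `L` as a direct summand of `X`. -/
noncomputable def multiplicity (L X : C) : ℤ :=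
  Module.finrank k (X ⟶ L) - Module.finrank k (radicalHom k L X)

variable {k}

section

variable {L : C} {χ : (L ⟶ L) →ₗ[k] k} (hχ : IsResidue k χ)
include hχ

lemma IsResidue.isIso_iff (f : L ⟶ L) : IsIso f ↔ χ f ≠ 0 := by
  refine ⟨fun _ h => ?_, hχ.isIso f⟩
  have := hχ.comp f (inv f)
  rw [IsIso.hom_inv_id, hχ.one, h, zero_mul] at this
  exact one_ne_zero this

/-- Isomorphisms are detected by `χ`, so the radical morphisms are the common zeros of the linear
forms `f ↦ χ (h ≫ f)`. They already form a subspace, and the span in the definition adds nothing. -/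
lemma IsResidue.mem_radicalHom_iff {X : C} (f : X ⟶ L) :
    f ∈ radicalHom k L X ↔ ∀ h : L ⟶ X, χ (h ≫ f) = 0 := by
  let S : Submodule k (X ⟶ L) :=
    { carrier := {f | ∀ h : L ⟶ X, χ (h ≫ f) = 0}
      add_mem' := fun {a b} ha hb h => by
        rw [Preadditive.comp_add, map_add, ha h, hb h, add_zero]
      zero_mem' := fun h => by rw [comp_zero, map_zero]
      smul_mem' := fun c a ha h => by rw [Linear.comp_smul, map_smul, ha h, smul_zero] }
  have hS : {f : X ⟶ L | ∀ h : L ⟶ X, ¬ IsIso (h ≫ f)} = S := by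
    ext f
    simp [S, hχ.isIso_iff]
  rw [radicalHom, hS, Submodule.span_eq]
  rfl

/-- The radical of `End L` is the kernel of `χ`, of codimension one. -/
lemma multiplicity_self [Module.Finite k (L ⟶ L)] : multiplicity k L L = 1 := by
  have h : radicalHom k L L = LinearMap.ker χ := by
    ext f
    rw [hχ.mem_radicalHom_iff, LinearMap.mem_ker]
    exact ⟨fun h => by simpa using h (𝟙 L), fun h g => by rw [hχ.comp, h, mul_zero]⟩
  have hs : LinearMap.range χ = ⊤ := LinearMap.range_eq_top.2 fun c =>
    ⟨c • 𝟙 L, by rw [map_smul, hχ.one, smul_eq_mul, mul_one]⟩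
  have := LinearMap.finrank_range_add_finrank_ker χ
  rw [hs, finrank_top, Module.finrank_self] at this
  rw [multiplicity, h, ← this]
  push_cast
  abel

lemma multiplicity_biprod [HasBinaryBiproducts C] (X Y : C) [Module.Finite k (X ⟶ L)]
    [Module.Finite k (Y ⟶ L)] :
    multiplicity k L (X ⊞ Y) = multiplicity k L X + multiplicity k L Y := by
  let e : (X ⊞ Y ⟶ L) ≃ₗ[k] (X ⟶ L) × (Y ⟶ L) :=
    { toFun := fun f => (biprod.inl ≫ f, biprod.inr ≫ f)
      map_add' := fun f g => by simp
      map_smul' := fun c f => by simp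
      invFun := fun f => biprod.desc f.1 f.2
      left_inv := fun f => by ext <;> simp
      right_inv := fun f => by ext <;> simp }
  have h : (radicalHom k L (X ⊞ Y)).map (e : (X ⊞ Y ⟶ L) →ₗ[k] _) =
      (radicalHom k L X).prod (radicalHom k L Y) := by
    ext f
    rw [Submodule.mem_map_equiv, hχ.mem_radicalHom_iff, Submodule.mem_prod,
      hχ.mem_radicalHom_iff, hχ.mem_radicalHom_iff]
    change (∀ h : L ⟶ X ⊞ Y, χ (h ≫ biprod.desc f.1 f.2) = 0) ↔ _
    constructor
    · exact fun h => ⟨fun g => by simpa using h (g ≫ biprod.inl),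
        fun g => by simpa using h (g ≫ biprod.inr)⟩
    · rintro ⟨h1, h2⟩ g
      rw [biprod.desc_eq, Preadditive.comp_add, map_add, ← Category.assoc, ← Category.assoc,
        h1, h2, add_zero]
  have h1 : Module.finrank k (radicalHom k L (X ⊞ Y)) =
      Module.finrank k (radicalHom k L X) + Module.finrank k (radicalHom k L Y) := by
    let e' : ((radicalHom k L X).prod (radicalHom k L Y)) ≃ₗ[k]
        radicalHom k L X × radicalHom k L Y :=
      { toFun := fun f => (⟨f.1.1, f.2.1⟩, ⟨f.1.2, f.2.2⟩)
        map_add' := fun _ _ => rfl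
        map_smul' := fun _ _ => rfl
        invFun := fun f => ⟨(f.1.1, f.2.1), f.1.2, f.2.2⟩ }
    rw [← LinearEquiv.finrank_map_eq e, h, e'.finrank_eq, Module.finrank_prod]
  rw [multiplicity, multiplicity, multiplicity, h1, e.finrank_eq, Module.finrank_prod]
  push_cast
  abel

end

lemma multiplicity_eq_zero {L X : C} (h : ∀ (g : L ⟶ X) (f : X ⟶ L), ¬ IsIso (g ≫ f)) :
    multiplicity k L X = 0 := by
  have : radicalHom k L X = ⊤ := by
    refine Submodule.eq_top_iff'.2 fun f => Submodule.subset_span fun g => h g f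
  rw [multiplicity, this, finrank_top, sub_self]

/-- Multiplicities are preserved by fully faithful linear functors. -/
lemma multiplicity_map {D : Type*} [Category* D] [Preadditive D] [Linear k D] (F : C ⥤ D)
    [F.Additive] [F.Linear k] [F.Full] [F.Faithful] {L X : C} {L' X' : D} (e : F.obj L ≅ L')
    (e' : F.obj X ≅ X') : multiplicity k L' X' = multiplicity k L X := by
  let φ : (X ⟶ L) ≃ₗ[k] (X' ⟶ L') :=
    { toFun := fun f => e'.inv ≫ F.map f ≫ e.hom
      map_add' := fun f g => by simp
      map_smul' := fun c f => by simp
      invFun := fun f => F.preimage (e'.hom ≫ f ≫ e.inv)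
      left_inv := fun f => F.map_injective (by simp)
      right_inv := fun f => by simp }
  have h : (radicalHom k L X).map (φ : (X ⟶ L) →ₗ[k] _) = radicalHom k L' X' := by
    rw [radicalHom, radicalHom, Submodule.map_span]
    congr 1
    ext f
    constructor
    · rintro ⟨f, hf, rfl⟩ g hg
      refine hf (F.preimage (e.hom ≫ g ≫ e'.inv)) ?_
      rw [← isIso_iff_of_reflects_iso _ F]
      have : F.map (F.preimage (e.hom ≫ g ≫ e'.inv) ≫ f) =
          e.hom ≫ (g ≫ e'.inv ≫ F.map f ≫ e.hom) ≫ e.inv := by simp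
      rw [this]
      have : IsIso (g ≫ e'.inv ≫ F.map f ≫ e.hom) := hg
      infer_instance
    · intro hf
      refine ⟨φ.symm f, fun g hg => ?_, φ.apply_symm_apply f⟩
      refine hf (e.inv ≫ F.map g ≫ e'.hom) ?_
      have : (e.inv ≫ F.map g ≫ e'.hom) ≫ f = e.inv ≫ F.map (g ≫ φ.symm f) ≫ e.hom := by
        simp [φ]
      rw [this]
      infer_instance
  rw [multiplicity, multiplicity, φ.finrank_eq, ← h, LinearEquiv.finrank_map_eq]

lemma multiplicity_iso {L L' X X' : C} (e : L ≅ L') (e' : X ≅ X') :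
    multiplicity k L' X' = multiplicity k L X :=
  multiplicity_map (𝟭 C) e e'

end Multiplicity

/-! ### Modules over a `k`-category, evaluated pointwise -/

section ModuleCategory

variable {k : Type u} [Field k] {C : Type u} [Category.{u} C] [Preadditive C] [Linear k C]

instance : PreservesFiniteLimits (isLinear k C).ι := by
  have := (isLinear k C).preservesKernels_ι
  exact Functor.preservesFiniteLimits_of_preservesKernels _

instance : PreservesFiniteColimits (isLinear k C).ι := by
  have := (isLinear k C).preservesCokernels_ι
  exact Functor.preservesFiniteColimits_of_preservesCokernels _

variable (k) in
/-- The value of a module at an object, as a functor. -/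
def evalAt (x : C) : LinMod k C ⥤ ModuleCat.{u} k :=
  (isLinear k C).ι ⋙ (evaluation C (ModuleCat.{u} k)).obj x

instance (x : C) : (evalAt k x).Additive where
  map_add := rfl

instance (x : C) : PreservesFiniteLimits (evalAt k x) := by
  unfold evalAt
  infer_instance

instance (x : C) : PreservesFiniteColimits (evalAt k x) := by
  unfold evalAt
  infer_instance

/-- The component of a morphism of modules at an object, as a linear map. -/
abbrev homAt {M N : LinMod k C} (f : M ⟶ N) (x : C) : M.obj.obj x →ₗ[k] N.obj.obj x :=
  (f.hom.app x).hom

lemma homAt_naturality {M N : LinMod k C} (f : M ⟶ N) {x y : C} (a : x ⟶ y) (m : M.obj.obj x) :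
    homAt f y ((M.obj.map a).hom m) = (N.obj.map a).hom (homAt f x m) := by
  have := congrArg (fun t => t.hom m) (f.hom.naturality a)
  exact this

lemma hom_ext_homAt {M N : LinMod k C} {f g : M ⟶ N} (h : ∀ x m, homAt f x m = homAt g x m) :
    f = g := by
  apply ObjectProperty.hom_ext
  ext x m
  exact h x m

@[simp]
lemma homAt_comp {M N P : LinMod k C} (f : M ⟶ N) (g : N ⟶ P) (x : C) (m : M.obj.obj x) :
    homAt (f ≫ g) x m = homAt g x (homAt f x m) := rfl

@[simp]
lemma homAt_id {M : LinMod k C} (x : C) (m : M.obj.obj x) : homAt (𝟙 M) x m = m := rfl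

@[simp]
lemma homAt_add {M N : LinMod k C} (f g : M ⟶ N) (x : C) (m : M.obj.obj x) :
    homAt (f + g) x m = homAt f x m + homAt g x m := rfl

@[simp]
lemma homAt_zero {M N : LinMod k C} (x : C) (m : M.obj.obj x) :
    homAt (0 : M ⟶ N) x m = 0 := rfl

@[simp]
lemma homAt_sum {M N : LinMod k C} {J : Type*} (s : Finset J) (f : J → (M ⟶ N)) (x : C)
    (m : M.obj.obj x) : homAt (∑ j ∈ s, f j) x m = ∑ j ∈ s, homAt (f j) x m := by
  classical
  induction s using Finset.induction_on with
  | empty => simp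
  | insert a s ha ih => rw [Finset.sum_insert ha, Finset.sum_insert ha, homAt_add, ih]

/-- A morphism of modules from a natural family of linear maps. -/
def mkHom {M N : LinMod k C} (f : ∀ x, M.obj.obj x →ₗ[k] N.obj.obj x)
    (h : ∀ {x y : C} (a : x ⟶ y) (m : M.obj.obj x),
      f y ((M.obj.map a).hom m) = (N.obj.map a).hom (f x m)) : M ⟶ N :=
  (isLinear k C).homMk
    { app := fun x => ModuleCat.ofHom (f x)
      naturality := fun x y a => by
        ext m
        exact h a m }

lemma isIso_of_bijective {M N : LinMod k C} (f : M ⟶ N)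
    (h : ∀ x, Function.Bijective (homAt f x)) : IsIso f := by
  have : ∀ x, IsIso (f.hom.app x) := fun x =>
    (ConcreteCategory.isIso_iff_bijective (f.hom.app x)).2 (h x)
  have : IsIso f.hom := NatIso.isIso_of_isIso_app f.hom
  have : IsIso ((isLinear k C).ι.map f) := this
  exact isIso_of_reflects_iso f (isLinear k C).ι

lemma isZero_iff (M : LinMod k C) : IsZero M ↔ ∀ x (m : M.obj.obj x), m = 0 := by
  rw [IsZero.iff_id_eq_zero]
  refine ⟨fun h x m => ?_, fun h => hom_ext_homAt fun x m => ?_⟩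
  · have := congrArg (fun t => homAt t x m) h
    simpa using this
  · rw [h x m, map_zero, map_zero]

lemma map_add_hom (M : LinMod k C) {x y : C} (a b : x ⟶ y) (m : M.obj.obj x) :
    (M.obj.map (a + b)).hom m = (M.obj.map a).hom m + (M.obj.map b).hom m := by
  have := M.property.1
  rw [Functor.map_add]
  rfl

lemma map_smul_hom (M : LinMod k C) {x y : C} (c : k) (a : x ⟶ y) (m : M.obj.obj x) :
    (M.obj.map (c • a)).hom m = c • (M.obj.map a).hom m := by
  have := M.property.2
  rw [Functor.map_smul]
  rfl

lemma map_comp_hom (M : LinMod k C) {x y z : C} (a : x ⟶ y) (b : y ⟶ z) (m : M.obj.obj x) :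
    (M.obj.map (a ≫ b)).hom m = (M.obj.map b).hom ((M.obj.map a).hom m) := by
  rw [Functor.map_comp]
  rfl

lemma map_sum_hom (M : LinMod k C) {x y : C} {J : Type*} (s : Finset J) (a : J → (x ⟶ y))
    (m : M.obj.obj x) :
    (M.obj.map (∑ j ∈ s, a j)).hom m = ∑ j ∈ s, (M.obj.map (a j)).hom m := by
  have := M.property.1
  rw [Functor.map_sum, ModuleCat.hom_sum, LinearMap.sum_apply]

@[simp]
lemma map_id_hom (M : LinMod k C) {x : C} (m : M.obj.obj x) :
    (M.obj.map (𝟙 x)).hom m = m := by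
  rw [CategoryTheory.Functor.map_id]
  rfl

/-! ### Finite dimensional modules -/

/-- All values of `M` are finite dimensional. -/
def IsPointwiseFinite (M : LinMod k C) : Prop := ∀ x, Module.Finite k (M.obj.obj x)

lemma finite_directSum_iff {J : Type*} [Finite J] (V : J → Type*) [∀ j, AddCommGroup (V j)]
    [∀ j, Module k (V j)] : Module.Finite k (DirectSum J V) ↔ ∀ j, Module.Finite k (V j) := by
  classical
  have := Fintype.ofFinite J
  refine ⟨fun _ j => ?_, fun _ => inferInstance⟩
  exact Module.Finite.of_surjective (DirectSum.component k J V j) fun v =>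
    ⟨DirectSum.lof k J V j v, DirectSum.component.lof_self k j v⟩

lemma isFinDim_iff [Finite C] (M : LinMod k C) : IsFinDim M ↔ IsPointwiseFinite M :=
  finite_directSum_iff _

namespace IsPointwiseFinite

lemma of_injective {M N : LinMod k C} (hN : IsPointwiseFinite N) (f : M ⟶ N) [Mono f] :
    IsPointwiseFinite M := fun x => by
  have := hN x
  have : Mono ((evalAt k x).map f) := inferInstance
  exact Module.Finite.of_injective (homAt f x) ((ModuleCat.mono_iff_injective _).1 this)

/-- Endomorphisms of finite rank at `x` form a subgroup containing all composites through `P`. -/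
lemma of_isInAdd {P M : LinMod k C} (hP : IsPointwiseFinite P) (h : IsInAdd P M) :
    IsPointwiseFinite M := fun x => by
  let H : AddSubgroup (M ⟶ M) :=
    { carrier := {f | Module.Finite k (LinearMap.range (homAt f x))}
      add_mem' := fun {a b} ha hb => by
        have ha : Module.Finite k (LinearMap.range (homAt a x)) := ha
        have hb : Module.Finite k (LinearMap.range (homAt b x)) := hb
        exact Submodule.finiteDimensional_of_le (S₂ := LinearMap.range (homAt a x) ⊔
          LinearMap.range (homAt b x)) (LinearMap.range_add_le (homAt a x) (homAt b x))
      zero_mem' := by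
        change Module.Finite k (LinearMap.range (0 : M.obj.obj x →ₗ[k] M.obj.obj x))
        rw [LinearMap.range_zero]
        infer_instance
      neg_mem' := fun {a} ha => by
        change Module.Finite k (LinearMap.range (-homAt a x))
        rw [LinearMap.range_neg]
        exact ha }
  have hH : factoringThrough P M M ≤ H := by
    refine factoringThrough_le fun a b => ?_
    have := hP x
    change Module.Finite k (LinearMap.range (homAt b x ∘ₗ homAt a x))
    exact Submodule.finiteDimensional_of_le (LinearMap.range_comp_le_range _ _)
  have := hH h
  change Module.Finite k (LinearMap.range (LinearMap.id : M.obj.obj x →ₗ[k] M.obj.obj x)) at this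
  rw [LinearMap.range_id] at this
  exact Module.Finite.equiv Submodule.topEquiv

lemma finite_hom [Finite C] {M N : LinMod k C} (hM : IsPointwiseFinite M)
    (hN : IsPointwiseFinite N) : Module.Finite k (M ⟶ N) := by
  have := Fintype.ofFinite C
  have h1 : ∀ x, Module.Finite k (M.obj.obj x) := hM
  have h2 : ∀ x, Module.Finite k (N.obj.obj x) := hN
  let φ : (M ⟶ N) →ₗ[k] (∀ x, M.obj.obj x →ₗ[k] N.obj.obj x) :=
    { toFun := fun f x => homAt f x
      map_add' := fun _ _ => rfl
      map_smul' := fun _ _ => rfl }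
  refine Module.Finite.of_injective φ fun f g h => hom_ext_homAt fun x m => ?_
  exact congrArg (fun t : M.obj.obj x →ₗ[k] N.obj.obj x => t m) (congrFun h x)

end IsPointwiseFinite

/-! ### The regular module -/

section Regular

open Classical in
/-- The element of the regular module given by a morphism. -/
noncomputable def regOf (k : Type u) [Field k] [Linear k C] {y x : C} (a : y ⟶ x) :
    (regularModule k C).obj.obj x :=
  DirectSum.lof k C (fun y => (y ⟶ x)) y a

lemma regOf_map {y x x' : C} (a : y ⟶ x) (b : x ⟶ x') :
    ((regularModule k C).obj.map b).hom (regOf k a) = regOf k (a ≫ b) := by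
  classical
  exact DirectSum.lmap_lof _ _ _

lemma reg_hom_ext {M : LinMod k C} {f g : regularModule k C ⟶ M}
    (h : ∀ y, homAt f y (regOf k (𝟙 y)) = homAt g y (regOf k (𝟙 y))) : f = g := by
  classical
  refine hom_ext_homAt fun x => ?_
  have : homAt f x = homAt g x := by
    refine DirectSum.linearMap_ext _ fun y => LinearMap.ext fun a => ?_
    have h1 : regOf k a = ((regularModule k C).obj.map a).hom (regOf k (𝟙 y)) := by
      rw [regOf_map, Category.id_comp]
    change homAt f x (regOf k a) = homAt g x (regOf k a)
    rw [h1, homAt_naturality, homAt_naturality, h]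
  exact fun m => by rw [this]

open Classical in
/-- The linear maps underlying `regDesc`. -/
noncomputable def regDescAt (M : LinMod k C) (m : ∀ y, M.obj.obj y) (x : C) :
    DirectSum C (fun y => (y ⟶ x)) →ₗ[k] M.obj.obj x :=
  DirectSum.toModule k C (M.obj.obj x) fun y =>
    { toFun := fun a : y ⟶ x => (M.obj.map a).hom (m y)
      map_add' := fun a b => map_add_hom M a b _
      map_smul' := fun c a => map_smul_hom M c a _ }

open Classical in
lemma regDescAt_lof {M : LinMod k C} (m : ∀ y, M.obj.obj y) {y x : C} (a : y ⟶ x) :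
    regDescAt M m x (DirectSum.lof k C (fun y => (y ⟶ x)) y a) = (M.obj.map a).hom (m y) := by
  simp [regDescAt]

/-- The morphism from the regular module given by a family of elements. -/
noncomputable def regDesc {M : LinMod k C} (m : ∀ y, M.obj.obj y) : regularModule k C ⟶ M :=
  mkHom (M := regularModule k C) (regDescAt M m)
    (fun {x x'} a r => by
      classical
      have : regDescAt M m x' ∘ₗ DirectSum.lmap (fun y => Linear.rightComp k y a) =
          (M.obj.map a).hom ∘ₗ regDescAt M m x := by
        refine DirectSum.linearMap_ext _ fun y => LinearMap.ext fun b => ?_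
        simp only [LinearMap.comp_apply, DirectSum.lmap_lof, regDescAt_lof]
        exact map_comp_hom M b a _
      exact LinearMap.congr_fun this r)

lemma regDesc_regOf {M : LinMod k C} (m : ∀ y, M.obj.obj y) {y x : C} (a : y ⟶ x) :
    homAt (regDesc m) x (regOf k a) = (M.obj.map a).hom (m y) :=
  regDescAt_lof m a

/-- The regular module is free on the identities, so a lift is specified by lifting their images. -/
instance : Projective (regularModule k C) where
  factors {E X} f e _ := by
    have hs : ∀ x, Function.Surjective (homAt e x) := fun x => by
      have : Epi ((evalAt k x).map e) := inferInstance
      exact (ModuleCat.epi_iff_surjective _).1 this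
    choose m hm using fun y => hs y (homAt f y (regOf k (𝟙 y)))
    refine ⟨regDesc m, reg_hom_ext fun y => ?_⟩
    rw [homAt_comp, regDesc_regOf, map_id_hom, hm]

lemma isPointwiseFinite_regularModule (hC : IsLocallyBounded k C) :
    IsPointwiseFinite (regularModule k C) := fun x => hC.finite_in x

lemma exists_epi [Finite C] {M : LinMod k C} (hM : IsPointwiseFinite M) :
    ∃ (Q : LinMod k C) (p : Q ⟶ M), Epi p ∧ IsInAdd (regularModule k C) Q := by
  classical
  have h1 : ∀ x, Module.Finite k (M.obj.obj x) := hM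
  choose n s hs using fun x => Module.Finite.exists_fin (R := k) (M := M.obj.obj x)
  -- One copy of the regular module for each generator `s x i`; it sends the identity of `x` to that
  -- generator and all other identities to zero.
  let J : Type u := Σ x, Fin (n x)
  let d : ∀ _ : J, regularModule k C ⟶ M := fun j => regDesc (Pi.single j.1 (s j.1 j.2))
  refine ⟨⨁ fun _ : J => regularModule k C, biproduct.desc d, ⟨fun {Z} f g h => ?_⟩,
    IsInAdd.biproduct _ fun _ => IsInAdd.self _⟩
  refine hom_ext_homAt fun x => ?_
  suffices H : homAt f x = homAt g x from fun m => by rw [H]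
  refine LinearMap.ext_on_range (hs x) fun i => ?_
  have := congrArg (fun t => homAt (biproduct.ι (fun _ : J => regularModule k C) ⟨x, i⟩ ≫ t) x
    (regOf k (𝟙 x))) h
  simpa [d, regDesc_regOf] using this

lemma exists_syzygy [Finite C] (hC : IsLocallyBounded k C) {M : LinMod k C}
    (hM : IsPointwiseFinite M) :
    ∃ (K Q : LinMod k C) (f : K ⟶ Q) (g : Q ⟶ M) (w : f ≫ g = 0),
      (ShortComplex.mk f g w).ShortExact ∧ IsInAdd (regularModule k C) Q ∧
        IsPointwiseFinite K := by
  obtain ⟨Q, p, hp, hQ⟩ := exists_epi hM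
  have hQ' := (isPointwiseFinite_regularModule hC).of_isInAdd hQ
  exact ⟨kernel p, Q, kernel.ι p, p, kernel.condition p,
    ShortComplex.ShortExact.mk' (ShortComplex.exact_kernel p) (by dsimp; infer_instance) hp, hQ,
    hQ'.of_injective (kernel.ι p)⟩

lemma isInAdd_of_projective [Finite C] {M : LinMod k C} (hM : IsPointwiseFinite M) [Projective M] :
    IsInAdd (regularModule k C) M := by
  obtain ⟨Q, p, hp, hQ⟩ := exists_epi hM
  exact hQ.of_retract ⟨Projective.factorThru (𝟙 M) p, p, Projective.factorThru_comp _ _⟩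

end Regular

/-! ### Representable modules -/

section Representable

variable (k) in
/-- The module represented by an object. -/
def repModule (z : C) : LinMod k C where
  obj := (linearCoyoneda k C).obj (Opposite.op z)
  property := by
    constructor
    · constructor
      intro x y f g
      ext a
      exact Preadditive.comp_add _ _ _ a f g
    · constructor
      intro x y f c
      ext a
      exact Linear.comp_smul _ _ _ a c f

/-- Identity of `z` as an element of the module represented by `z`. -/
abbrev repId (z : C) : (repModule k z).obj.obj z := (𝟙 z : z ⟶ z)

lemma rep_map {z x y : C} (a : x ⟶ y) (b : z ⟶ x) :
    ((repModule k z).obj.map a).hom b = (b ≫ a : z ⟶ y) := rfl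

lemma homAt_rep {z x : C} {M : LinMod k C} (f : repModule k z ⟶ M) (b : z ⟶ x) :
    homAt f x b = (M.obj.map b).hom (homAt f z (repId z)) := by
  rw [← homAt_naturality f b (repId z), rep_map, Category.id_comp]

lemma rep_hom_ext {z : C} {M : LinMod k C} {f g : repModule k z ⟶ M}
    (h : homAt f z (repId z) = homAt g z (repId z)) : f = g :=
  hom_ext_homAt fun _ b => (homAt_rep f b).trans ((congrArg _ h).trans (homAt_rep g b).symm)

/-- The morphism of `C` corresponding to a morphism of representable modules. -/
def repUnmap {z z' : C} (f : repModule k z ⟶ repModule k z') : z' ⟶ z := homAt f z (repId z)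

lemma repUnmap_comp {z z' z'' : C} (f : repModule k z ⟶ repModule k z')
    (g : repModule k z' ⟶ repModule k z'') : repUnmap (f ≫ g) = repUnmap g ≫ repUnmap f := by
  exact homAt_rep g (repUnmap f)

lemma repUnmap_id (z : C) : repUnmap (𝟙 (repModule k z)) = 𝟙 z := rfl

lemma repUnmap_injective {z z' : C} :
    Function.Injective (repUnmap (k := k) : (repModule k z ⟶ repModule k z') → (z' ⟶ z)) :=
  fun _ _ h => rep_hom_ext h

lemma nonempty_iso_of_rep_iso {z z' : C} (e : repModule k z ≅ repModule k z') :
    Nonempty (z ≅ z') :=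
  ⟨⟨repUnmap e.inv, repUnmap e.hom, by rw [← repUnmap_comp, e.hom_inv_id, repUnmap_id],
    by rw [← repUnmap_comp, e.inv_hom_id, repUnmap_id]⟩⟩

/-- By Yoneda an idempotent comes from the local ring `End z`, where `a` or `1 - a` is invertible.
-/
lemma hasTrivialIdempotents_rep (hC : IsLocallyBounded k C) (z : C) :
    HasTrivialIdempotents (repModule k z) := by
  intro e he
  have := hC.isLocalRing_end z
  let a : End z := repUnmap e
  have h : a * a = a := by
    change repUnmap e ≫ repUnmap e = repUnmap e
    rw [← repUnmap_comp, he]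
  rcases IsLocalRing.isUnit_or_isUnit_of_add_one (add_sub_cancel a 1) with ha | ha
  · right
    apply repUnmap_injective
    exact ha.mul_left_cancel (h.trans (mul_one a).symm)
  · left
    apply repUnmap_injective
    refine ha.mul_left_cancel (b := a) (c := 0) ?_
    rw [sub_mul, one_mul, h, sub_self, mul_zero]

lemma not_isZero_rep (hC : IsLocallyBounded k C) (z : C) : ¬ IsZero (repModule k z) := by
  have := hC.isLocalRing_end z
  intro h
  have h1 : (𝟙 z : z ⟶ z) = 0 := (isZero_iff _).1 h z (repId z)
  exact one_ne_zero (α := End z) h1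

/-- The inclusion of a representable module into the regular module. -/
noncomputable def repι (z : C) : repModule k z ⟶ regularModule k C :=
  mkHom (fun x =>
    { toFun := fun a : z ⟶ x => regOf k a
      map_add' := fun a b => by
        classical exact map_add (DirectSum.lof k C (fun y => (y ⟶ x)) z) a b
      map_smul' := fun c a => by
        classical exact map_smul (DirectSum.lof k C (fun y => (y ⟶ x)) z) c a })
    fun a b => (regOf_map b a).symm

open Classical in
/-- The projection of the regular module to a representable module. -/
noncomputable def repπ (z : C) : regularModule k C ⟶ repModule k z :=
  regDesc (M := repModule k z) (Pi.single z (repId z))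

lemma repι_repπ (z : C) : repι (k := k) z ≫ repπ z = 𝟙 _ := by
  classical
  refine rep_hom_ext ?_
  have : homAt (repι (k := k) z) z (repId z) = regOf k (𝟙 z) := rfl
  rw [homAt_comp, this, repπ, regDesc_regOf, map_id_hom, Pi.single_eq_same]
  rfl

lemma sum_repπ_repι [Fintype C] : ∑ z : C, repπ (k := k) z ≫ repι z = 𝟙 (regularModule k C) := by
  classical
  refine reg_hom_ext fun y => ?_
  rw [homAt_sum, Finset.sum_eq_single y]
  · rw [homAt_comp, repπ, regDesc_regOf, map_id_hom, Pi.single_eq_same]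
    rfl
  · intro z _ hz
    rw [homAt_comp, repπ, regDesc_regOf, map_id_hom, Pi.single_eq_of_ne (Ne.symm hz), map_zero]
  · simp

lemma isInAdd_rep (z : C) : IsInAdd (regularModule k C) (repModule k z) :=
  (IsInAdd.self _).of_retract ⟨repι z, repπ z, repι_repπ z⟩

end Representable

end ModuleCategory

/-! ### The pull-up functor -/

section PullUp

variable {k : Type u} [Field k]
variable {E : Type u} [Category.{u} E] [Preadditive E] [Linear k E]
variable {B : Type u} [Category.{u} B] [Preadditive B] [Linear k B]

/-- The pull-up as a functor. -/
def pullUpFunctor (F : E ⥤ B) (hF : F.Additive) (hF' : F.Linear k) : LinMod k B ⥤ LinMod k E where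
  obj := pullUp F hF hF'
  map f := (isLinear k E).homMk (Functor.whiskerLeft F f.hom)

variable (F : E ⥤ B) (hF : F.Additive) (hF' : F.Linear k)

instance : (pullUpFunctor F hF hF').Additive where
  map_add := rfl

instance : (pullUpFunctor F hF hF').Linear k where
  map_smul _ _ := rfl

/-- The pull-up is compatible with the inclusion into all functors. -/
def pullUpFunctorCompι : pullUpFunctor F hF hF' ⋙ (isLinear k E).ι ≅
    (isLinear k B).ι ⋙ (Functor.whiskeringLeft E B (ModuleCat.{u} k)).obj F := Iso.refl _

instance : PreservesFiniteLimits (pullUpFunctor F hF hF') := by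
  have : PreservesFiniteLimits (pullUpFunctor F hF hF' ⋙ (isLinear k E).ι) :=
    preservesFiniteLimits_of_natIso (pullUpFunctorCompι F hF hF').symm
  exact ⟨fun J _ _ => preservesLimitsOfShape_of_reflects_of_preserves _ (isLinear k E).ι⟩

instance : PreservesFiniteColimits (pullUpFunctor F hF hF') := by
  have : PreservesFiniteColimits (pullUpFunctor F hF hF' ⋙ (isLinear k E).ι) :=
    preservesFiniteColimits_of_natIso (pullUpFunctorCompι F hF hF').symm
  exact ⟨fun J _ _ => preservesColimitsOfShape_of_reflects_of_preserves _ (isLinear k E).ι⟩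

instance [F.IsEquivalence] : (pullUpFunctor F hF hF').Full where
  map_surjective {M N} f := by
    obtain ⟨g, hg⟩ := ((Functor.whiskeringLeft E B (ModuleCat.{u} k)).obj F).map_surjective f.hom
    exact ⟨(isLinear k B).homMk g, ObjectProperty.hom_ext _ hg⟩

instance [F.IsEquivalence] : (pullUpFunctor F hF hF').Faithful where
  map_injective {M N} f g h := by
    apply ObjectProperty.hom_ext
    refine ((Functor.whiskeringLeft E B (ModuleCat.{u} k)).obj F).map_injective ?_
    exact congrArg (fun t => t.hom) h

lemma IsPointwiseFinite.pullUp {M : LinMod k B} (hM : IsPointwiseFinite M) :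
    IsPointwiseFinite (pullUp F hF hF' M) := fun x => hM (F.obj x)

/-- For `F = ρ.act g`, the twist by `g` sends the module represented by `g • z` to the one
represented by `z`. Twisting thus permutes the representables. -/
lemma nonempty_pullUp_rep_iso [F.IsEquivalence] (z : E) :
    Nonempty ((pullUpFunctor F hF hF').obj (repModule k (F.obj z)) ≅ repModule k z) := by
  let f : repModule k z ⟶ (pullUpFunctor F hF hF').obj (repModule k (F.obj z)) :=
    mkHom (fun x => (F.mapLinearMap k : (z ⟶ x) →ₗ[k] (F.obj z ⟶ F.obj x)))
      fun a b => F.map_comp (b : z ⟶ _) a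
  have : IsIso f := isIso_of_bijective f fun x => ⟨F.map_injective, F.map_surjective⟩
  exact ⟨(asIso f).symm⟩

end PullUp

/-! ### Group actions, twists and counting along free orbits -/

section Action

variable {k : Type u} [Field k] {G : Type w} [Group G]
variable {E : Type u} [Category.{u} E] [Preadditive E] [Linear k E] (ρ : CatAction k G E)

namespace CatAction

/-- The action of `G` on the objects of `E`. -/
@[reducible]
def mulAction : MulAction G E where
  smul g x := (ρ.act g).obj x
  one_smul x := by
    change (ρ.act 1).obj x = x
    rw [ρ.act_one]
    rfl
  mul_smul g h x := by
    change (ρ.act (g * h)).obj x = _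
    rw [ρ.act_mul]
    rfl

instance (g : G) : (ρ.act g).IsEquivalence :=
  (CategoryTheory.Equivalence.mk (ρ.act g) (ρ.act g⁻¹)
    (eqToIso (by rw [← ρ.act_mul, inv_mul_cancel, ρ.act_one]))
    (eqToIso (by rw [← ρ.act_mul, mul_inv_cancel, ρ.act_one]))).isEquivalence_functor

/-- The twist of modules by an element of the group. -/
abbrev twist (g : G) : LinMod k E ⥤ LinMod k E :=
  pullUpFunctor (ρ.act g) (ρ.additive g) (ρ.linear g)

end CatAction

/-- A sum of a function invariant under a free automorphism is divisible by its order. -/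
lemma orderOf_dvd_sum [Finite G] {X : Type*} [Fintype X] [MulAction G X] (g : G)
    (hfree : ∀ (h : G) (x : X), h • x = x → h = 1) (w : X → ℤ) (hw : ∀ x, w (g • x) = w x) :
    (orderOf g : ℤ) ∣ ∑ x, w x := by
  classical
  let S : Subgroup G :=
    { carrier := {h | ∀ x, w (h • x) = w x}
      mul_mem' := fun {a b} ha hb x => by rw [mul_smul, ha, hb]
      one_mem' := fun x => by rw [one_smul]
      inv_mem' := fun {a} ha x => by rw [← ha, smul_inv_smul] }
  have hS : Subgroup.zpowers g ≤ S := (Subgroup.zpowers_le).2 hw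
  let H := Subgroup.zpowers g
  have := Fintype.ofFinite H
  let π : X → MulAction.orbitRel.Quotient H X := Quotient.mk _
  -- Freeness gives every orbit of the cyclic group generated by `g` exactly `orderOf g` elements,
  -- so each orbit contributes a multiple of that number to the sum.
  have hcard : ∀ a : X, ((Finset.univ.filter fun x => π x = π a).card : ℤ) = orderOf g := by
    intro a
    have hinj : Function.Injective fun h : H => h • a := by
      intro h h' hh
      have h1 : (h'⁻¹ * h : H) • a = a := by
        rw [mul_smul]
        exact inv_smul_eq_iff.2 hh
      have h2 := hfree _ _ h1
      exact (inv_mul_eq_one.1 (Subtype.ext h2)).symm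
    have h1 : (Finset.univ.filter fun x => π x = π a) =
        Finset.univ.image fun h : H => h • a := by
      ext x
      simp only [Finset.mem_filter, Finset.mem_univ, true_and, Finset.mem_image]
      rw [Quotient.eq'', MulAction.orbitRel_apply]
      exact Iff.rfl
    rw [h1, Finset.card_image_of_injective _ hinj, Finset.card_univ]
    rw [← Nat.card_eq_fintype_card]
    exact congrArg Nat.cast (Nat.card_zpowers g)
  rw [← Finset.sum_fiberwise Finset.univ π]
  refine Finset.dvd_sum fun q _ => ?_
  induction q using Quotient.inductionOn with
  | h a =>
    have h1 : ∀ x ∈ Finset.univ.filter (fun x => π x = π a), w x = w a := by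
      intro x hx
      have hx' := (Finset.mem_filter.1 hx).2
      rw [Quotient.eq'', MulAction.orbitRel_apply] at hx'
      obtain ⟨h, rfl⟩ := hx'
      exact hS h.2 a
    change (orderOf g : ℤ) ∣ ∑ x ∈ Finset.univ.filter (fun x => π x = π a), w x
    rw [Finset.sum_congr rfl h1, Finset.sum_const, nsmul_eq_mul, hcard]
    exact dvd_mul_right _ _

end Action

/-! ### Decomposition of finitely generated projectives into representables -/

section Projectives

variable {k : Type u} [Field k] {C : Type u} [Category.{u} C] [Preadditive C] [Linear k C]

lemma nonempty_iso_biprod_of_retract {D : Type*} [Category* D] [Abelian D] {M W : D}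
    (h : Retract M W) : ∃ N : D, Nonempty (W ≅ M ⊞ N) := by
  have hi : Mono h.i := mono_of_mono_fac h.retract
  have hS : (ShortComplex.mk h.i (cokernel.π h.i) (cokernel.condition _)).ShortExact :=
    ShortComplex.ShortExact.mk' (ShortComplex.exact_cokernel _) hi (by dsimp; infer_instance)
  exact ⟨cokernel h.i, ⟨(ShortComplex.Splitting.ofExactOfRetraction _ hS.exact h.r h.retract
    hS.epi_g).isoBinaryBiproduct⟩⟩

/-- The dimension of a module, measured by the regular module. -/
noncomputable def regRank (M : LinMod k C) : ℕ := Module.finrank k (regularModule k C ⟶ M)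

lemma regRank_of_iso {M N : LinMod k C} (e : M ≅ N) : regRank M = regRank N :=
  LinearEquiv.finrank_eq
    { toFun := fun f : regularModule k C ⟶ M => f ≫ e.hom
      map_add' := by simp
      map_smul' := by simp
      invFun := fun f => f ≫ e.inv
      left_inv := fun f => by simp
      right_inv := fun f => by simp }

variable [Finite C]

/-- Multiplicities in `add P` are additive. -/
lemma isAdditiveOn_multiplicity {P L : LinMod k C} (hP : IsPointwiseFinite P)
    (hL : IsPointwiseFinite L) {χ : (L ⟶ L) →ₗ[k] k} (hχ : IsResidue k χ) :
    IsAdditiveOn P (multiplicity k L) where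
  iso _ e := (multiplicity_iso (Iso.refl L) e).symm
  biprod hX hY := by
    have := (hP.of_isInAdd hX).finite_hom hL
    have := (hP.of_isInAdd hY).finite_hom hL
    exact multiplicity_biprod hχ _ _

variable (hC : IsLocallyBounded k C)

include hC

lemma regRank_biprod {M N : LinMod k C} (hM : IsPointwiseFinite M) (hN : IsPointwiseFinite N) :
    regRank (M ⊞ N) = regRank M + regRank N := by
  have := (isPointwiseFinite_regularModule hC).finite_hom hM
  have := (isPointwiseFinite_regularModule hC).finite_hom hN
  rw [regRank, regRank, regRank, ← Module.finrank_prod]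
  exact LinearEquiv.finrank_eq
    { toFun := fun f => (f ≫ biprod.fst, f ≫ biprod.snd)
      map_add' := by simp
      map_smul' := by simp
      invFun := fun f => biprod.lift f.1 f.2
      left_inv := fun f => biprod.hom_ext _ _ (by simp) (by simp)
      right_inv := fun f => by simp }

lemma regRank_pos {M : LinMod k C} (hM : IsPointwiseFinite M) (h : ¬ IsZero M) :
    0 < regRank M := by
  have := (isPointwiseFinite_regularModule hC).finite_hom hM
  rw [regRank, Module.finrank_pos_iff_exists_ne_zero]
  by_contra! h0
  refine h ((isZero_iff M).2 fun x m => ?_)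
  classical
  have := congrArg (fun t => homAt t x (regOf k (𝟙 x))) (h0 (regDesc (Pi.single x m)))
  simpa [regDesc_regOf] using this

/-- Every nonzero finite dimensional module has an indecomposable direct summand. -/
lemma exists_retract_hasTrivialIdempotents {M : LinMod k C} (hM : IsPointwiseFinite M)
    (h : ¬ IsZero M) : ∃ N : LinMod k C, ¬ IsZero N ∧ HasTrivialIdempotents N ∧
      Nonempty (Retract N M) := by
  induction hn : regRank M using Nat.strong_induction_on generalizing M with
  | _ n ih =>
  by_cases hi : HasTrivialIdempotents M
  · exact ⟨M, h, hi, ⟨Retract.refl M⟩⟩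
  · have hi' : ¬ Indecomposable M := fun h => hi (hasTrivialIdempotents_of_indecomposable h)
    simp only [Indecomposable, not_and, not_forall, not_or] at hi'
    obtain ⟨Y, Z, e, hY, hZ⟩ := hi' h
    have hYM : Retract Y M := (⟨biprod.inl, biprod.fst, by simp⟩ : Retract Y (Y ⊞ Z)).trans
      e.symm.retract
    have hZM : Retract Z M := (⟨biprod.inr, biprod.snd, by simp⟩ : Retract Z (Y ⊞ Z)).trans
      e.symm.retract
    have hYf : IsPointwiseFinite Y := hM.of_isInAdd ((IsInAdd.self M).of_retract hYM)
    have hZf : IsPointwiseFinite Z := hM.of_isInAdd ((IsInAdd.self M).of_retract hZM)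
    have h1 := regRank_biprod hC hYf hZf
    rw [← regRank_of_iso e, hn] at h1
    have h2 := regRank_pos hC hZf hZ
    obtain ⟨N, hN, hN', ⟨r⟩⟩ := ih (regRank Y) (by lia) hYf hY rfl
    exact ⟨N, hN, hN', ⟨r.trans hYM⟩⟩

/-- Existence of the resolution class of a module of finite projective dimension. -/
lemma exists_resClass {V : Type*} [AddCommGroup V] (m : LinMod k C → V) {M : LinMod k C}
    (hM : IsPointwiseFinite M) (n : ℕ) (hn : HasProjectiveDimensionLE M n) :
    ∃ v, ResClass (regularModule k C) m n M v := by
  induction n generalizing M with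
  | zero =>
    have := (projective_iff_hasProjectiveDimensionLE_zero M).2 hn
    exact ⟨_, isInAdd_of_projective hM, rfl⟩
  | succ n ih =>
    obtain ⟨K, Q, f, g, w, hS, hQ, hK⟩ := exists_syzygy hC hM
    have := hQ.projective
    obtain ⟨v, hv⟩ := ih hK (hS.hasProjectiveDimensionLT_X₁ (n + 1)
      (hasProjectiveDimensionLT_of_ge Q 1 (n + 1) (by lia)) hn)
    exact ⟨_, K, Q, f, g, w, hS, hQ, v, hv, rfl⟩

variable [IsAlgClosed k]

/-- A finite dimensional nonzero projective module with trivial idempotents is representable. -/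
lemma nonempty_iso_rep {N : LinMod k C} (hN : IsInAdd (regularModule k C) N) (hN0 : ¬ IsZero N)
    (hN1 : HasTrivialIdempotents N) : ∃ z, Nonempty (repModule k z ≅ N) := by
  have := Fintype.ofFinite C
  have hfd := (isPointwiseFinite_regularModule hC).of_isInAdd hN
  have := hfd.finite_hom hfd
  obtain ⟨χ, hχ⟩ := exists_isResidue k hN0 hN1
  by_contra! hne
  -- If `N` is isomorphic to no representable, then `χ` kills every endomorphism factoring through
  -- one, hence every endomorphism factoring through the regular module. The identity is a sum of
  -- these, yet `χ` sends it to `1`.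
  have hz : ∀ (z : C) (a : N ⟶ repModule k z) (b : repModule k z ⟶ N), χ (a ≫ b) = 0 := by
    intro z a b
    by_contra hab
    have := (hasTrivialIdempotents_rep hC z).isIso hN0 (hχ.isIso _ hab)
    exact (hne z).elim (asIso a).symm
  have hle : factoringThrough (regularModule k C) N N ≤ (χ : (N ⟶ N) →+ k).ker := by
    refine factoringThrough_le fun a b => ?_
    change χ (a ≫ b) = 0
    have : a ≫ b = ∑ z : C, (a ≫ repπ z) ≫ (repι z ≫ b) := by
      calc a ≫ b = a ≫ 𝟙 _ ≫ b := by rw [Category.id_comp]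
        _ = _ := by
          rw [← sum_repπ_repι, Preadditive.sum_comp, Preadditive.comp_sum]
          simp only [Category.assoc]
    rw [this, map_sum]
    exact Finset.sum_eq_zero fun z _ => hz _ _ _
  have h1 : χ (𝟙 N) = 0 := hle hN
  exact one_ne_zero (hχ.one.symm.trans h1)

lemma exists_isResidue_rep (z : C) :
    ∃ χ : (repModule k z ⟶ repModule k z) →ₗ[k] k, IsResidue k χ := by
  have h : IsPointwiseFinite (repModule k z) :=
    (isPointwiseFinite_regularModule hC).of_isInAdd (isInAdd_rep z)
  have := h.finite_hom h
  exact exists_isResidue k (not_isZero_rep hC z) (hasTrivialIdempotents_rep hC z)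

lemma isAdditiveOn_multiplicity_rep :
    IsAdditiveOn (regularModule k C) fun M z => multiplicity k (repModule k z) M where
  iso hX e := by
    ext z
    exact (multiplicity_iso (Iso.refl _) e).symm
  biprod hX hY := by
    ext z
    have hreg := isPointwiseFinite_regularModule hC
    obtain ⟨χ, hχ⟩ := exists_isResidue_rep hC z
    exact (isAdditiveOn_multiplicity hreg (hreg.of_isInAdd (isInAdd_rep z)) hχ).biprod hX hY

/-- Distinct objects are not isomorphic, so distinct representables are non-isomorphic modules with
local endomorphism rings and multiplicity zero in one another. -/
lemma multiplicity_rep [DecidableEq C] (z z' : C) :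
    multiplicity k (repModule k z) (repModule k z') = (Pi.single z' 1 : C → ℤ) z := by
  obtain ⟨χ, hχ⟩ := exists_isResidue_rep hC z
  by_cases h : z = z'
  · subst h
    have h : IsPointwiseFinite (repModule k z) :=
      (isPointwiseFinite_regularModule hC).of_isInAdd (isInAdd_rep z)
    have := h.finite_hom h
    rw [multiplicity_self hχ, Pi.single_eq_same]
  · rw [Pi.single_eq_of_ne h]
    refine multiplicity_eq_zero fun g f hgf => h ?_
    have := (hasTrivialIdempotents_rep hC z').isIso (not_isZero_rep hC z) hgf
    exact hC.eq_of_iso _ _ (nonempty_iso_of_rep_iso (asIso g))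

/-- Coresolution classes of finitely generated projective modules. -/
lemma coresClass_of_isInAdd_reg [Fintype C] {T : LinMod k C} {μ : LinMod k C → ℤ}
    (hμ : IsAdditiveOn T μ)
    (hT : letI := HasExt.standard (LinMod k C)
      ∀ i, 0 < i → Subsingleton (Abelian.Ext.{u + 1} T T i))
    {φ : C → ℤ} (hφ : ∀ z, ∃ n, CoresClass T μ n (repModule k z) (φ z)) {Q : LinMod k C}
    (hQ : IsInAdd (regularModule k C) Q) :
    ∃ n, CoresClass T μ n Q (∑ z, multiplicity k (repModule k z) Q * φ z) := by
  classical
  let := HasExt.standard (LinMod k C)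
  have hq := isAdditiveOn_multiplicity_rep hC
  have hreg := isPointwiseFinite_regularModule hC
  induction hn : regRank Q using Nat.strong_induction_on generalizing Q with
  | _ n ih =>
  by_cases hQ0 : IsZero Q
  · have h1 : ∀ z, multiplicity k (repModule k z) Q = 0 := congrFun (hq.zero hQ0)
    refine ⟨0, IsInAdd.of_isZero hQ0, ?_⟩
    rw [hμ.zero hQ0]
    simp [h1]
  -- Split off one representable; the complement has smaller `regRank`, and the classes add along
  -- the split sequence.
  · obtain ⟨N, hN0, hN1, ⟨r⟩⟩ :=
      exists_retract_hasTrivialIdempotents hC (hreg.of_isInAdd hQ) hQ0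
    obtain ⟨z, ⟨e⟩⟩ := nonempty_iso_rep hC (hQ.of_retract r) hN0 hN1
    obtain ⟨Q', ⟨e'⟩⟩ := nonempty_iso_biprod_of_retract (e.retract.trans r)
    have hQ' : IsInAdd (regularModule k C) Q' :=
      (hQ.of_iso e'.symm).of_retract ⟨biprod.inr, biprod.snd, by simp⟩
    have h1 := regRank_biprod hC (hreg.of_isInAdd (isInAdd_rep z)) (hreg.of_isInAdd hQ')
    rw [← regRank_of_iso e', hn] at h1
    have h2 := regRank_pos hC (hreg.of_isInAdd (isInAdd_rep z)) (not_isZero_rep hC z)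
    obtain ⟨n', hn'⟩ := ih (regRank Q') (by lia) hQ' rfl
    obtain ⟨n'', hn''⟩ := hφ z
    refine ⟨max n' n'', ?_⟩
    have h3 := CoresClass.of_shortExact hμ hT (shortExact_biprod (repModule k z) Q')
      (hn''.mono hμ (le_max_right n' n'')) (hn'.mono hμ (le_max_left n' n''))
    have h4 : ∀ w, multiplicity k (repModule k w) Q =
        (Pi.single z 1 : C → ℤ) w + multiplicity k (repModule k w) Q' := by
      intro w
      have h5 := congrFun (hq.iso hQ e') w
      have h6 := congrFun (hq.biprod (isInAdd_rep z) hQ') w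
      rw [h5, h6, Pi.add_apply]
      rw [multiplicity_rep hC]
    convert h3.of_iso hμ e' using 1
    simp [h4, add_mul, Finset.sum_add_distrib, Pi.single_apply]

end Projectives

/-! ### Triviality of stabilizers of summands of an invariant tilting module -/

section Stabilizers

variable {k : Type u} [Field k]
variable {C : Type u} [Category.{u} C] [Preadditive C] [Linear k C]

lemma InAdd.isInAdd {T X : LinMod k C} (h : InAdd T X) : IsInAdd T X := by
  obtain ⟨m, N, hN, ⟨e⟩⟩ := h
  refine (IsInAdd.biproduct N fun i => ?_).of_iso e
  obtain ⟨N', ⟨e'⟩⟩ := hN i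
  exact ((IsInAdd.self T).of_iso e'.symm).of_retract ⟨biprod.inl, biprod.fst, by simp⟩

lemma HasAddCoresolution.exists_coresClass {V : Type*} [AddCommGroup V] (m : LinMod k C → V)
    {T X : LinMod k C} (h : HasAddCoresolution T X) : ∃ n c, CoresClass T m n X c := by
  induction h with
  | of_inAdd X hX => exact ⟨0, _, hX.isInAdd, rfl⟩
  | splice f g w hS hY _ ih =>
    obtain ⟨n, c, h⟩ := ih
    exact ⟨n + 1, _, _, _, f, g, w, hS, hY.isInAdd, c, h, rfl⟩

variable [IsAlgClosed k] [Finite C] (hC : IsLocallyBounded k C)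
  {G : Type w} [Group G] [Finite G] (ρ : CatAction k G C)
include hC

/-- If `T` is a tilting module invariant under an element `g` of a finite group acting freely on
the objects, then no indecomposable direct summand of `T` is invariant under `g` unless `g = 1`. -/
theorem eq_one_of_twist_iso (hρ : ∀ (g : G) (x : C), (ρ.act g).obj x = x → g = 1)
    {T L : LinMod k C} (hT : IsTilting T) (r : Retract L T) (hL0 : ¬ IsZero L)
    (hL : HasTrivialIdempotents L) (g : G) (hgT : (ρ.twist g).obj T ≅ T)
    (hgL : (ρ.twist g).obj L ≅ L) : g = 1 := by
  classical
  have := Fintype.ofFinite C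
  let := HasExt.standard (LinMod k C)
  let := ρ.mulAction
  have hTf := (isFinDim_iff T).1 hT.isFinDim
  have hExt := hT.ext_eq_zero
  have hreg := isPointwiseFinite_regularModule hC
  have hLT : IsInAdd T L := (IsInAdd.self T).of_retract r
  have hLf := hTf.of_isInAdd hLT
  have := hLf.finite_hom hLf
  obtain ⟨χ, hχ⟩ := exists_isResidue k hL0 hL
  let μ : LinMod k C → ℤ := multiplicity k L
  have hμ : IsAdditiveOn T μ := isAdditiveOn_multiplicity hTf hLf hχ
  let q : LinMod k C → C → ℤ := fun M z => multiplicity k (repModule k z) M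
  have hq : IsAdditiveOn (regularModule k C) q := isAdditiveOn_multiplicity_rep hC
  -- Representables are summands of the regular module, and having a coresolution in `add T` passes
  -- to summands.
  have hrep : ∀ z : C, ∃ n c, CoresClass T μ n (repModule k z) c := by
    intro z
    obtain ⟨n, c, h⟩ := hT.coresolution.exists_coresClass μ
    obtain ⟨N, ⟨e⟩⟩ := nonempty_iso_biprod_of_retract
      (⟨repι z, repπ z, repι_repπ z⟩ : Retract (repModule k z) (regularModule k C))
    obtain ⟨c', h'⟩ := h.summand hμ hExt e
    exact ⟨n, c', h'⟩
  choose n φ hφ using hrep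
  have hrepTwist : ∀ z : C,
      Nonempty ((ρ.twist g).obj (repModule k (g • z)) ≅ repModule k z) :=
    fun z => nonempty_pullUp_rep_iso _ _ _ z
  have hμg : ∀ X, μ ((ρ.twist g).obj X) = μ X := fun X =>
    multiplicity_map (ρ.twist g) hgL (Iso.refl _)
  -- Twisting by `g` preserves `add T` and multiplicities of `L`, so it turns a coresolution at `g •
  -- z` into one at `z` of the same class; classes are unique.
  have hφg : ∀ z : C, φ (g • z) = φ z := by
    intro z
    obtain ⟨e⟩ := hrepTwist z
    have h := (hφ (g • z)).map (ρ.twist g) ((IsInAdd.self T).of_iso hgT) fun X _ => hμg X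
    exact (h.of_iso hμ e.symm).eq hμ hExt (hφ z)
  obtain ⟨d, hd⟩ := hT.finite_pd
  have hLd : HasProjectiveDimensionLE L d := r.hasProjectiveDimensionLT (d + 1)
  obtain ⟨v, hv⟩ := exists_resClass hC q hLf d hLd
  have hregTwist : IsInAdd (regularModule k C) ((ρ.twist g).obj (regularModule k C)) := by
    refine IsInAdd.of_sum _ (fun z => (ρ.twist g).map (repπ z))
      (fun z => (ρ.twist g).map (repι z)) ?_ fun z => ?_
    · simp_rw [← Functor.map_comp]
      rw [← Functor.map_sum, sum_repπ_repι, CategoryTheory.Functor.map_id]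
    · obtain ⟨e⟩ := hrepTwist (g⁻¹ • z)
      rw [smul_inv_smul] at e
      exact (isInAdd_rep _).of_iso e
  -- The twist of a resolution of `L` resolves a module isomorphic to `L`, with the multiplicities
  -- permuted by `g`; uniqueness of the class makes `v` invariant.
  have hvg : ∀ z : C, v (g • z) = v z := by
    let s : (C → ℤ) →+ (C → ℤ) :=
      { toFun := fun f z => f (g • z)
        map_zero' := rfl
        map_add' := fun _ _ => rfl }
    have h := (hv.map (ρ.twist g) hregTwist s fun X _ => by
      ext z
      obtain ⟨e⟩ := hrepTwist z
      exact multiplicity_map (ρ.twist g) e (Iso.refl _)).of_iso hq hgL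
    intro z
    exact (congrFun (hv.eq hq h) z).symm
  let Φ : (C → ℤ) →+ ℤ :=
    { toFun := fun f => ∑ z, f z * φ z
      map_zero' := by simp
      map_add' := fun f f' => by simp [add_mul, Finset.sum_add_distrib] }
  -- The class of `L` is computed twice: as an object of `add T` it is `1`, and through its
  -- projective resolution it is the sum below.
  have hL1 : CoresClass T μ 0 L 1 := ⟨hLT, (multiplicity_self hχ).symm⟩
  have h1 : (1 : ℤ) = ∑ z, v z * φ z := hv.coresClass hμ hExt Φ
    (fun Q hQ => coresClass_of_isInAdd_reg hC hμ hExt (fun z => ⟨_, hφ z⟩) hQ) hL1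
  have h2 : (orderOf g : ℤ) ∣ 1 := by
    rw [h1]
    exact orderOf_dvd_sum g hρ _ fun z => by rw [hvg, hφg]
  exact orderOf_eq_one_iff.1 (Nat.dvd_one.1 (by exact_mod_cast h2))

end Stabilizers

/-! ### The orbit category of a covering -/

section OrbitCategory

variable {k : Type u} [Field k] {G : Type w} [Group G]
variable {E : Type u} [Category.{u} E] [Preadditive E] [Linear k E]
variable {B : Type u} [Category.{u} B] [Preadditive B] [Linear k B]

/-- The relation of lying in the same orbit. -/
def CatAction.orbitSetoid (ρ : CatAction k G E) : Setoid E :=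
  letI := ρ.mulAction
  MulAction.orbitRel G E

variable {ρ : CatAction k G E} {F : E ⥤ B}

lemma CatAction.act_mul_obj (ρ : CatAction k G E) (g h : G) (x : E) :
    (ρ.act (g * h)).obj x = (ρ.act g).obj ((ρ.act h).obj x) := by
  rw [ρ.act_mul]; rfl

lemma CatAction.act_one_obj (ρ : CatAction k G E) (x : E) : (ρ.act 1).obj x = x := by
  rw [ρ.act_one]; rfl

lemma CatAction.orbit_iff (ρ : CatAction k G E) {x y : E} :
    ρ.orbitSetoid x y ↔ ∃ g, (ρ.act g).obj x = y := by
  let := ρ.mulAction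
  change (∃ g : G, (ρ.act g).obj y = x) ↔ _
  constructor
  · rintro ⟨g, rfl⟩
    exact ⟨g⁻¹, by rw [← ρ.act_mul_obj, inv_mul_cancel, ρ.act_one_obj]⟩
  · rintro ⟨g, rfl⟩
    exact ⟨g⁻¹, by rw [← ρ.act_mul_obj, inv_mul_cancel, ρ.act_one_obj]⟩

omit [Preadditive B] in
lemma eqToHom_comp_eq_of_heq {X X' Y Y' : B} {f : X ⟶ Y} {f' : X' ⟶ Y'} (hX : X' = X)
    (hY : Y = Y') (h : HEq f f') : eqToHom hX ≫ f ≫ eqToHom hY = f' := by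
  subst hX hY
  simpa using h

namespace IsGaloisCovering

variable (hF : IsGaloisCovering k ρ F)
include hF

lemma obj_act (g : G) (x : E) : F.obj ((ρ.act g).obj x) = F.obj x :=
  Functor.congr_obj (hF.comp_eq g) x

lemma act_injective {g h : G} {x : E} (e : (ρ.act g).obj x = (ρ.act h).obj x) : g = h := by
  have h1 : (ρ.act (h⁻¹ * g)).obj x = x := by
    rw [ρ.act_mul_obj, e, ← ρ.act_mul_obj, inv_mul_cancel, ρ.act_one_obj]
  exact (inv_mul_eq_one.1 (hF.free _ _ h1)).symm

/-- The category of orbits: the morphisms are the morphisms of `B` together with a matrix of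
morphisms of `E` lifting them. -/
def Orbits (_ : IsGaloisCovering k ρ F) : Type u := _root_.Quotient ρ.orbitSetoid

/-- The orbit of an object. -/
def orbitOf (x : E) : hF.Orbits := Quotient.mk ρ.orbitSetoid x

lemma orbitOf_eq_iff {x y : E} : hF.orbitOf x = hF.orbitOf y ↔ ∃ g, (ρ.act g).obj x = y :=
  Quotient.eq''.trans ρ.orbit_iff

/-- The image in `B` of an orbit. -/
def image : hF.Orbits → B :=
  Quotient.lift F.obj fun x y h => by
    obtain ⟨g, rfl⟩ := ρ.orbit_iff.1 h
    exact (hF.obj_act g x).symm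

lemma exists_orbitOf (a : hF.Orbits) : ∃ x, hF.orbitOf x = a := Quotient.exists_rep a

/-- The objects in an orbit. -/
abbrev Fiber (a : hF.Orbits) : Type u := {x : E // hF.orbitOf x = a}

lemma obj_fiber {a : hF.Orbits} (x : hF.Fiber a) : F.obj x.1 = hF.image a := by
  obtain ⟨x, rfl⟩ := x
  rfl

lemma exists_act {x : E} (x' : hF.Fiber (hF.orbitOf x)) : ∃ g, (ρ.act g).obj x = x'.1 :=
  hF.orbitOf_eq_iff.1 x'.2.symm

/-- The translate of an object in its orbit. -/
def translate (x : E) (g : G) : hF.Fiber (hF.orbitOf x) :=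
  ⟨(ρ.act g).obj x, (hF.orbitOf_eq_iff.2 ⟨g, rfl⟩).symm⟩

instance [Finite G] (a : hF.Orbits) : Finite (hF.Fiber a) := by
  obtain ⟨x, rfl⟩ := hF.exists_orbitOf a
  exact Finite.of_surjective (hF.translate x) fun x' =>
    (hF.exists_act x').imp fun _ hg => Subtype.ext hg

noncomputable instance [Finite G] (a : hF.Orbits) : Fintype (hF.Fiber a) := Fintype.ofFinite _

/-- The functor `F` on a morphism between given objects of two orbits. -/
def mapFiber {a b : hF.Orbits} (x : hF.Fiber a) (y : hF.Fiber b) (u : x.1 ⟶ y.1) :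
    hF.image a ⟶ hF.image b :=
  eqToHom (hF.obj_fiber x).symm ≫ F.map u ≫ eqToHom (hF.obj_fiber y)

lemma mapFiber_id {a : hF.Orbits} (x : hF.Fiber a) : hF.mapFiber x x (𝟙 _) = 𝟙 _ := by
  simp [mapFiber]

lemma mapFiber_comp {a b c : hF.Orbits} (x : hF.Fiber a) (y : hF.Fiber b) (z : hF.Fiber c)
    (u : x.1 ⟶ y.1) (v : y.1 ⟶ z.1) :
    hF.mapFiber x z (u ≫ v) = hF.mapFiber x y u ≫ hF.mapFiber y z v := by
  simp [mapFiber]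

lemma mapFiber_add {a b : hF.Orbits} (x : hF.Fiber a) (y : hF.Fiber b) (u v : x.1 ⟶ y.1) :
    hF.mapFiber x y (u + v) = hF.mapFiber x y u + hF.mapFiber x y v := by
  have := hF.additive
  simp [mapFiber]

lemma mapFiber_zero {a b : hF.Orbits} (x : hF.Fiber a) (y : hF.Fiber b) :
    hF.mapFiber x y 0 = 0 := by
  have := hF.additive
  simp [mapFiber]

lemma mapFiber_smul {a b : hF.Orbits} (x : hF.Fiber a) (y : hF.Fiber b) (c : k)
    (u : x.1 ⟶ y.1) : hF.mapFiber x y (c • u) = c • hF.mapFiber x y u := by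
  have := hF.additive
  have := hF.linear
  simp [mapFiber]

lemma mapFiber_sum {a b : hF.Orbits} (x : hF.Fiber a) (y : hF.Fiber b) {J : Type*}
    (s : Finset J) (u : J → (x.1 ⟶ y.1)) :
    hF.mapFiber x y (∑ j ∈ s, u j) = ∑ j ∈ s, hF.mapFiber x y (u j) := by
  have := hF.additive
  simp [mapFiber, Functor.map_sum, Preadditive.sum_comp, Preadditive.comp_sum]

section

variable [Finite G]

/-- The morphisms of the orbit category. -/
def OrbitHom (a b : hF.Orbits) :
    Submodule k ((hF.image a ⟶ hF.image b) × (∀ (x : hF.Fiber a) (y : hF.Fiber b), x.1 ⟶ y.1)) where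
  -- Row sums will describe the action of a morphism on the inclusions into a push-down, column sums
  -- its action on the projections. Equivariance of the matrix is not imposed, as it is never
  -- needed.
  carrier := {f | (∀ x, ∑ y, hF.mapFiber x y (f.2 x y) = f.1) ∧
    ∀ y, ∑ x, hF.mapFiber x y (f.2 x y) = f.1}
  add_mem' {f g} hf hg := by
    constructor <;> intro x <;>
      simp [mapFiber_add, Finset.sum_add_distrib, hf.1, hg.1, hf.2, hg.2]
  zero_mem' := by constructor <;> intro x <;> simp [mapFiber_zero]
  smul_mem' c f hf := by
    constructor <;> intro x <;>
      simp [mapFiber_smul, ← Finset.smul_sum, hf.1, hf.2]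

open Classical in
noncomputable instance : Category.{u} hF.Orbits where
  Hom a b := hF.OrbitHom a b
  id a := ⟨(𝟙 _, fun x y => if h : x = y then eqToHom (by rw [h]) else 0), by
    constructor
    · intro x
      rw [Finset.sum_eq_single x]
      · simp [mapFiber_id]
      · intro y _ hy
        simp [Ne.symm hy, mapFiber_zero]
      · simp
    · intro x
      rw [Finset.sum_eq_single x]
      · simp [mapFiber_id]
      · intro y _ hy
        simp [hy, mapFiber_zero]
      · simp⟩
  comp {a b c} f g := ⟨(f.1.1 ≫ g.1.1, fun x z => ∑ y, f.1.2 x y ≫ g.1.2 y z), by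
    constructor
    · intro x
      simp only [mapFiber_sum]
      rw [Finset.sum_comm, ← f.2.1 x, Preadditive.sum_comp]
      refine Finset.sum_congr rfl fun y _ => ?_
      rw [← g.2.1 y, Preadditive.comp_sum]
      exact Finset.sum_congr rfl fun z _ => hF.mapFiber_comp x y z _ _
    · intro z
      simp only [mapFiber_sum]
      rw [Finset.sum_comm, ← g.2.2 z, Preadditive.comp_sum]
      refine Finset.sum_congr rfl fun y _ => ?_
      rw [← f.2.2 y, Preadditive.sum_comp]
      exact Finset.sum_congr rfl fun x _ => hF.mapFiber_comp x y z _ _⟩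
  id_comp {a b} f := by
    refine Subtype.ext (Prod.ext (Category.id_comp _) ?_)
    funext x y
    dsimp only
    rw [Finset.sum_eq_single x]
    · simp
    · intro z _ hz
      simp [Ne.symm hz]
    · simp
  comp_id {a b} f := by
    refine Subtype.ext (Prod.ext (Category.comp_id _) ?_)
    funext x y
    dsimp only
    rw [Finset.sum_eq_single y]
    · simp
    · intro z _ hz
      simp [hz]
    · simp
  assoc {a b c d} f g h := by
    refine Subtype.ext (Prod.ext (Category.assoc _ _ _) ?_)
    funext x y
    dsimp only
    simp only [Preadditive.sum_comp, Preadditive.comp_sum, Category.assoc]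
    exact Finset.sum_comm

noncomputable instance : Preadditive hF.Orbits where
  homGroup a b := inferInstanceAs (AddCommGroup (hF.OrbitHom a b))
  add_comp a b c f g h := by
    refine Subtype.ext (Prod.ext (Preadditive.add_comp _ _ _ _ _ _) ?_)
    funext x z
    change ∑ y, (f.1.2 x y + g.1.2 x y) ≫ h.1.2 y z =
      ∑ y, f.1.2 x y ≫ h.1.2 y z + ∑ y, g.1.2 x y ≫ h.1.2 y z
    simp [Finset.sum_add_distrib]
  comp_add a b c f g h := by
    refine Subtype.ext (Prod.ext (Preadditive.comp_add _ _ _ _ _ _) ?_)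
    funext x z
    change ∑ y, f.1.2 x y ≫ (g.1.2 y z + h.1.2 y z) =
      ∑ y, f.1.2 x y ≫ g.1.2 y z + ∑ y, f.1.2 x y ≫ h.1.2 y z
    simp [Finset.sum_add_distrib]

noncomputable instance : Linear k hF.Orbits where
  homModule a b := inferInstanceAs (Module k (hF.OrbitHom a b))
  smul_comp a b c r f g := by
    refine Subtype.ext (Prod.ext (Linear.smul_comp _ _ _ _ _ _) ?_)
    funext x z
    change ∑ y, (r • f.1.2 x y) ≫ g.1.2 y z = r • ∑ y, f.1.2 x y ≫ g.1.2 y z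
    simp [Finset.smul_sum]
  comp_smul a b c f r g := by
    refine Subtype.ext (Prod.ext (Linear.comp_smul _ _ _ _ _ _) ?_)
    funext x z
    change ∑ y, f.1.2 x y ≫ (r • g.1.2 y z) = r • ∑ y, f.1.2 x y ≫ g.1.2 y z
    simp [Finset.smul_sum]

/-- The projection of the orbit category to `B`. -/
noncomputable def orbitsToBase : hF.Orbits ⥤ B where
  obj := hF.image
  map f := f.1.1

instance : hF.orbitsToBase.Additive where
  map_add := rfl

instance : hF.orbitsToBase.Linear k where
  map_smul _ _ := rfl

omit [Finite G] in
lemma heq_map_act (g : G) {x y : E} (u : x ⟶ y) :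
    HEq (F.map ((ρ.act g).map u)) (F.map u) :=
  Functor.hcongr_hom (hF.comp_eq g) u

open Classical in
/-- The matrix of translates of a morphism. -/
noncomputable def translates {x y : E} (u : x ⟶ y) (x' : hF.Fiber (hF.orbitOf x))
    (y' : hF.Fiber (hF.orbitOf y)) : x'.1 ⟶ y'.1 :=
  if h : ∃ g, (ρ.act g).obj x = x'.1 ∧ (ρ.act g).obj y = y'.1 then
    eqToHom h.choose_spec.1.symm ≫ (ρ.act h.choose).map u ≫ eqToHom h.choose_spec.2
  else 0

omit [Finite G] in
-- Freeness makes the group element in the definition of `translates` unique, so the choice made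
-- there does not matter.
lemma translates_of_eq {x y : E} (u : x ⟶ y) (g : G) {x' : hF.Fiber (hF.orbitOf x)}
    {y' : hF.Fiber (hF.orbitOf y)} (hx : (ρ.act g).obj x = x'.1) (hy : (ρ.act g).obj y = y'.1) :
    hF.translates u x' y' = eqToHom hx.symm ≫ (ρ.act g).map u ≫ eqToHom hy := by
  have h : ∃ g, (ρ.act g).obj x = x'.1 ∧ (ρ.act g).obj y = y'.1 := ⟨g, hx, hy⟩
  have key : ∀ (g' : G) (hx' : (ρ.act g').obj x = x'.1) (hy' : (ρ.act g').obj y = y'.1),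
      eqToHom hx'.symm ≫ (ρ.act g').map u ≫ eqToHom hy' =
        eqToHom hx.symm ≫ (ρ.act g).map u ≫ eqToHom hy := by
    intro g' hx' hy'
    obtain rfl : g' = g := hF.act_injective (hx'.trans hx.symm)
    rfl
  rw [translates, dif_pos h]
  exact key h.choose h.choose_spec.1 h.choose_spec.2

omit [Finite G] in
lemma translates_of_ne {x y : E} (u : x ⟶ y) (g : G) {x' : hF.Fiber (hF.orbitOf x)}
    {y' : hF.Fiber (hF.orbitOf y)} (hx : (ρ.act g).obj x = x'.1) (hy : (ρ.act g).obj y ≠ y'.1) :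
    hF.translates u x' y' = 0 := by
  refine dif_neg ?_
  rintro ⟨g', hx', hy'⟩
  obtain rfl : g' = g := hF.act_injective (hx'.trans hx.symm)
  exact hy hy'

omit [Finite G] in
lemma translates_translate_left {x y : E} (u : x ⟶ y) (g : G) {y' : hF.Fiber (hF.orbitOf y)}
    (h : (ρ.act g).obj y = y'.1) :
    hF.translates u (hF.translate x g) y' = (ρ.act g).map u ≫ eqToHom h :=
  (hF.translates_of_eq u g rfl h).trans (Category.id_comp _)

omit [Finite G] in
lemma translates_translate {x y : E} (u : x ⟶ y) (g : G) :
    hF.translates u (hF.translate x g) (hF.translate y g) = (ρ.act g).map u :=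
  (hF.translates_translate_left u g rfl).trans (Category.comp_id _)

omit [Finite G] in
lemma mapFiber_translates {x y : E} (u : x ⟶ y) (g : G) :
    hF.mapFiber (hF.translate x g) (hF.translate y g)
      (hF.translates u (hF.translate x g) (hF.translate y g)) = F.map u := by
  rw [hF.translates_translate u g]
  exact eqToHom_comp_eq_of_heq _ _ (hF.heq_map_act g u)

lemma orbits_id_snd_self {a : hF.Orbits} (x : hF.Fiber a) : (𝟙 a : a ⟶ a).1.2 x x = 𝟙 _ := by
  classical exact dif_pos rfl

lemma orbits_id_snd_ne {a : hF.Orbits} {x y : hF.Fiber a} (h : x ≠ y) :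
    (𝟙 a : a ⟶ a).1.2 x y = 0 := by
  classical exact dif_neg h

/-- The quotient functor to the orbit category. -/
noncomputable def toOrbits : E ⥤ hF.Orbits where
  obj := hF.orbitOf
  map {x y} u := ⟨(F.map u, hF.translates u), by
    constructor
    · intro x'
      obtain ⟨g, hg⟩ := hF.exists_act x'
      obtain rfl : hF.translate x g = x' := Subtype.ext hg
      -- In the row of the translate of `x` by `g`, only the column of the translate of `y` by `g`
      -- is nonzero.
      rw [Finset.sum_eq_single (hF.translate y g), mapFiber_translates]
      · intro y' _ hy'
        change hF.mapFiber _ y' (hF.translates u _ y') = 0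
        rw [hF.translates_of_ne u g rfl fun h => hy' (Subtype.ext h.symm), mapFiber_zero]
      · simp
    · intro y'
      obtain ⟨g, hg⟩ := hF.exists_act y'
      obtain rfl : hF.translate y g = y' := Subtype.ext hg
      rw [Finset.sum_eq_single (hF.translate x g), mapFiber_translates]
      · intro x' _ hx'
        obtain ⟨g', hg'⟩ := hF.exists_act x'
        obtain rfl : hF.translate x g' = x' := Subtype.ext hg'
        change hF.mapFiber (hF.translate x g') _ (hF.translates u (hF.translate x g') _) = 0
        rw [hF.translates_of_ne u g' hg' fun h => hx' ?_, mapFiber_zero]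
        rw [hF.act_injective h]
      · simp⟩
  map_id x := by
    refine Subtype.ext (Prod.ext (F.map_id x) ?_)
    funext x' y'
    obtain ⟨g, hg⟩ := hF.exists_act x'
    obtain rfl : hF.translate x g = x' := Subtype.ext hg
    change hF.translates (𝟙 x) _ _ = _
    by_cases h : hF.translate x g = y'
    · subst h
      rw [orbits_id_snd_self, translates_translate, CategoryTheory.Functor.map_id]
      rfl
    · rw [hF.orbits_id_snd_ne h, hF.translates_of_ne _ g hg fun h' => h (Subtype.ext h')]
  map_comp {x y z} u v := by
    refine Subtype.ext (Prod.ext (F.map_comp u v) ?_)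
    funext x' z'
    obtain ⟨g, hg⟩ := hF.exists_act x'
    obtain rfl : hF.translate x g = x' := Subtype.ext hg
    change hF.translates (u ≫ v) _ _ = ∑ y', hF.translates u _ y' ≫ hF.translates v y' _
    rw [Finset.sum_eq_single (hF.translate y g)]
    · by_cases h : (ρ.act g).obj z = z'.1
      · rw [hF.translates_translate u g, hF.translates_translate_left v g h,
          hF.translates_translate_left (u ≫ v) g h, CategoryTheory.Functor.map_comp]
        exact Category.assoc _ _ _
      · rw [hF.translates_of_ne v g rfl h, hF.translates_of_ne (u ≫ v) g rfl h, comp_zero]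
    · intro y' _ hy'
      rw [hF.translates_of_ne u g rfl fun h => hy' (Subtype.ext h.symm), zero_comp]
    · simp

end

end IsGaloisCovering

end OrbitCategory

/-! ### Lifting morphisms of the base to matrices -/

section OrbitCategory

variable {k : Type u} [Field k] {G : Type w} [Group G]
variable {E : Type u} [Category.{u} E] [Preadditive E] [Linear k E]
variable {B : Type u} [Category.{u} B] [Preadditive B] [Linear k B]
variable {ρ : CatAction k G E} {F : E ⥤ B}

lemma CatAction.heq_act_one (ρ : CatAction k G E) {x y : E} (u : x ⟶ y) :
    HEq ((ρ.act 1).map u) u :=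
  Functor.hcongr_hom ρ.act_one u

lemma CatAction.heq_act_mul (ρ : CatAction k G E) (g h : G) {x y : E} (u : x ⟶ y) :
    HEq ((ρ.act (g * h)).map u) ((ρ.act g).map ((ρ.act h).map u)) :=
  Functor.hcongr_hom (ρ.act_mul g h) u

namespace IsGaloisCovering

variable (hF : IsGaloisCovering k ρ F)
include hF

section

variable [Finite G]

lemma orbits_hom_heq {a a' b b' : hF.Orbits} (ha : a = a') (hb : b = b') (f : a ⟶ b)
    (f' : a' ⟶ b') (h₁ : HEq f.1.1 f'.1.1)
    (h₂ : ∀ (x y : E) (hx : hF.orbitOf x = a) (hx' : hF.orbitOf x = a') (hy : hF.orbitOf y = b)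
      (hy' : hF.orbitOf y = b'), f.1.2 ⟨x, hx⟩ ⟨y, hy⟩ = f'.1.2 ⟨x, hx'⟩ ⟨y, hy'⟩) :
    HEq f f' := by
  subst ha hb
  refine heq_of_eq (Subtype.ext (Prod.ext (eq_of_heq h₁) ?_))
  funext x y
  exact h₂ x.1 y.1 x.2 x.2 y.2 y.2

lemma heq_fst {a a' b b' : hF.Orbits} (ha : a = a') (hb : b = b') {f : a ⟶ b}
    {f' : a' ⟶ b'} (h : HEq f f') : HEq f.1.1 f'.1.1 := by
  subst ha hb
  rw [eq_of_heq h]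

lemma snd_eq_of_heq {a a' b b' : hF.Orbits} (ha : a = a') (hb : b = b') {f : a ⟶ b}
    {f' : a' ⟶ b'} (h : HEq f f') (x y : E) (hx : hF.orbitOf x = a) (hx' : hF.orbitOf x = a')
    (hy : hF.orbitOf y = b) (hy' : hF.orbitOf y = b') :
    f.1.2 ⟨x, hx⟩ ⟨y, hy⟩ = f'.1.2 ⟨x, hx'⟩ ⟨y, hy'⟩ := by
  subst ha hb
  rw [eq_of_heq h]

omit [Finite G] in
/-- The matrix of translates is determined by two rules. -/
lemma translates_cases {x y : E} {x' : hF.Fiber (hF.orbitOf x)} {y' : hF.Fiber (hF.orbitOf y)}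
    {P : ((x ⟶ y) → (x'.1 ⟶ y'.1)) → Prop}
    (h₁ : ∀ (g : G) (hx : (ρ.act g).obj x = x'.1) (hy : (ρ.act g).obj y = y'.1),
      P fun u => eqToHom hx.symm ≫ (ρ.act g).map u ≫ eqToHom hy)
    (h₂ : P fun _ => 0) : P fun u => hF.translates u x' y' := by
  obtain ⟨g, hx⟩ := hF.exists_act x'
  by_cases hy : (ρ.act g).obj y = y'.1
  · have h := funext fun u : x ⟶ y => hF.translates_of_eq u g hx hy
    rw [h]
    exact h₁ g hx hy
  · have h := funext fun u : x ⟶ y => hF.translates_of_ne u g hx hy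
    rw [h]
    exact h₂

instance : hF.toOrbits.Additive where
  map_add {x y u v} := by
    have := hF.additive
    refine Subtype.ext (Prod.ext F.map_add ?_)
    funext x' y'
    refine hF.translates_cases (P := fun t => t (u + v) = t u + t v) (fun g _ _ => ?_)
      (add_zero 0).symm
    have := ρ.additive g
    simp

instance : hF.toOrbits.Linear k where
  map_smul {x y} u c := by
    have := hF.additive
    have := hF.linear
    refine Subtype.ext (Prod.ext (F.map_smul c u) ?_)
    funext x' y'
    refine hF.translates_cases (P := fun t => t (c • u) = c • t u) (fun g _ _ => ?_)
      (smul_zero c).symm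
    have := ρ.additive g
    have := ρ.linear g
    simp

/-- The translate by `h` of `g u` is the translate by `h g` of `u`, so `u` and `g u` have the same
matrix. This invariance is the hypothesis of the universal property. -/
lemma act_comp_toOrbits (g : G) : ρ.act g ⋙ hF.toOrbits = hF.toOrbits := by
  have ho : ∀ x, hF.orbitOf ((ρ.act g).obj x) = hF.orbitOf x := fun x =>
    (hF.orbitOf_eq_iff.2 ⟨g, rfl⟩).symm
  refine CategoryTheory.Functor.hext ho fun x y u => ?_
  refine hF.orbits_hom_heq (ho x) (ho y) _ _ (hF.heq_map_act g u) fun x' y' hx hx' hy hy' => ?_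
  change hF.translates ((ρ.act g).map u) ⟨x', hx⟩ ⟨y', hy⟩ = hF.translates u ⟨x', hx'⟩ ⟨y', hy'⟩
  obtain ⟨h, h1⟩ := hF.exists_act ⟨x', hx⟩
  have h1' : (ρ.act (h * g)).obj x = x' := by rw [ρ.act_mul_obj, h1]
  by_cases h2 : (ρ.act h).obj ((ρ.act g).obj y) = y'
  · have h2' : (ρ.act (h * g)).obj y = y' := by rw [ρ.act_mul_obj, h2]
    rw [hF.translates_of_eq _ h h1 h2, hF.translates_of_eq u (h * g) h1' h2']
    dsimp only at h1 h2
    subst h1 h2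
    simp only [eqToHom_refl, Category.id_comp, Category.comp_id]
    exact (eqToHom_comp_eq_of_heq _ _ (ρ.heq_act_mul h g u)).symm
  · rw [hF.translates_of_ne _ h h1 h2, hF.translates_of_ne u (h * g) h1' ?_]
    rwa [ρ.act_mul_obj]

/-- The universal property applied to the orbit category. -/
lemma exists_section : ∃ H : B ⥤ hF.Orbits, H.Additive ∧ F ⋙ H = hF.toOrbits ∧
    H ⋙ hF.orbitsToBase = 𝟭 B := by
  obtain ⟨H, ⟨h1, h2, h3⟩, -⟩ := hF.existsUnique_fac hF.Orbits hF.toOrbits inferInstance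
    inferInstance hF.act_comp_toOrbits
  refine ⟨H, h1, h3, ?_⟩
  -- Both `H ⋙ hF.orbitsToBase` and the identity factor `F` through itself, so the uniqueness half
  -- of the universal property identifies them.
  have hcomp : F ⋙ H ⋙ hF.orbitsToBase = F := by
    rw [← Functor.assoc, h3]
    exact Functor.hext (fun _ => rfl) fun _ _ _ => HEq.rfl
  exact (hF.existsUnique_fac B F hF.additive hF.linear hF.comp_eq).unique
    ⟨inferInstance, inferInstance, hcomp⟩ ⟨inferInstance, inferInstance, Functor.comp_id F⟩

lemma surjective_obj (b : B) : ∃ x, F.obj x = b := by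
  obtain ⟨H, -, -, h⟩ := hF.exists_section
  obtain ⟨x, hx⟩ := hF.exists_orbitOf (H.obj b)
  refine ⟨x, ?_⟩
  have : hF.image (H.obj b) = b := Functor.congr_obj h b
  rw [← this, ← hx]
  rfl

lemma exists_act_eq {x y : E} (h : F.obj x = F.obj y) : ∃ g, (ρ.act g).obj x = y := by
  obtain ⟨H, -, h1, -⟩ := hF.exists_section
  refine hF.orbitOf_eq_iff.1 ?_
  have hx : H.obj (F.obj x) = hF.orbitOf x := Functor.congr_obj h1 x
  have hy : H.obj (F.obj y) = hF.orbitOf y := Functor.congr_obj h1 y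
  rw [← hx, ← hy, h]

lemma orbitOf_eq_iff_obj {x y : E} : hF.orbitOf x = hF.orbitOf y ↔ F.obj x = F.obj y := by
  refine ⟨fun h => ?_, fun h => hF.orbitOf_eq_iff.2 (hF.exists_act_eq h)⟩
  obtain ⟨g, rfl⟩ := hF.orbitOf_eq_iff.1 h
  exact (hF.obj_act g x).symm

/-- The functor `B ⥤ E/G` on the morphisms between the images of two objects of `E`. -/
lemma exists_lift (x y : E) :
    ∃ Ψ : (F.obj x ⟶ F.obj y) →+ (hF.toOrbits.obj x ⟶ hF.toOrbits.obj y),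
      (∀ v, (Ψ v).1.1 = v) ∧
      ∀ (x' y' : E) (hx : F.obj x' = F.obj x) (hy : F.obj y' = F.obj y) (u : x' ⟶ y')
        (z w : E) (hz : hF.orbitOf z = hF.orbitOf x) (hz' : hF.orbitOf z = hF.orbitOf x')
        (hw : hF.orbitOf w = hF.orbitOf y) (hw' : hF.orbitOf w = hF.orbitOf y'),
        (Ψ (eqToHom hx.symm ≫ F.map u ≫ eqToHom hy)).1.2 ⟨z, hz⟩ ⟨w, hw⟩ =
          hF.translates u ⟨z, hz'⟩ ⟨w, hw'⟩ := by
  obtain ⟨H, hadd, h1, h2⟩ := hF.exists_section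
  have hobj : ∀ x, H.obj (F.obj x) = hF.toOrbits.obj x := Functor.congr_obj h1
  let Ψ : (F.obj x ⟶ F.obj y) →+ (hF.toOrbits.obj x ⟶ hF.toOrbits.obj y) :=
    { toFun := fun v => eqToHom (hobj x).symm ≫ H.map v ≫ eqToHom (hobj y)
      map_zero' := by simp
      map_add' := by simp }
  have hΨ : ∀ v, HEq (Ψ v) (H.map v) := fun v =>
    (conj_eqToHom_iff_heq (Ψ v) (H.map v) (hobj x).symm (hobj y).symm).1 rfl
  refine ⟨Ψ, fun v => ?_, ?_⟩
  · refine eq_of_heq ((hF.heq_fst (hobj x).symm (hobj y).symm (hΨ v)).trans ?_)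
    exact Functor.hcongr_hom h2 v
  · intro x' y' hx hy u z w hz hz' hw hw'
    have e : HEq (Ψ (eqToHom hx.symm ≫ F.map u ≫ eqToHom hy)) (hF.toOrbits.map u) := by
      refine (hΨ _).trans (HEq.trans ?_ (Functor.hcongr_hom h1 u))
      rw [H.map_comp, H.map_comp, eqToHom_map, eqToHom_map]
      exact (conj_eqToHom_iff_heq _ _ _ (congrArg H.obj hy).symm).1 rfl
    exact hF.snd_eq_of_heq (hF.orbitOf_eq_iff_obj.2 hx.symm) (hF.orbitOf_eq_iff_obj.2 hy.symm)
      e z w hz hz' hw hw'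

/-- The functor `F` on a morphism between given objects of two fibres. -/
def mapOver (F : E ⥤ B) {b b' : B} (x : {x : E // F.obj x = b}) (y : {y : E // F.obj y = b'})
    (u : x.1 ⟶ y.1) : b ⟶ b' :=
  eqToHom x.2.symm ≫ F.map u ≫ eqToHom y.2

/-- The objects in the fibre of `F.obj x` are those in the orbit of `x`. -/
def fiberEquiv (x : E) : {z : E // F.obj z = F.obj x} ≃ hF.Fiber (hF.orbitOf x) :=
  Equiv.subtypeEquivRight fun _ => hF.orbitOf_eq_iff_obj.symm

/-- Every morphism of `B` is the image of a matrix of morphisms of `E`, both along the rows and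
along the columns. -/
theorem exists_matrix {b b' : B} [Fintype {x : E // F.obj x = b}]
    [Fintype {x : E // F.obj x = b'}] (v : b ⟶ b') :
    ∃ u : ∀ (x : {x : E // F.obj x = b}) (y : {y : E // F.obj y = b'}), x.1 ⟶ y.1,
      (∀ x, ∑ y, mapOver F x y (u x y) = v) ∧ ∀ y, ∑ x, mapOver F x y (u x y) = v := by
  obtain ⟨x₀, rfl⟩ := hF.surjective_obj b
  obtain ⟨y₀, rfl⟩ := hF.surjective_obj b'
  obtain ⟨Ψ, h1, -⟩ := hF.exists_lift x₀ y₀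
  refine ⟨fun x y => (Ψ v).1.2 (hF.fiberEquiv x₀ x) (hF.fiberEquiv y₀ y), fun x => ?_,
    fun y => ?_⟩
  · refine Eq.trans ?_ (((Ψ v).2.1 (hF.fiberEquiv x₀ x)).trans (h1 v))
    exact Fintype.sum_equiv (hF.fiberEquiv y₀) _ _ fun y => rfl
  · refine Eq.trans ?_ (((Ψ v).2.2 (hF.fiberEquiv y₀ y)).trans (h1 v))
    exact Fintype.sum_equiv (hF.fiberEquiv x₀) _ _ fun y => rfl

/-- The columns of a matrix of morphisms of `E` are determined by their image. -/
theorem column_eq_zero {b b' : B} [Fintype {x : E // F.obj x = b}] (y : {y : E // F.obj y = b'})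
    (u : ∀ x : {x : E // F.obj x = b}, x.1 ⟶ y.1) (hu : ∑ x, mapOver F x y (u x) = 0)
    (x : {x : E // F.obj x = b}) : u x = 0 := by
  classical
  obtain ⟨y, rfl⟩ := y
  obtain ⟨x, rfl⟩ := x
  obtain ⟨Ψ, -, h2⟩ := hF.exists_lift x y
  -- `φ` reads the entry at `(x, y)` of the matrix attached to a morphism of `B`. It returns `u` on
  -- `F u` when `u` starts at `x`, and zero when `u` goes from another object of the fibre to `y`,
  -- by freeness. Applied to the column sum, it isolates one entry.
  let φ : (F.obj x ⟶ F.obj y) →+ (x ⟶ y) :=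
    { toFun := fun v => (Ψ v).1.2 ⟨x, rfl⟩ ⟨y, rfl⟩
      map_zero' := by rw [map_zero]; rfl
      map_add' := fun v w => by rw [map_add]; rfl }
  have h3 := congrArg φ hu
  rw [map_sum, map_zero, Finset.sum_eq_single ⟨x, rfl⟩] at h3
  · rw [← h3]
    refine Eq.trans ?_ (h2 x y rfl rfl (u ⟨x, rfl⟩) x y rfl rfl rfl rfl).symm
    rw [hF.translates_of_eq _ 1 (ρ.act_one_obj x) (ρ.act_one_obj y)]
    exact (eqToHom_comp_eq_of_heq _ _ (ρ.heq_act_one _)).symm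
  · rintro ⟨x', hx'⟩ - hne
    have h4 := hF.orbitOf_eq_iff_obj.2 hx'
    refine (h2 x' y hx' rfl (u ⟨x', hx'⟩) x y rfl h4.symm rfl rfl).trans ?_
    obtain ⟨g, hg⟩ := hF.exists_act_eq hx'
    refine hF.translates_of_ne _ g hg fun h => hne ?_
    obtain rfl := hF.free g y h
    exact Subtype.ext ((ρ.act_one_obj x').symm.trans hg)
  · simp

end

end IsGaloisCovering

end OrbitCategory

/-! ### Push-down modules -/

section PushDown

variable {k : Type u} [Field k] {G : Type w} [Group G]
variable {E : Type u} [Category.{u} E] [Preadditive E] [Linear k E]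
variable {B : Type u} [Category.{u} B] [Preadditive B] [Linear k B]
variable {ρ : CatAction k G E} {F : E ⥤ B}

/-- The objects of `E` above an object of `B`. -/
abbrev Fib (F : E ⥤ B) (b : B) : Type u := {x : E // F.obj x = b}

omit [Preadditive E] [Preadditive B] in
lemma mapOver_self {x y : E} (u : x ⟶ y) :
    IsGaloisCovering.mapOver F ⟨x, rfl⟩ ⟨y, rfl⟩ u = F.map u :=
  (Category.id_comp _).trans (Category.comp_id _)

namespace IsGaloisCovering

variable (hF : IsGaloisCovering k ρ F)
include hF

/-- The pull-up along a Galois covering. -/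
abbrev pull : LinMod k B ⥤ LinMod k E := pullUpFunctor F hF.additive hF.linear

/-- The translate of an object above `b`. -/
def actFib (g : G) {b : B} (z : Fib F b) : Fib F b :=
  ⟨(ρ.act g).obj z.1, (hF.obj_act g z.1).trans z.2⟩

lemma actFib_injective (g : G) {b : B} {z w : Fib F b} (h : hF.actFib g z = hF.actFib g w) :
    z = w := by
  have h1 : (ρ.act g).obj z.1 = (ρ.act g).obj w.1 := congrArg Subtype.val h
  have h2 := congrArg (ρ.act g⁻¹).obj h1
  rw [← ρ.act_mul_obj, ← ρ.act_mul_obj, inv_mul_cancel, ρ.act_one_obj, ρ.act_one_obj] at h2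
  exact Subtype.ext h2

lemma mapOver_act (g : G) {b b' : B} (z : Fib F b) (w : Fib F b') (u : z.1 ⟶ w.1) :
    mapOver F (hF.actFib g z) (hF.actFib g w) ((ρ.act g).map u) = mapOver F z w u := by
  obtain ⟨z, rfl⟩ := z
  obtain ⟨w, rfl⟩ := w
  exact (eqToHom_comp_eq_of_heq _ _ (hF.heq_map_act g u)).trans (mapOver_self u).symm

lemma mapOver_sub {b b' : B} (z : Fib F b) (w : Fib F b') (u v : z.1 ⟶ w.1) :
    mapOver F z w (u - v) = mapOver F z w u - mapOver F z w v := by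
  have := hF.additive
  simp [mapOver, Preadditive.sub_comp, Preadditive.comp_sub]

lemma mapOver_zero {b b' : B} (z : Fib F b) (w : Fib F b') :
    mapOver F z w 0 = 0 := by
  have := hF.additive
  simp [mapOver]

variable [Finite G]

lemma finite_fib (b : B) : Finite (Fib F b) := by
  obtain ⟨x, rfl⟩ := hF.surjective_obj b
  exact Finite.of_equiv _ (hF.fiberEquiv x).symm

lemma bijective_actFib (x : E) :
    Function.Bijective fun g => hF.actFib g (⟨x, rfl⟩ : Fib F (F.obj x)) := by
  refine ⟨fun g h e => hF.act_injective (x := x) (congrArg Subtype.val e), fun z => ?_⟩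
  obtain ⟨g, hg⟩ := hF.exists_act_eq z.2.symm
  exact ⟨g, Subtype.ext hg⟩

lemma finite_domain [Finite B] : Finite E := by
  choose s hs using hF.surjective_obj
  refine Finite.of_surjective (fun p : B × G => (ρ.act p.2).obj (s p.1)) fun x => ?_
  obtain ⟨g, hg⟩ := hF.exists_act_eq (hs (F.obj x))
  exact ⟨(F.obj x, g), hg⟩

lemma column_unique {b b' : B} [Fintype (Fib F b)] (w : Fib F b') {c c' : ∀ z : Fib F b, z.1 ⟶ w.1}
    (h : ∑ z, mapOver F z w (c z) = ∑ z, mapOver F z w (c' z)) : c = c' := by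
  funext z
  refine sub_eq_zero.1 (hF.column_eq_zero w (fun z => c z - c' z) ?_ z)
  simp only [hF.mapOver_sub]
  rw [Finset.sum_sub_distrib, h, sub_self]

end IsGaloisCovering

/-- The inclusions and projections exhibiting `N` as the push-down of `L`. -/
structure PushDownData (F : E ⥤ B) [∀ b, Fintype (Fib F b)] (L : LinMod k E) (N : LinMod k B) where
  incl {b : B} (z : Fib F b) : L.obj.obj z.1 →ₗ[k] N.obj.obj b
  proj {b : B} (z : Fib F b) : N.obj.obj b →ₗ[k] L.obj.obj z.1
  proj_incl {b : B} (z : Fib F b) (a : L.obj.obj z.1) : proj z (incl z a) = a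
  proj_incl_of_ne {b : B} {z w : Fib F b} (h : w ≠ z) (a : L.obj.obj z.1) : proj w (incl z a) = 0
  sum_incl_proj {b : B} (m : N.obj.obj b) : ∑ z : Fib F b, incl z (proj z m) = m
  incl_naturality {b b' : B} (z : Fib F b) (w : Fib F b') (u : z.1 ⟶ w.1) (a : L.obj.obj z.1) :
    incl w ((L.obj.map u).hom a) =
      (N.obj.map (IsGaloisCovering.mapOver F z w u)).hom (incl z a)

variable [∀ b, Fintype (Fib F b)]

lemma IsPushDown.nonempty_data {L : LinMod k E} {N : LinMod k B} (h : IsPushDown F L N) :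
    Nonempty (PushDownData F L N) := by
  classical
  obtain ⟨j, hj⟩ := h
  let incl {b : B} (z : Fib F b) : L.obj.obj z.1 →ₗ[k] N.obj.obj b :=
    (N.obj.map (eqToHom z.2)).hom ∘ₗ (j.app z.1).hom
  let φ (b : B) : DirectSum (Fib F b) (fun z => L.obj.obj z.1) ≃ₗ[k] N.obj.obj b :=
    LinearEquiv.ofBijective _ (hj b)
  have hφ : ∀ {b : B} (z : Fib F b) (a : L.obj.obj z.1),
      φ b (DirectSum.lof k _ (fun z : Fib F b => L.obj.obj z.1) z a) = incl z a := by
    intro b z a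
    simp [φ, incl]
  have hφ' : ∀ {b : B} (z : Fib F b) (a : L.obj.obj z.1),
      (φ b).symm (incl z a) = DirectSum.lof k _ (fun z : Fib F b => L.obj.obj z.1) z a := by
    intro b z a
    rw [← hφ, LinearEquiv.symm_apply_apply]
  refine ⟨⟨incl, fun {b} z => DirectSum.component k _ _ z ∘ₗ (φ b).symm.toLinearMap, ?_, ?_, ?_,
    ?_⟩⟩
  · intro b z a
    simp [hφ', DirectSum.component.lof_self]
  · intro b z w h a
    simp only [LinearMap.comp_apply, LinearEquiv.coe_coe, hφ']
    rw [DirectSum.component.of, dif_neg h.symm]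
  · intro b m
    obtain ⟨r, rfl⟩ := (φ b).surjective m
    simp only [LinearMap.comp_apply, LinearEquiv.coe_coe, LinearEquiv.symm_apply_apply, ← hφ]
    rw [← map_sum]
    congr 1
    refine DirectSum.ext_component k fun z => ?_
    rw [map_sum, Finset.sum_eq_single z]
    · exact DirectSum.component.lof_self k z _
    · intro w _ hw
      rw [DirectSum.component.of, dif_neg hw]
    · simp
  · rintro b b' ⟨z, rfl⟩ ⟨w, rfl⟩ u a
    rw [mapOver_self]
    have h1 := congrArg (fun t => t.hom a) (j.naturality u)
    change (N.obj.map (𝟙 _)).hom _ = (N.obj.map _).hom ((N.obj.map (𝟙 _)).hom _)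
    rw [map_id_hom, map_id_hom]
    exact h1

namespace PushDownData

variable {L L' L'' : LinMod k E} {N N' N'' : LinMod k B} (d : PushDownData F L N)
  (d' : PushDownData F L' N') (d'' : PushDownData F L'' N'')

lemma map_incl {b b' : B} (v : b ⟶ b') (z : Fib F b) (r : ∀ w : Fib F b', z.1 ⟶ w.1)
    (hr : ∑ w, IsGaloisCovering.mapOver F z w (r w) = v) (a : L.obj.obj z.1) :
    (N.obj.map v).hom (d.incl z a) = ∑ w, d.incl w ((L.obj.map (r w)).hom a) := by
  simp only [d.incl_naturality]
  rw [← hr, map_sum_hom]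

lemma proj_sum_incl {b : B} (w : Fib F b) (a : ∀ z : Fib F b, L.obj.obj z.1) :
    d.proj w (∑ z, d.incl z (a z)) = a w := by
  rw [map_sum, Finset.sum_eq_single w, d.proj_incl]
  · intro z _ hz
    exact d.proj_incl_of_ne hz.symm _
  · simp

section Galois

variable [Finite G] (hF : IsGaloisCovering k ρ F)
include hF

/-- Expanding along the rows of one matrix lifting `v` leaves its column at `w`. A column is
determined by its sum, so any `c` with the right sum may be used. -/
lemma proj_map {b b' : B} (v : b ⟶ b') (w : Fib F b') (c : ∀ z : Fib F b, z.1 ⟶ w.1)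
    (hc : ∑ z, IsGaloisCovering.mapOver F z w (c z) = v) (m : N.obj.obj b) :
    d.proj w ((N.obj.map v).hom m) = ∑ z, (L.obj.map (c z)).hom (d.proj z m) := by
  obtain ⟨u, h1, h2⟩ := hF.exists_matrix v
  obtain rfl : (fun z => u z w) = c := hF.column_unique w ((h2 w).trans hc.symm)
  conv_lhs => rw [← d.sum_incl_proj m, map_sum]
  simp only [fun z => d.map_incl v z _ (h1 z)]
  rw [Finset.sum_comm]
  simp only [← map_sum]
  exact d.proj_sum_incl w _

/-- The inclusion of a module into the pull-up of its push-down. -/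
def unit : L ⟶ hF.pull.obj N :=
  mkHom (fun x => d.incl (⟨x, rfl⟩ : Fib F (F.obj x))) fun {x y} u a => by
    have := d.incl_naturality ⟨x, rfl⟩ ⟨y, rfl⟩ u a
    rw [mapOver_self] at this
    exact this

/-- The projection from the pull-up of the push-down of a module. -/
def counit : hF.pull.obj N ⟶ L :=
  mkHom (fun x => d.proj (⟨x, rfl⟩ : Fib F (F.obj x))) fun {x y} u m => by
    classical
    -- The column with single nonzero entry `u` at `x` has sum `F.map u`.
    have h := d.proj_map hF (F.map u) ⟨y, rfl⟩ (Pi.single (⟨x, rfl⟩ : Fib F (F.obj x)) u) ?_ m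
    · refine h.trans ?_
      rw [Finset.sum_eq_single ⟨x, rfl⟩, Pi.single_eq_same]
      · rfl
      · intro z _ hz
        have := L.property.1
        rw [Pi.single_eq_of_ne hz, Functor.map_zero]
        rfl
      · simp
    · rw [Finset.sum_eq_single ⟨x, rfl⟩, Pi.single_eq_same, mapOver_self]
      · intro z _ hz
        rw [Pi.single_eq_of_ne hz, hF.mapOver_zero]
      · simp

lemma unit_counit : d.unit hF ≫ d.counit hF = 𝟙 L :=
  hom_ext_homAt fun x a => d.proj_incl (⟨x, rfl⟩ : Fib F (F.obj x)) a

/-- The retraction of the pull-up of the push-down. -/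
def retract : Retract L (hF.pull.obj N) :=
  ⟨d.unit hF, d.counit hF, d.unit_counit hF⟩

/-- The existence half of the adjunction making push-down right adjoint to pull-up. The lift adds up
the components of `f` over each fibre: rows and columns of one matrix give its naturality. -/
lemma exists_lift {X : LinMod k B} (f : hF.pull.obj X ⟶ L) :
    ∃ f' : X ⟶ N, hF.pull.map f' ≫ d.counit hF = f := by
  let fz {b : B} (z : Fib F b) : X.obj.obj b →ₗ[k] L.obj.obj z.1 :=
    homAt f z.1 ∘ₗ (X.obj.map (eqToHom z.2.symm)).hom
  have hfz : ∀ {b b' : B} (z : Fib F b) (w : Fib F b') (u : z.1 ⟶ w.1) (m : X.obj.obj b),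
      fz w ((X.obj.map (IsGaloisCovering.mapOver F z w u)).hom m) =
        (L.obj.map u).hom (fz z m) := by
    rintro b b' ⟨z, rfl⟩ ⟨w, rfl⟩ u m
    rw [mapOver_self]
    change homAt f w ((X.obj.map (𝟙 _)).hom _) =
      (L.obj.map u).hom (homAt f z ((X.obj.map (𝟙 _)).hom m))
    rw [map_id_hom, map_id_hom]
    exact homAt_naturality f u m
  let f' : X ⟶ N := mkHom (fun b => ∑ z : Fib F b, d.incl z ∘ₗ fz z) fun {b b'} v m => by
    obtain ⟨u, h1, h2⟩ := hF.exists_matrix v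
    simp only [LinearMap.sum_apply, LinearMap.comp_apply, map_sum]
    simp only [fun z => d.map_incl v z _ (h1 z)]
    rw [Finset.sum_comm]
    refine Finset.sum_congr rfl fun w _ => ?_
    rw [← map_sum]
    congr 1
    rw [← h2 w, map_sum_hom, map_sum]
    exact Finset.sum_congr rfl fun z _ => hfz z w _ m
  refine ⟨f', hom_ext_homAt fun x m => ?_⟩
  change d.proj (⟨x, rfl⟩ : Fib F (F.obj x)) ((∑ z : Fib F (F.obj x), d.incl z ∘ₗ fz z) m) = _
  refine (congrArg (d.proj (⟨x, rfl⟩ : Fib F (F.obj x))) (LinearMap.sum_apply _ _ _)).trans ?_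
  refine (d.proj_sum_incl ⟨x, rfl⟩ fun z => fz z m).trans ?_
  exact congrArg (homAt f x) (map_id_hom X m)

/-- The functoriality of the push-down. -/
def map (φ : L ⟶ L') : N ⟶ N' :=
  mkHom (fun b => ∑ z : Fib F b, d'.incl z ∘ₗ homAt φ z.1 ∘ₗ d.proj z) fun {b b'} v m => by
    obtain ⟨u, h1, h2⟩ := hF.exists_matrix v
    simp only [LinearMap.sum_apply, LinearMap.comp_apply, map_sum]
    simp only [fun z => d'.map_incl v z _ (h1 z)]
    rw [Finset.sum_comm]
    refine Finset.sum_congr rfl fun w _ => ?_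
    rw [← map_sum]
    congr 1
    rw [d.proj_map hF v w _ (h2 w), map_sum]
    exact Finset.sum_congr rfl fun z _ => homAt_naturality φ _ _

lemma homAt_map (φ : L ⟶ L') {b : B} (m : N.obj.obj b) :
    homAt (map d d' hF φ) b m = ∑ z : Fib F b, d'.incl z (homAt φ z.1 (d.proj z m)) := by
  refine (LinearMap.sum_apply _ _ _).trans ?_
  rfl

lemma map_id : map d d hF (𝟙 L) = 𝟙 N :=
  hom_ext_homAt fun b m => by
    rw [homAt_map]
    exact d.sum_incl_proj m

lemma map_comp (φ : L ⟶ L') (ψ : L' ⟶ L'') :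
    map d d'' hF (φ ≫ ψ) = map d d' hF φ ≫ map d' d'' hF ψ :=
  hom_ext_homAt fun b m => by
    simp only [homAt_comp, homAt_map]
    refine Finset.sum_congr rfl fun z _ => ?_
    rw [d'.proj_sum_incl z fun z => homAt φ z.1 (d.proj z m)]

lemma map_zero' : map d d' hF 0 = 0 :=
  hom_ext_homAt fun b m => by
    simp [homAt_map]

lemma map_injective {φ ψ : L ⟶ L'} (h : map d d' hF φ = map d d' hF ψ) : φ = ψ := by
  refine hom_ext_homAt fun x a => ?_
  have h1 := congrArg (fun t => d'.proj (⟨x, rfl⟩ : Fib F (F.obj x))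
    (homAt t (F.obj x) (d.incl (⟨x, rfl⟩ : Fib F (F.obj x)) a))) h
  dsimp only at h1
  rw [homAt_map, homAt_map,
    d'.proj_sum_incl ⟨x, rfl⟩ fun z => homAt φ z.1 (d.proj z (d.incl ⟨x, rfl⟩ a)),
    d'.proj_sum_incl ⟨x, rfl⟩ fun z => homAt ψ z.1 (d.proj z (d.incl ⟨x, rfl⟩ a)),
    d.proj_incl] at h1
  exact h1

/-- The push-downs of isomorphic modules are isomorphic. -/
def mapIso (e : L ≅ L') : N ≅ N' where
  hom := map d d' hF e.hom
  inv := map d' d hF e.inv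
  hom_inv_id := by rw [← map_comp, e.hom_inv_id, map_id]
  inv_hom_id := by rw [← map_comp, e.inv_hom_id, map_id]

-- Push-down on morphisms is faithful and functorial, so an idempotent of `L` is trivial as soon as
-- its image on `N` is.
include d in
lemma hasTrivialIdempotents (hN : HasTrivialIdempotents N) : HasTrivialIdempotents L := by
  intro e he
  rcases hN (map d d hF e) (by rw [← map_comp, he]) with h | h
  · exact Or.inl (map_injective d d hF (h.trans (d.map_zero' d hF).symm))
  · exact Or.inr (map_injective d d hF (h.trans (d.map_id hF).symm))

/-- A push-down of `L` is also a push-down of the twists of `L`. -/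
def twist (g : G) : PushDownData F ((ρ.twist g).obj L) N where
  incl z := d.incl (hF.actFib g z)
  proj z := d.proj (hF.actFib g z)
  proj_incl z a := d.proj_incl (hF.actFib g z) a
  proj_incl_of_ne {b z w} h a :=
    d.proj_incl_of_ne (fun h' => h (hF.actFib_injective g h')) a
  sum_incl_proj {b} m := by
    have hb : Function.Bijective (hF.actFib g : Fib F b → Fib F b) :=
      Finite.injective_iff_bijective.1 fun _ _ => hF.actFib_injective g
    exact (hb.sum_comp fun z => d.incl z (d.proj z m)).trans (d.sum_incl_proj m)
  incl_naturality z w u a := by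
    have := d.incl_naturality (hF.actFib g z) (hF.actFib g w) ((ρ.act g).map u) a
    rw [hF.mapOver_act] at this
    exact this

/-- Each fibre is a torsor under `G`, so the fibrewise inclusions and projections reorganize into a
decomposition of the pull-up of `N` indexed by `G`; this is the orthogonality part. -/
lemma unit_counit_twist_of_ne {g h : G} (hgh : g ≠ h) :
    (d.twist hF g).unit hF ≫ (d.twist hF h).counit hF = 0 := by
  refine hom_ext_homAt fun x a => ?_
  refine d.proj_incl_of_ne (z := hF.actFib g (⟨x, rfl⟩ : Fib F (F.obj x)))
    (w := hF.actFib h ⟨x, rfl⟩) (fun e => hgh ?_) a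
  exact ((hF.bijective_actFib x).1 e).symm

lemma sum_counit_unit_twist [Fintype G] :
    ∑ g, (d.twist hF g).counit hF ≫ (d.twist hF g).unit hF = 𝟙 _ := by
  refine hom_ext_homAt fun x m => ?_
  rw [homAt_sum]
  exact ((hF.bijective_actFib x).sum_comp fun z => d.incl z (d.proj z m)).trans
    (d.sum_incl_proj m)

end Galois

include d in
lemma isZero_of_isZero (hL : IsZero L) : IsZero N := by
  refine (isZero_iff N).2 fun b m => ?_
  rw [← d.sum_incl_proj m]
  refine Finset.sum_eq_zero fun z _ => ?_
  rw [(isZero_iff L).1 hL z.1 (d.proj z m), _root_.map_zero]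

include d in
lemma isPointwiseFinite (hN : IsPointwiseFinite N) : IsPointwiseFinite L := fun x => by
  have := hN (F.obj x)
  exact Module.Finite.of_injective (d.incl (⟨x, rfl⟩ : Fib F (F.obj x)))
    (Function.LeftInverse.injective (d.proj_incl (⟨x, rfl⟩ : Fib F (F.obj x))))

end PushDownData

end PushDown

/-! ### Recognition of finite biproducts -/

section Biproduct

variable {D : Type*} [Category* D] [Preadditive D] [HasFiniteBiproducts D]

lemma nonempty_iso_biproduct {J : Type} [Fintype J] {X : D} (Y : J → D)
    (i : ∀ j, Y j ⟶ X) (p : ∀ j, X ⟶ Y j) (h₁ : ∀ j, i j ≫ p j = 𝟙 _)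
    (h₂ : ∀ j j', j ≠ j' → i j ≫ p j' = 0) (h₃ : ∑ j, p j ≫ i j = 𝟙 X) :
    Nonempty (X ≅ ⨁ Y) := by
  refine ⟨⟨biproduct.lift p, biproduct.desc i, by rw [biproduct.lift_desc, h₃], ?_⟩⟩
  refine biproduct.hom_ext' _ _ fun j => biproduct.hom_ext _ _ fun j' => ?_
  simp only [biproduct.ι_desc_assoc, Category.assoc, biproduct.lift_π, Category.comp_id]
  by_cases h : j = j'
  · subst h
    rw [h₁, biproduct.ι_π_self]
  · rw [h₂ j j' h, biproduct.ι_π_ne _ h]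

end Biproduct

/-! ### Transport of coresolutions along exact functors -/

section Coresolution

variable {k : Type u} [Field k]
variable {E : Type u} [Category.{u} E] [Preadditive E] [Linear k E]
variable {B : Type u} [Category.{u} B] [Preadditive B] [Linear k B]

lemma IsSummand.map {N M : LinMod k B} (h : IsSummand N M) (Φ : LinMod k B ⥤ LinMod k E)
    [Φ.Additive] : IsSummand (Φ.obj N) (Φ.obj M) := by
  obtain ⟨N', ⟨e⟩⟩ := h
  have := preservesBinaryBiproducts_of_preservesBiproducts Φ
  exact ⟨Φ.obj N', ⟨Φ.mapIso e ≪≫ Φ.mapBiprod N N'⟩⟩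

lemma InAdd.map {T X : LinMod k B} (h : InAdd T X) (Φ : LinMod k B ⥤ LinMod k E)
    [Φ.Additive] : InAdd (Φ.obj T) (Φ.obj X) := by
  obtain ⟨m, N, hN, ⟨e⟩⟩ := h
  exact ⟨m, fun i => Φ.obj (N i), fun i => (hN i).map Φ, ⟨Φ.mapIso e ≪≫ Φ.mapBiproduct N⟩⟩

lemma HasAddCoresolution.map {T X : LinMod k B} (h : HasAddCoresolution T X)
    (Φ : LinMod k B ⥤ LinMod k E) [Φ.Additive] [PreservesFiniteLimits Φ]
    [PreservesFiniteColimits Φ] : HasAddCoresolution (Φ.obj T) (Φ.obj X) := by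
  induction h with
  | of_inAdd X hX => exact .of_inAdd _ (hX.map Φ)
  | splice f g w hS hY _ ih =>
    exact .splice (Φ.map f) (Φ.map g) _ (hS.map_of_exact Φ) (hY.map Φ) ih

lemma HasAddCoresolution.of_iso {T X X' : LinMod k B} (h : HasAddCoresolution T X) (e : X' ≅ X) :
    HasAddCoresolution T X' := by
  cases h with
  | of_inAdd _ hX =>
    obtain ⟨m, N, hN, ⟨e'⟩⟩ := hX
    exact .of_inAdd _ ⟨m, N, hN, ⟨e ≪≫ e'⟩⟩
  | splice f g w hS hY hZ =>
    refine .splice (e.hom ≫ f) g (by rw [Category.assoc, w, comp_zero])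
      (ShortComplex.shortExact_of_iso ?_ hS) hY hZ
    exact ShortComplex.isoMk e.symm (Iso.refl _) (Iso.refl _)

end Coresolution

/-! ### Homological behaviour of the pull-up along a covering -/

section Covering

variable {k : Type u} [Field k] {G : Type w} [Group G]
variable {E : Type u} [Category.{u} E] [Preadditive E] [Linear k E]
variable {B : Type u} [Category.{u} B] [Preadditive B] [Linear k B]
variable {ρ : CatAction k G E} {F : E ⥤ B}

namespace IsGaloisCovering

variable (hF : IsGaloisCovering k ρ F) [Finite G]
include hF

/-- The morphisms to `x` from all objects above `b` form the columns over `x`, and taking column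
sums identifies them with the morphisms from `b` to `F x`: injectively by `column_eq_zero`,
surjectively by `exists_matrix`. -/
lemma nonempty_reg_iso :
    Nonempty (regularModule k E ≅ hF.pull.obj (regularModule k B)) := by
  classical
  have hfin := hF.finite_fib
  have := fun b => Fintype.ofFinite (Fib F b)
  have := hF.additive
  have := hF.linear
  let n : regularModule k E ⟶ hF.pull.obj (regularModule k B) :=
    regDesc fun z => regOf k (𝟙 (F.obj z))
  have hn : ∀ {z x : E} (a : z ⟶ x), homAt n x (regOf k a) = regOf k (F.map a) := by
    intro z x a
    refine (regDesc_regOf _ a).trans ?_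
    refine (regOf_map (𝟙 (F.obj z)) (F.map a)).trans ?_
    rw [Category.id_comp]
  let n' (x : E) : (DirectSum E fun z => (z ⟶ x)) →ₗ[k] DirectSum B fun b => (b ⟶ F.obj x) :=
    homAt n x
  have hn' : ∀ {z x : E} (a : z ⟶ x), n' x (DirectSum.lof k E (fun z => (z ⟶ x)) z a) =
      DirectSum.lof k B (fun b => (b ⟶ F.obj x)) (F.obj z) (F.map a) := fun a => hn a
  have hc : ∀ (x : E) (b : B) (r : DirectSum E fun z => (z ⟶ x)),
      DirectSum.component k B (fun y => (y ⟶ F.obj x)) b (n' x r) =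
        ∑ z : Fib F b, mapOver F z ⟨x, rfl⟩ (r z.1) := by
    intro x b r
    let lift (z : Fib F b) : (z.1 ⟶ x) →ₗ[k] (b ⟶ F.obj x) :=
      { toFun := mapOver F z ⟨x, rfl⟩
        map_add' := fun a a' => by simp [mapOver]
        map_smul' := fun c a => by simp [mapOver] }
    have h : DirectSum.component k B (fun y => (y ⟶ F.obj x)) b ∘ₗ n' x =
        ∑ z : Fib F b, lift z ∘ₗ DirectSum.component k E (fun z => (z ⟶ x)) z.1 := by
      refine DirectSum.linearMap_ext _ fun z => LinearMap.ext fun a => ?_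
      simp only [LinearMap.comp_apply, LinearMap.sum_apply, hn']
      by_cases h : F.obj z = b
      · subst h
        rw [DirectSum.component.lof_self, Finset.sum_eq_single ⟨z, rfl⟩,
          DirectSum.component.lof_self]
        · exact (mapOver_self a).symm
        · intro z' _ hz'
          rw [DirectSum.component.of, dif_neg fun h => hz' (Subtype.ext h.symm), map_zero]
        · simp
      · rw [DirectSum.component.of, dif_neg h]
        refine (Finset.sum_eq_zero fun z' _ => ?_).symm
        rw [DirectSum.component.of, dif_neg, map_zero]
        rintro rfl
        exact h z'.2
    refine (LinearMap.congr_fun h r).trans (LinearMap.sum_apply _ _ _)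
  have hb : ∀ x, Function.Bijective (homAt n x) := by
    intro x
    constructor
    · refine (injective_iff_map_eq_zero _).2 fun (r : DirectSum E fun z => (z ⟶ x)) hr => ?_
      refine DFinsupp.ext fun z => ?_
      have h := hc x (F.obj z) r
      rw [show n' x r = 0 from hr, map_zero] at h
      exact hF.column_eq_zero (⟨x, rfl⟩ : Fib F (F.obj x)) (fun z' : Fib F (F.obj z) => r z'.1)
        h.symm ⟨z, rfl⟩
    · intro r
      change DirectSum B fun y => (y ⟶ F.obj x) at r
      induction r using DirectSum.induction_on with
      | zero => exact ⟨0, map_zero _⟩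
      | add a b ha hb =>
        obtain ⟨a', rfl⟩ := ha
        obtain ⟨b', rfl⟩ := hb
        exact ⟨a' + b', map_add _ _ _⟩
      | of b v =>
        obtain ⟨u, -, h⟩ := hF.exists_matrix v
        refine ⟨∑ z : Fib F b, regOf k (u z ⟨x, rfl⟩), ?_⟩
        have h1 : ∀ z : Fib F b, homAt n x (regOf k (u z ⟨x, rfl⟩)) =
            DirectSum.lof k B (fun b => (b ⟶ F.obj x)) b (mapOver F z ⟨x, rfl⟩ (u z ⟨x, rfl⟩)) := by
          rintro ⟨z, rfl⟩
          rw [mapOver_self]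
          exact hn _
        refine (map_sum _ _ _).trans ((Finset.sum_congr rfl fun z _ => h1 z).trans ?_)
        exact (map_sum _ _ _).symm.trans
          (congrArg (DirectSum.lof k B (fun b => (b ⟶ F.obj x)) b) (h ⟨x, rfl⟩))
  have := isIso_of_bijective n hb
  exact ⟨asIso n⟩

section

lemma projective_pull_of_isInAdd {Q : LinMod k B} (hQ : IsInAdd (regularModule k B) Q) :
    Projective (hF.pull.obj Q) := by
  obtain ⟨e⟩ := hF.nonempty_reg_iso
  have : Projective (hF.pull.obj (regularModule k B)) := Projective.of_iso e inferInstance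
  exact (hQ.map hF.pull).projective

variable [Finite B] (hB : IsLocallyBounded k B)
include hB

/-- Syzygies are pulled up one at a time; exactness and projectivity of the middle terms persist. -/
lemma hasProjectiveDimensionLE_pull (n : ℕ) {M : LinMod k B} (hM : IsPointwiseFinite M)
    (h : HasProjectiveDimensionLE M n) : HasProjectiveDimensionLE (hF.pull.obj M) n := by
  induction n generalizing M with
  | zero =>
    have := (projective_iff_hasProjectiveDimensionLE_zero M).2 h
    have := hF.projective_pull_of_isInAdd (isInAdd_of_projective hM)
    exact (projective_iff_hasProjectiveDimensionLE_zero _).1 this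
  | succ n ih =>
    obtain ⟨K, Q, f, g, w, hS, hQ, hK⟩ := exists_syzygy hB hM
    have := hQ.projective
    have hK' : HasProjectiveDimensionLE K n :=
      hS.hasProjectiveDimensionLT_X₁ (n + 1)
        (hasProjectiveDimensionLT_of_ge Q 1 (n + 1) (by lia)) h
    have := hF.projective_pull_of_isInAdd hQ
    exact (hS.map_of_exact hF.pull).hasProjectiveDimensionLT_X₃ (n + 1) (ih hK hK')
      (hasProjectiveDimensionLT_of_ge (hF.pull.obj Q) 1 (n + 2) (by lia))

/-- The `Ext` form of the adjunction. In degree one, a map from the pulled-up syzygy to `L` lifts to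
a map to `N`, extends there, and is pulled back. Higher degrees follow by replacing `X` with its
syzygy, which inherits the hypothesis. -/
lemma ext_pull_eq_zero [∀ b, Fintype (Fib F b)] {L : LinMod k E} {N : LinMod k B}
    (d : PushDownData F L N) (n : ℕ) {X : LinMod k B} (hX : IsPointwiseFinite X)
    (h : letI := HasExt.standard (LinMod k B)
      ∀ i, 0 < i → Subsingleton (Abelian.Ext.{u + 1} X N i)) :
    letI := HasExt.standard (LinMod k E)
    Subsingleton (Abelian.Ext.{u + 1} (hF.pull.obj X) L (n + 1)) := by
  let := HasExt.standard (LinMod k B)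
  let := HasExt.standard (LinMod k E)
  induction n generalizing X with
  | zero =>
    obtain ⟨K, Q, f, g, w, hS, hQ, hK⟩ := exists_syzygy hB hX
    have hS' := hS.map_of_exact hF.pull
    have : Projective ((ShortComplex.mk f g w).map hF.pull).X₂ := hF.projective_pull_of_isInAdd hQ
    refine ext_one_eq_zero_of_extension hS' fun a => ?_
    obtain ⟨a', ha'⟩ := d.exists_lift hF a
    obtain ⟨b, hb⟩ := exists_extension hS (h 1 one_pos) a'
    refine ⟨hF.pull.map b ≫ d.counit hF, ?_⟩
    rw [← ha', ← hb]
    exact (Category.assoc _ _ _).symm.trans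
      (congrArg (· ≫ d.counit hF) (hF.pull.map_comp f b).symm)
  | succ n ih =>
    obtain ⟨K, Q, f, g, w, hS, hQ, hK⟩ := exists_syzygy hB hX
    have hS' := hS.map_of_exact hF.pull
    have := hQ.projective
    have : Projective ((ShortComplex.mk f g w).map hF.pull).X₂ := hF.projective_pull_of_isInAdd hQ
    refine ext_eq_zero_X₃ hS' (add_comm 1 (n + 1)) (ih hK fun i hi => ?_) ?_
    · obtain ⟨i, rfl⟩ := Nat.exists_eq_add_of_lt hi
      refine ext_eq_zero_X₁ hS rfl ?_ (h _ (by lia))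
      exact ⟨fun a b => by
        rw [Abelian.Ext.eq_zero_of_projective a, Abelian.Ext.eq_zero_of_projective b]⟩
    · exact ⟨fun a b => by
        rw [Abelian.Ext.eq_zero_of_projective a, Abelian.Ext.eq_zero_of_projective b]⟩

end

end IsGaloisCovering

end Covering

open Abelian in
lemma ext_eq_zero_right_of_sum {D : Type*} [Category* D] [Abelian D] [HasExt.{w} D] {X Y : D}
    {J : Type*} [Fintype J] (Z : J → D) (a : ∀ j, Y ⟶ Z j) (b : ∀ j, Z j ⟶ Y)
    (hab : ∑ j, a j ≫ b j = 𝟙 Y) {i : ℕ} (h : ∀ j, Subsingleton (Ext.{w} X (Z j) i)) :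
    Subsingleton (Ext.{w} X Y i) := by
  suffices H : ∀ e : Ext.{w} X Y i, e = 0 from ⟨fun a b => by rw [H a, H b]⟩
  intro e
  let φ : (Y ⟶ Y) →+ Ext.{w} X Y i :=
    AddMonoidHom.mk' (fun f => e.comp (Ext.mk₀ f) (add_zero i)) fun f g => by
      rw [Ext.mk₀_add, Ext.comp_add]
  have h0 : φ (𝟙 Y) = e := Ext.comp_mk₀_id e
  rw [← h0, ← hab, map_sum]
  refine Finset.sum_eq_zero fun j _ => ?_
  change e.comp (Ext.mk₀ (a j ≫ b j)) (add_zero i) = 0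
  have := Subsingleton.elim (e.comp (Ext.mk₀ (a j)) (add_zero i)) 0
  rw [← Ext.mk₀_comp_mk₀, ← Ext.comp_assoc_of_third_deg_zero, this, Ext.zero_comp]

/-! ### Composition of twists -/

section Twist

variable {k : Type u} [Field k] {G : Type w} [Group G]
variable {E : Type u} [Category.{u} E] [Preadditive E] [Linear k E] (ρ : CatAction k G E)

namespace CatAction

/-- Twisting is precomposition, so twists compose in the opposite order. -/
lemma twist_mul_obj (g h : G) (M : LinMod k E) :
    (ρ.twist (g * h)).obj M = (ρ.twist h).obj ((ρ.twist g).obj M) := by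
  apply ObjectProperty.FullSubcategory.ext
  change ρ.act (g * h) ⋙ M.obj = ρ.act h ⋙ ρ.act g ⋙ M.obj
  rw [ρ.act_mul, Functor.assoc]

lemma twist_one_obj (M : LinMod k E) : (ρ.twist 1).obj M = M := by
  apply ObjectProperty.FullSubcategory.ext
  change ρ.act 1 ⋙ M.obj = M.obj
  rw [ρ.act_one, Functor.id_comp]

/-- If two twists of a module are isomorphic, then the module is invariant under their quotient. -/
def twistIsoOfIso {g h : G} {M N : LinMod k E} (e : (ρ.twist g).obj M ≅ (ρ.twist h).obj N) :
    (ρ.twist (g * h⁻¹)).obj M ≅ N :=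
  eqToIso (ρ.twist_mul_obj g h⁻¹ M) ≪≫ (ρ.twist h⁻¹).mapIso e ≪≫
    eqToIso (by rw [← ρ.twist_mul_obj h h⁻¹ N, mul_inv_cancel, ρ.twist_one_obj])

end CatAction

end Twist

/-! ### Decomposition of the pull-up into twists -/

section Main

variable {k : Type u} [Field k] {G : Type w} [Group G] [Finite G]
variable {E : Type u} [Category.{u} E] [Preadditive E] [Linear k E]
variable {B : Type u} [Category.{u} B] [Preadditive B] [Linear k B]
variable {ρ : CatAction k G E} {F : E ⥤ B}

namespace IsGaloisCovering

variable (hF : IsGaloisCovering k ρ F)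
include hF

omit [Finite G] in
lemma twist_pull_obj (g : G) (M : LinMod k B) :
    (ρ.twist g).obj (hF.pull.obj M) = hF.pull.obj M := by
  apply ObjectProperty.FullSubcategory.ext
  change ρ.act g ⋙ F ⋙ M.obj = F ⋙ M.obj
  rw [← Functor.assoc, hF.comp_eq]

variable [∀ b, Fintype (Fib F b)]

/-- The pull-up of a direct sum of push-downs is the direct sum of the twists. -/
lemma exists_decomposition [Fintype G] {T : LinMod k B} {t : ℕ} {N : Fin t → LinMod k B}
    (e : T ≅ ⨁ N) {L : Fin t → LinMod k E} (d : ∀ i, PushDownData F (L i) (N i)) :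
    ∃ (inc : ∀ j : Fin t × G, (ρ.twist j.2).obj (L j.1) ⟶ hF.pull.obj T)
      (prj : ∀ j : Fin t × G, hF.pull.obj T ⟶ (ρ.twist j.2).obj (L j.1)),
      (∀ j, inc j ≫ prj j = 𝟙 _) ∧ (∀ j j', j ≠ j' → inc j ≫ prj j' = 0) ∧
        ∑ j, prj j ≫ inc j = 𝟙 _ := by
  have hcomp : ∀ (i i' : Fin t) {X Y : LinMod k E} (a : X ⟶ hF.pull.obj (N i))
      (b : hF.pull.obj (N i') ⟶ Y),
      (a ≫ hF.pull.map (biproduct.ι N i ≫ e.inv)) ≫ hF.pull.map (e.hom ≫ biproduct.π N i') ≫ b =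
        a ≫ hF.pull.map (biproduct.ι N i ≫ biproduct.π N i') ≫ b := by
    intro i i' X Y a b
    rw [Category.assoc, ← Functor.map_comp_assoc]
    simp
  refine ⟨fun j => ((d j.1).twist hF j.2).unit hF ≫ hF.pull.map (biproduct.ι N j.1 ≫ e.inv),
    fun j => hF.pull.map (e.hom ≫ biproduct.π N j.1) ≫ ((d j.1).twist hF j.2).counit hF,
    fun j => ?_, ?_, ?_⟩
  · refine (hcomp _ _ _ _).trans ?_
    rw [biproduct.ι_π_self, CategoryTheory.Functor.map_id, Category.id_comp]
    exact PushDownData.unit_counit _ hF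
  · rintro ⟨i, g⟩ ⟨i', g'⟩ hne
    refine (hcomp _ _ _ _).trans ?_
    by_cases hi : i = i'
    · subst hi
      rw [biproduct.ι_π_self, CategoryTheory.Functor.map_id, Category.id_comp]
      exact (d i).unit_counit_twist_of_ne hF fun h => hne (Prod.ext rfl h)
    · rw [biproduct.ι_π_ne _ hi, Functor.map_zero, zero_comp, comp_zero]
  · have h1 : ∀ i : Fin t, ∑ g : G, (hF.pull.map (e.hom ≫ biproduct.π N i) ≫
        ((d i).twist hF g).counit hF) ≫ ((d i).twist hF g).unit hF ≫
          hF.pull.map (biproduct.ι N i ≫ e.inv) =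
        hF.pull.map (e.hom ≫ (biproduct.π N i ≫ biproduct.ι N i) ≫ e.inv) := by
      intro i
      have h := congrArg (fun a => hF.pull.map (e.hom ≫ biproduct.π N i) ≫ a ≫
        hF.pull.map (biproduct.ι N i ≫ e.inv)) ((d i).sum_counit_unit_twist hF)
      simp only [Preadditive.sum_comp, Preadditive.comp_sum] at h
      refine Eq.trans ?_ (h.trans ?_)
      · simp only [Category.assoc]
      · refine (congrArg (_ ≫ ·) (Category.id_comp _)).trans ?_
        rw [← Functor.map_comp]
        simp only [Category.assoc]
    rw [Fintype.sum_prod_type]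
    refine (Finset.sum_congr rfl fun i _ => h1 i).trans ?_
    rw [← Functor.map_sum, ← Preadditive.comp_sum, ← Preadditive.sum_comp, biproduct.total,
      Category.id_comp, e.hom_inv_id, CategoryTheory.Functor.map_id]

end IsGaloisCovering

end Main

end GaloisTilting

/-! ### The main theorem -/

open GaloisTilting in
theorem lemma7p3 {k : Type u} [Field k] [IsAlgClosed k] {G : Type w} [Group G] [Finite G]
    {A' : Type u} [Category.{u} A'] [Preadditive A'] [Linear k A']
    {A : Type u} [Category.{u} A] [Preadditive A] [Linear k A]
    [Finite A] (hAlb : IsLocallyBounded k A) (hAconn : IsConnectedCat A)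
    (ρ : CatAction k G A') (F : A' ⥤ A) (hF : IsGaloisCovering k ρ F)
    (hA'lb : IsLocallyBounded k A') (hA'conn : IsConnectedCat A')
    (T : LinMod k A) (hT : IsTilting T) (hTbasic : IsBasic T) (hTfirst : IsFirstKind F T) :
    IsTilting (pullUp F hF.additive hF.linear T) ∧
      IsBasic (pullUp F hF.additive hF.linear T) := by
  have := hF.finite_domain
  have hfib := hF.finite_fib
  have := fun b => Fintype.ofFinite (Fib F b)
  have := Fintype.ofFinite G
  have hTfin := (isFinDim_iff T).1 hT.isFinDim
  obtain ⟨t, N, hN, ⟨e⟩, hne⟩ := hTbasic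
  have retN : ∀ i, Retract (N i) T := fun i =>
    ⟨biproduct.ι N i ≫ e.inv, e.hom ≫ biproduct.π N i, by simp⟩
  have hNfin := fun i => (isFinDim_iff (N i)).1 (hN i).1
  choose L hL using fun i => hTfirst (N i) (hN i).2 (nonempty_iso_biprod_of_retract (retN i))
  let d i := (hL i).nonempty_data.some
  let D (j : Fin t × G) := (d j.1).twist hF j.2
  obtain ⟨inc, prj, h1, h2, h3⟩ := hF.exists_decomposition e d
  have htilt : IsTilting (hF.pull.obj T) := by
    refine ⟨(isFinDim_iff _).2 (hTfin.pullUp F hF.additive hF.linear), ?_, fun i hi => ?_, ?_⟩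
    · obtain ⟨n, hn⟩ := hT.finite_pd
      exact ⟨n, hF.hasProjectiveDimensionLE_pull hAlb n hTfin hn⟩
    · let := HasExt.standard (LinMod k A)
      let := HasExt.standard (LinMod k A')
      obtain ⟨i, rfl⟩ := Nat.exists_eq_add_of_lt hi
      rw [zero_add]
      -- Only the second argument is decomposed. Each twist of `L i` still has push-down `N i`, a
      -- summand of `T`, so self-orthogonality of `T` suffices.
      refine ext_eq_zero_right_of_sum _ prj inc h3 fun j => ?_
      exact hF.ext_pull_eq_zero hAlb (D j) i hTfin fun i hi =>
        ((IsInAdd.self T).of_retract (retN j.1)).ext_eq_zero_right (hT.ext_eq_zero i hi)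
    · obtain ⟨e'⟩ := hF.nonempty_reg_iso
      exact (hT.coresolution.map hF.pull).of_iso e'
  refine ⟨htilt, ?_⟩
  have hti : ∀ {L : LinMod k A'} {i} (_ : PushDownData F L (N i)), HasTrivialIdempotents L :=
    fun d => d.hasTrivialIdempotents hF (hasTrivialIdempotents_of_indecomposable (hN _).2)
  have hnz : ∀ {L : LinMod k A'} {i} (_ : PushDownData F L (N i)), ¬ IsZero L :=
    fun d h => (hN _).2.1 (d.isZero_of_isZero h)
  let ε : Fin (Nat.card (Fin t × G)) ≃ Fin t × G := (Finite.equivFin _).symm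
  refine ⟨_, fun l => (ρ.twist (ε l).2).obj (L (ε l).1), fun l => ⟨?_, ?_⟩, ?_, ?_⟩
  · exact (isFinDim_iff _).2 ((D (ε l)).isPointwiseFinite (hNfin _))
  · exact indecomposable_of_hasTrivialIdempotents (hnz (D (ε l))) (hti (D (ε l)))
  · exact nonempty_iso_biproduct _ (fun l => inc (ε l)) (fun l => prj (ε l)) (fun l => h1 _)
      (fun l l' h => h2 _ _ fun h' => h (ε.injective h'))
      ((ε.sum_comp fun j => prj j ≫ inc j).trans h3)
  · rintro l l' hll ⟨f⟩
    refine hll (ε.injective ?_)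
    dsimp only at f
    generalize ε l = j at f ⊢
    generalize ε l' = j' at f ⊢
    obtain ⟨i, g⟩ := j
    obtain ⟨i', g'⟩ := j'
    -- Isomorphic modules have isomorphic push-downs, and the `N i` are pairwise non-isomorphic.
    obtain rfl : i = i' := by
      by_contra hi
      exact hne i i' hi ⟨(D (i, g)).mapIso (D (i', g')) hF f⟩
    -- The pull-up of `T` equals each of its twists, and `f` makes its summand `L i` invariant under
    -- `g * g'⁻¹`.
    have hg := eq_one_of_twist_iso hA'lb ρ hF.free htilt
      (((d i).retract hF).trans ((retN i).map hF.pull)) (hnz (d i)) (hti (d i)) (g * g'⁻¹)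
      (eqToIso (hF.twist_pull_obj _ T)) (ρ.twistIsoOfIso f)
    rw [mul_inv_eq_one.1 hg]
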